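/- **Setting.** Let $\mathbb F_q$ be a finite field, and let $m\ge 3$ and $r$ be integers with $\gcd(m,q)=1$, $r^3\equiv 1\pmod m$ and $r\equiv q^{\epsilon}\pmod m$ for some integer $\epsilon\ge 1$. Let $G=\langle x,y\mid x^m=1,\ y^3=1,\ yx=x^ry\rangle$, a group of order $3m$. A *left $G$-code* is a left ideal $\mathcal C$ of $\mathbb F_q[G]$. It is *self-orthogonal* if $\sum_{g\in G}\xi_g\eta_g=0$ for all $\xi,\eta\in\mathcal C$. Let $\zeta$ be a primitive $m$-th root of unity in an extension of $\mathbb F_q$. The index set $I$ is the set of $q$-cyclotomic cosets $J(i)\subseteq\mathbb Z/m$. For $i\in I$ put $d_i=|J(i)|$, $f_i(x)=\prod_{j\in J(i)}(x-\zeta^j)\in\mathbb F_q[x]$ and $K_i=\mathbb F_q[x]/\langle f_i\rangle$. Let $\theta_i$ be the automorphism $a(x)\mapsto a(x^r)$ of $K_i$, and let $\mathcal R_i=K_i[y;\theta_i]/\langle y^3-1\rangle$, where $ya=\theta_i(a)y$. Let $\varepsilon_i(x)$ be the idempotent of $\mathbb F_q[x]/\langle x^m-1\rangle$ that is $1$ modulo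 $f_i$ and $0$ modulo $(x^m-1)/f_i$. For a left ideal $C_i$ of $\mathcal R_i$ put $\mathcal A_i\Box_{\varphi_i} C_i=\{\varepsilon_i(x)\xi\mid\xi\in C_i\}\subseteq\mathbb F_q[G]$. Let $\mu$ be the involution of $I$ with $J(\mu(i))=-J(i)$. Write $a(x^{-1})\in K_{\mu(i)}$ for the image of $a(x)\in K_i$ under $x\mapsto x^{-1}$. Fix a primitive element $\zeta_i$ of every $K_i$. Call $i$ *$\theta$-trivial* if $rj=j$ for all $j\in J(i)$; then $\theta_i=\mathrm{id}$. Otherwise $\theta_i$ has order $3$ and $3\mid d_i$. Fix a set $T\subseteq I$ that contains exactly one index of each pair $\{i,\mu(i)\}$ with $\mu(i)\ne i$. * If $i$ is $\theta$-trivial and $q^{d_i}\equiv1\pmod 3$, put $\omega_i=\zeta_i^{(q^{d_i}-1)/3}$. * If $i$ is $\theta$-nontrivial, put $Q=q^{d_i/3}$ and let $\mathcal G_i$ be the subgroup of $K_i^\times$ generated by $\zeta_i^{Q-1}$, which has order $1+Q+Q^2$. For $\alpha\in\mathcal G_i$ put $C_{i,2,\alpha}=\mathcal R_i(-\alpha+y)$,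 $C_{i,1,\alpha}=\mathcal R_i(\alpha^{-1}+\theta_i^2(\alpha)y+y^2)$ and $\widehat\alpha=\alpha(x^{-1})^{Q^2+Q}\ (=\alpha(x^{-1})^{-1})$ in $K_{\mu(i)}$. Further put $\phi_{i,\alpha}(X)=X^{Q+1}+\alpha^{Q^2}X+\alpha^{-1}$ and $\psi_{i,\alpha}(X)=\alpha^{Q}X^{Q+1}+\alpha^{-1}X^{Q}+1$. **Theorem.** The self-orthogonal left $G$-codes over $\mathbb F_q$ are exactly the codes $\mathcal C=\bigoplus_{i\in I}\mathcal A_i\Box_{\varphi_i}C_i$ (the sum is direct), where the $C_i$ are left ideals of $\mathcal R_i$ that satisfy (i)–(iv) below; distinct families $(C_i)_i$ give distinct codes. **(i)** $i$ is $\theta$-trivial and $\mu(i)=i$. * If $q\equiv0\pmod 3$: $C_i=\{0\}$ or $C_i=\mathcal R_i(y-1)^2$. * If $q^{d_i}\equiv2\pmod 3$: $C_i=\{0\}$. * If $q^{d_i}\equiv1\pmod 3$ and $\omega_i(x^{-1})=\omega_i(x)$ in $K_i$: $C_i$ is $\{0\}$, $\mathcal R_i(y-1)(y-\omega_i)$ or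 $\mathcal R_i(y-1)(y-\omega_i^2)$. * If $q^{d_i}\equiv1\pmod 3$ and $\omega_i(x^{-1})\ne\omega_i(x)$: $C_i=\{0\}$. **(ii)** $i\in T$ is $\theta$-trivial. Then $C_i=\mathcal R_i\,g(y)$ and $C_{\mu(i)}=\mathcal R_{\mu(i)}\vartheta(y)$, where $(g,\vartheta)$ is one of the following. * If $q\equiv0\pmod 3$ ($10$ pairs of ideals): - $g=y^3-1$: $\vartheta\in\{y^3-1,(y-1)^2,y-1,1\}$ - $g=(y-1)^2$: $\vartheta\in\{y^3-1,(y-1)^2,y-1\}$ - $g=y-1$: $\vartheta\in\{y^3-1,(y-1)^2\}$ - $g=1$: $\vartheta=y^3-1$. * If $q^{d_i}\equiv2\pmod 3$ ($9$ pairs of ideals): - $g=y^3-1$: $\vartheta\in\{y^3-1,y^2+y+1,y-1,1\}$ - $g=y^2+y+1$: $\vartheta\in\{y^3-1,y-1\}$ - $g=y-1$: $\vartheta\in\{y^3-1,y^2+y+1\}$ - $g=1$: $\vartheta=y^3-1$. * If $q^{d_i}\equiv1\pmod 3$ ($27$ pairs of ideals), with $\omega=\omega_i$ and $w=\omega_i(x^{-1})\in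 K_{\mu(i)}$: - $g=y^3-1$: $\vartheta\in\{1,\ y^2+y+1,\ (y-1)(y-w),\ (y-1)(y-w^2),\ y-1,\ y-w^2,\ y-w,\ y^3-1\}$ - $g=y^2+y+1$: $\vartheta\in\{y^3-1,\ (y-1)(y-w),\ (y-1)(y-w^2),\ y-1\}$ - $g=(y-1)(y-\omega)$: $\vartheta\in\{y^3-1,\ (y-1)(y-w),\ y^2+y+1,\ y-w\}$ - $g=(y-1)(y-\omega^2)$: $\vartheta\in\{y^3-1,\ (y-1)(y-w^2),\ y^2+y+1,\ y-w^2\}$ - $g=y-1$: $\vartheta\in\{y^3-1,\ y^2+y+1\}$ - $g=y-\omega$: $\vartheta\in\{y^3-1,\ (y-1)(y-w)\}$ - $g=y-\omega^2$: $\vartheta\in\{y^3-1,\ (y-1)(y-w^2)\}$ - $g=1$: $\vartheta=y^3-1$. **(iii)** $i$ is $\theta$-nontrivial and $\mu(i)=i$. Then $C_i=\{0\}$, or $C_i=C_{i,1,\alpha}$ with $\alpha\in\mathcal G_i$ satisfying $$\theta_i(\widehat\alpha)\,\theta_i^2(\widehat\alpha)\,\alpha+\theta_i(\widehat\alpha)\,\alpha\,\theta_i^2(\alpha)+1=0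 .$$ **(iv)** $i\in T$ is $\theta$-nontrivial. Put $i'=\mu(i)$ and $Q=q^{d_i/3}$. Then $(C_i,C_{i'})$ is one of exactly $10+8q^{d_i/3}+8q^{2d_i/3}+q^{d_i}$ pairs, namely: 1. the $4+2Q+2Q^2$ pairs $(\{0\},C_{i'})$, where $C_{i'}$ is $\{0\}$, $\mathcal R_{i'}$, $C_{i',2,\beta}$ or $C_{i',1,\beta}$ with $\beta\in\mathcal G_{i'}$ (these are all left ideals of $\mathcal R_{i'}$); 2. the $(1+Q+Q^2)(3+Q)$ pairs $(C_{i,1,\alpha},C_{i'})$ with $\alpha\in\mathcal G_i$, where for each $\alpha$ the code $C_{i'}$ is one of the following $3+Q$ left ideals: $\{0\}$; $C_{i',1,\beta}$ with $\beta=\theta_{i'}^2(\gamma(x^{-1})^{-1})$, where $\gamma\in\mathcal G_i$ satisfies $\phi_{i,\alpha}(\gamma)=0$ if $\theta_i(a)=a^{Q}$ for all $a\in K_i$, and $\psi_{i,\alpha}(\gamma)=0$ if $\theta_i(a)=a^{Q^2}$ for all $a\in K_i$; $C_{i',2,\beta}$ with $\beta=\theta_{i'}(\alpha(x^{-1})^{-1})$;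 3. the $2(1+Q+Q^2)$ pairs $(C_{i,2,\alpha},C_{i'})$ with $\alpha\in\mathcal G_i$, where for each $\alpha$ the code $C_{i'}$ is one of the following $2$ left ideals: $\{0\}$; $C_{i',1,\beta}$ with $\beta=\theta_{i'}^2(\alpha(x^{-1})^{-1})$; 4. the single pair $(\mathcal R_i,\{0\})$. -/

import Mathlib

open Polynomial

noncomputable section

/-- The ring `K[y;σ]/⟨y³ - 1⟩` for a ring endomorphism `σ` of `K` with `σ³ = id`: its elements are
the polynomials `c₀ + c₁ y + c₂ y²` with coefficients in `K` written on the left, multiplied by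
the rules `y a = σ(a) y` and `y³ = 1`. -/
@[ext]
structure SkewCyclicRing (K : Type*) [CommRing K] (σ : {σ : K →+* K // ∀ a, σ (σ (σ a)) = a}) where
  c₀ : K
  c₁ : K
  c₂ : K

namespace SkewCyclicRing

variable {K : Type*} [CommRing K] {σ : {σ : K →+* K // ∀ a, σ (σ (σ a)) = a}}

instance : Zero (SkewCyclicRing K σ) := ⟨⟨0, 0, 0⟩⟩
instance : One (SkewCyclicRing K σ) := ⟨⟨1, 0, 0⟩⟩
instance : Add (SkewCyclicRing K σ) := ⟨fun a b => ⟨a.c₀ + b.c₀, a.c₁ + b.c₁, a.c₂ + b.c₂⟩⟩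
instance : Neg (SkewCyclicRing K σ) := ⟨fun a => ⟨-a.c₀, -a.c₁, -a.c₂⟩⟩
instance : Mul (SkewCyclicRing K σ) := ⟨fun a b =>
  ⟨a.c₀ * b.c₀ + a.c₁ * σ.1 b.c₂ + a.c₂ * σ.1 (σ.1 b.c₁),
   a.c₀ * b.c₁ + a.c₁ * σ.1 b.c₀ + a.c₂ * σ.1 (σ.1 b.c₂),
   a.c₀ * b.c₂ + a.c₁ * σ.1 b.c₁ + a.c₂ * σ.1 (σ.1 b.c₀)⟩⟩

@[simp] theorem zero_c₀ : (0 : SkewCyclicRing K σ).c₀ = 0 := rfl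
@[simp] theorem zero_c₁ : (0 : SkewCyclicRing K σ).c₁ = 0 := rfl
@[simp] theorem zero_c₂ : (0 : SkewCyclicRing K σ).c₂ = 0 := rfl
@[simp] theorem one_c₀ : (1 : SkewCyclicRing K σ).c₀ = 1 := rfl
@[simp] theorem one_c₁ : (1 : SkewCyclicRing K σ).c₁ = 0 := rfl
@[simp] theorem one_c₂ : (1 : SkewCyclicRing K σ).c₂ = 0 := rfl
@[simp] theorem add_c₀ (a b : SkewCyclicRing K σ) : (a + b).c₀ = a.c₀ + b.c₀ := rfl
@[simp] theorem add_c₁ (a b : SkewCyclicRing K σ) : (a + b).c₁ = a.c₁ + b.c₁ := rfl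
@[simp] theorem add_c₂ (a b : SkewCyclicRing K σ) : (a + b).c₂ = a.c₂ + b.c₂ := rfl
@[simp] theorem neg_c₀ (a : SkewCyclicRing K σ) : (-a).c₀ = -a.c₀ := rfl
@[simp] theorem neg_c₁ (a : SkewCyclicRing K σ) : (-a).c₁ = -a.c₁ := rfl
@[simp] theorem neg_c₂ (a : SkewCyclicRing K σ) : (-a).c₂ = -a.c₂ := rfl
@[simp] theorem mul_c₀ (a b : SkewCyclicRing K σ) :
    (a * b).c₀ = a.c₀ * b.c₀ + a.c₁ * σ.1 b.c₂ + a.c₂ * σ.1 (σ.1 b.c₁) := rfl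
@[simp] theorem mul_c₁ (a b : SkewCyclicRing K σ) :
    (a * b).c₁ = a.c₀ * b.c₁ + a.c₁ * σ.1 b.c₀ + a.c₂ * σ.1 (σ.1 b.c₂) := rfl
@[simp] theorem mul_c₂ (a b : SkewCyclicRing K σ) :
    (a * b).c₂ = a.c₀ * b.c₂ + a.c₁ * σ.1 b.c₁ + a.c₂ * σ.1 (σ.1 b.c₀) := rfl

instance : Ring (SkewCyclicRing K σ) where
  add_assoc a b c := by ext <;> simp [add_assoc]
  zero_add a := by ext <;> simp
  add_zero a := by ext <;> simp
  add_comm a b := by ext <;> simp [add_comm]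
  neg_add_cancel a := by ext <;> simp
  nsmul := nsmulRec
  zsmul := zsmulRec
  zero_mul a := by ext <;> simp
  mul_zero a := by ext <;> simp
  one_mul a := by ext <;> simp
  mul_one a := by ext <;> simp
  left_distrib a b c := by ext <;> simp <;> ring
  right_distrib a b c := by ext <;> simp <;> ring
  mul_assoc a b c := by ext <;> simp [σ.2] <;> ring

/-- The constant polynomial `a`. -/
def const (a : K) : SkewCyclicRing K σ := ⟨a, 0, 0⟩

/-- The indeterminate `y`. -/
def y : SkewCyclicRing K σ := ⟨0, 1, 0⟩

end SkewCyclicRing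

/-- The standing data: a finite field `F` with `q` elements, integers `m ≥ 3` and `r` with
`gcd(m, q) = 1`, `r³ ≡ 1 (mod m)` and `r ≡ q ^ ε (mod m)` for some `ε ≥ 1`, and a primitive
`m`-th root of unity `ζ` in an extension field `L` of `F`. -/
structure MetacyclicData (F L : Type*) [Field F] [Fintype F] [Field L] [Algebra F L] where
  m : ℕ
  r : ℕ
  ζ : L
  three_le : 3 ≤ m
  coprime : Nat.Coprime m (Fintype.card F)
  cube : r ^ 3 ≡ 1 [MOD m]
  frob : ∃ ε : ℕ, 0 < ε ∧ r ≡ Fintype.card F ^ ε [MOD m]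
  primitive : IsPrimitiveRoot ζ m

namespace MetacyclicData

variable {F L : Type*} [Field F] [Fintype F] [Field L] [Algebra F L] (P : MetacyclicData F L)

/-- The cardinality of the base field. -/
def q (_P : MetacyclicData F L) : ℕ := Fintype.card F

instance : NeZero P.m := ⟨by have := P.three_le; omega⟩

theorem cube_zmod : (P.r : ZMod P.m) ^ 3 = 1 := by
  have := (ZMod.natCast_eq_natCast_iff _ _ _).2 P.cube
  simpa using this

/-! ### The group and its codes -/

/-- The metacyclic group `⟨x, y | x ^ m = 1, y ^ 3 = 1, y x = x ^ r y⟩` of order `3 m`;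
the pair `(i, j)` stands for `x ^ i y ^ j`. -/
@[ext]
structure G (P : MetacyclicData F L) where
  i : ZMod P.m
  j : ZMod 3

namespace G

variable {P}

instance : One P.G := ⟨⟨0, 0⟩⟩
instance : Mul P.G := ⟨fun a b => ⟨a.i + (P.r : ZMod P.m) ^ a.j.val * b.i, a.j + b.j⟩⟩
instance : Inv P.G := ⟨fun a => ⟨-((P.r : ZMod P.m) ^ (-a.j).val * a.i), -a.j⟩⟩

@[simp] theorem one_i : (1 : P.G).i = 0 := rfl
@[simp] theorem one_j : (1 : P.G).j = 0 := rfl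
@[simp] theorem mul_i (a b : P.G) : (a * b).i = a.i + (P.r : ZMod P.m) ^ a.j.val * b.i := rfl
@[simp] theorem mul_j (a b : P.G) : (a * b).j = a.j + b.j := rfl
@[simp] theorem inv_i (a : P.G) : (a⁻¹).i = -((P.r : ZMod P.m) ^ (-a.j).val * a.i) := rfl
@[simp] theorem inv_j (a : P.G) : (a⁻¹).j = -a.j := rfl

theorem r_pow_add (a b : ZMod 3) :
    (P.r : ZMod P.m) ^ (a + b).val = (P.r : ZMod P.m) ^ a.val * (P.r : ZMod P.m) ^ b.val := by
  rw [ZMod.val_add, ← pow_add]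
  conv_rhs => rw [← Nat.mod_add_div (a.val + b.val) 3, pow_add, pow_mul, P.cube_zmod, one_pow,
    mul_one]

instance : Group P.G := Group.ofLeftAxioms
  (fun a b c => by ext <;> simp [r_pow_add] <;> ring)
  (fun a => by ext <;> simp)
  (fun a => by ext <;> simp)

/-- The generator `x`. -/
def x : P.G := ⟨1, 0⟩

/-- The generator `y`. -/
def y : P.G := ⟨0, 1⟩

/-- The defining relations, and the normal form `x ^ i y ^ j`. -/
theorem presentation :
    (x : P.G) ^ P.m = 1 ∧ (y : P.G) ^ 3 = 1 ∧ (y : P.G) * x = x ^ P.r * y ∧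
      ∀ g : P.G, g = x ^ g.i.val * y ^ g.j.val := by
  have hx : ∀ n : ℕ, (x : P.G) ^ n = ⟨(n : ZMod P.m), 0⟩ := by
    intro n
    induction n with
    | zero => ext <;> simp
    | succ n ih => rw [pow_succ, ih]; ext <;> simp [x]
  have hy : ∀ n : ℕ, (y : P.G) ^ n = ⟨0, (n : ZMod 3)⟩ := by
    intro n
    induction n with
    | zero => ext <;> simp
    | succ n ih => rw [pow_succ, ih]; ext <;> simp [y]
  refine ⟨?_, ?_, ?_, fun g => ?_⟩
  · rw [hx]; ext <;> simp
  · rw [hy]; ext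
    · simp
    · exact ZMod.natCast_self 3
  · rw [hx]; ext
    · simp [x, y, show (1 : ZMod 3).val = 1 from rfl]
    · simp [x, y]
  · rw [hx, hy]; ext <;> simp

end G

/-- The group algebra of the metacyclic group. -/
abbrev GA : Type _ := MonoidAlgebra F P.G

/-- A linear code `C ⊆ F[G]` is a left metacyclic code if it is a left ideal of `F[G]`. -/
def IsLeftCode (C : Submodule F P.GA) : Prop :=
  ∀ a : P.GA, ∀ ξ ∈ C, a * ξ ∈ C

/-- The Euclidean inner product on `F[G]`. -/
def inner (ξ η : P.GA) : F :=
  ∑ i : ZMod P.m, ∑ j : ZMod 3, ξ.coeff ⟨i, j⟩ * η.coeff ⟨i, j⟩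

/-- The Euclidean dual code. -/
def dual (C : Submodule F P.GA) : Set P.GA := {ξ | ∀ η ∈ C, P.inner ξ η = 0}

/-- Self-orthogonality: `C ⊆ C^⊥`. -/
def IsSelfOrthogonal (C : Submodule F P.GA) : Prop := (C : Set P.GA) ⊆ P.dual C

/-! ### Cyclotomic cosets -/

open Classical in
/-- The `q`-cyclotomic coset of `a` modulo `m`. -/
def cyclotomicCoset (a : ZMod P.m) : Finset (ZMod P.m) :=
  Finset.univ.filter fun b => ∃ k : ℕ, b = a * (P.q : ZMod P.m) ^ k

/-- The set of all `q`-cyclotomic cosets modulo `m`, which serves as index set. -/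
def Coset : Type := {J : Finset (ZMod P.m) // ∃ a, J = P.cyclotomicCoset a}

variable {P}

theorem mem_cyclotomicCoset {a b : ZMod P.m} :
    b ∈ P.cyclotomicCoset a ↔ ∃ k : ℕ, b = a * (P.q : ZMod P.m) ^ k := by
  simp [cyclotomicCoset]

/-- The cardinality `d` of the coset. -/
def Coset.d (J : P.Coset) : ℕ := J.1.card

/-- Multiplication by `r` fixes the coset pointwise. -/
def Coset.IsFixed (J : P.Coset) : Prop := ∀ j ∈ J.1, (P.r : ZMod P.m) * j = j

open Classical in
/-- The coset `-J`. -/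
def Coset.mu (J : P.Coset) : P.Coset :=
  ⟨J.1.image fun j => -j, by
    obtain ⟨a, ha⟩ := J.2
    refine ⟨-a, ?_⟩
    ext b
    simp only [ha, Finset.mem_image, mem_cyclotomicCoset]
    constructor
    · rintro ⟨_, ⟨k, rfl⟩, rfl⟩
      exact ⟨k, by ring⟩
    · rintro ⟨k, rfl⟩
      exact ⟨_, ⟨k, rfl⟩, by ring⟩⟩

theorem Coset.mul_q_mem (J : P.Coset) {j : ZMod P.m} (hj : j ∈ J.1) :
    j * (P.q : ZMod P.m) ∈ J.1 := by
  obtain ⟨a, ha⟩ := J.2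
  rw [ha, mem_cyclotomicCoset] at hj ⊢
  obtain ⟨k, rfl⟩ := hj
  exact ⟨k + 1, by ring⟩

theorem Coset.r_mul_mem (J : P.Coset) {j : ZMod P.m} (hj : j ∈ J.1) :
    (P.r : ZMod P.m) * j ∈ J.1 := by
  obtain ⟨e, -, he⟩ := P.frob
  have hr : (P.r : ZMod P.m) = (P.q : ZMod P.m) ^ e := by
    have := (ZMod.natCast_eq_natCast_iff _ _ _).2 he
    simpa [q] using this
  obtain ⟨a, ha⟩ := J.2
  rw [ha, mem_cyclotomicCoset] at hj ⊢
  obtain ⟨k, rfl⟩ := hj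
  exact ⟨e + k, by rw [hr]; ring⟩

theorem Coset.neg_mem_of_mu {J J' : P.Coset} (h : J.mu = J') {j : ZMod P.m} (hj : j ∈ J'.1) :
    ((P.m - 1 : ℕ) : ZMod P.m) * j ∈ J.1 := by
  subst h
  have h1 : ((P.m - 1 : ℕ) : ZMod P.m) = -1 := by
    rw [Nat.cast_sub (by have := P.three_le; omega)]; simp
  classical
  obtain ⟨i, hi, rfl⟩ := Finset.mem_image.1 hj
  simpa [h1] using hi

/-! ### The fields `K = F[x]/⟨f⟩` -/

/-- The product of `X - ζ ^ j` over the coset. -/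
def Coset.fL (J : P.Coset) : L[X] := ∏ j ∈ J.1, (X - C (P.ζ ^ j.val))

theorem mem_range_of_pow (c : L) (hc : c ^ Fintype.card F = c) : c ∈ (algebraMap F L).range := by
  have h : (X ^ Fintype.card F - X : F[X]) = ∏ a : F, (X - C a) := by
    have hq : 1 < Fintype.card F := Fintype.one_lt_card
    have hmonic : (X ^ Fintype.card F - X : F[X]).Monic :=
      monic_X_pow_sub (by rw [degree_X]; exact_mod_cast hq)
    rw [← prod_multiset_X_sub_C_of_monic_of_roots_card_eq hmonic, FiniteField.roots_X_pow_card_sub_X]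
    · rfl
    · rw [FiniteField.roots_X_pow_card_sub_X, FiniteField.X_pow_card_sub_X_natDegree_eq F hq]
      simp
  have h2 := congrArg (aeval c) h
  simp only [map_sub, map_pow, aeval_X, hc, sub_self, map_prod, aeval_C] at h2
  obtain ⟨a, -, ha⟩ := Finset.prod_eq_zero_iff.1 h2.symm
  exact ⟨a, (sub_eq_zero.1 ha).symm⟩

theorem zeta_pow_eq {a b : ℕ} (h : (a : ZMod P.m) = b) : P.ζ ^ a = P.ζ ^ b := by
  rw [ZMod.natCast_eq_natCast_iff] at h
  exact pow_eq_pow_of_modEq h P.primitive.pow_eq_one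

theorem Coset.exists_f (J : P.Coset) : ∃ f : F[X], f.map (algebraMap F L) = J.fL := by
  have hq : IsUnit (P.q : ZMod P.m) := (ZMod.isUnit_iff_coprime _ _).2 P.coprime.symm
  have key : J.fL.map (FiniteField.frobeniusAlgHom F L : L →+* L) = J.fL := by
    rw [Coset.fL, Polynomial.map_prod]
    refine Finset.prod_nbij (fun j => j * (P.q : ZMod P.m)) (fun j hj => J.mul_q_mem hj)
      (fun a _ b _ hab => hq.mul_right_cancel hab)
      (Finset.surjOn_of_injOn_of_card_le _ (fun j hj => J.mul_q_mem hj)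
        (fun a _ b _ hab => hq.mul_right_cancel hab) le_rfl) (fun j _ => ?_)
    simp only [Polynomial.map_sub, map_X, map_C]
    congr 2
    change (P.ζ ^ j.val) ^ Fintype.card F = _
    rw [← pow_mul]
    exact zeta_pow_eq (by simp [q])
  have h : J.fL ∈ Polynomial.lifts (algebraMap F L) := by
    rw [Polynomial.lifts_iff_coeff_lifts]
    intro n
    apply mem_range_of_pow
    have := congrArg (fun p => p.coeff n) key
    simpa [coeff_map] using this
  obtain ⟨f, hf⟩ := (Polynomial.mem_lifts _).1 h
  exact ⟨f, hf⟩

/-- `f(x) = ∏_{j ∈ J} (x - ζ ^ j)` as a polynomial over `F`. -/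
def Coset.f (J : P.Coset) : F[X] := J.exists_f.choose

theorem Coset.map_f (J : P.Coset) : J.f.map (algebraMap F L) = ∏ j ∈ J.1, (X - C (P.ζ ^ j.val)) :=
  J.exists_f.choose_spec

theorem Coset.monic_f (J : P.Coset) : J.f.Monic := by
  apply Polynomial.monic_of_injective (algebraMap F L).injective
  rw [J.map_f]
  exact monic_prod_of_monic _ _ fun j _ => monic_X_sub_C _

/-- `K = F[x]/⟨f(x)⟩`. -/
abbrev Coset.K (J : P.Coset) : Type _ := AdjoinRoot J.f

theorem zeta_injective : Function.Injective fun j : ZMod P.m => P.ζ ^ j.val := by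
  intro a b h
  exact ZMod.val_injective _ (P.primitive.pow_inj (ZMod.val_lt a) (ZMod.val_lt b) h)

theorem Coset.f_dvd {J J' : P.Coset} {u : ℕ} (h : ∀ j ∈ J'.1, (u : ZMod P.m) * j ∈ J.1) :
    J'.f ∣ expand F u J.f := by
  rw [← map_dvd_map' (algebraMap F L), J'.map_f, map_expand, J.map_f]
  refine Finset.prod_dvd_of_coprime (fun a _ b _ hab => ?_) fun j hj => ?_
  · exact pairwise_coprime_X_sub_C (zeta_injective (P := P)) hab
  · rw [dvd_iff_isRoot, IsRoot.def, expand_eval, eval_prod]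
    refine Finset.prod_eq_zero (h j hj) ?_
    rw [eval_sub, eval_X, eval_C, ← pow_mul, sub_eq_zero]
    exact zeta_pow_eq (by simp [mul_comm])

theorem Coset.eval₂_root_pow {J J' : P.Coset} {u : ℕ}
    (h : ∀ j ∈ J'.1, (u : ZMod P.m) * j ∈ J.1) :
    eval₂ (Algebra.ofId F J'.K : F →+* J'.K) (AdjoinRoot.root J'.f ^ u) J.f = 0 := by
  have h1 := Coset.f_dvd h
  rw [← AdjoinRoot.mk_eq_zero, ← AdjoinRoot.aeval_eq, expand_aeval] at h1
  exact h1

/-- For `u` with `u J' ⊆ J`, the map `K_J → K_J'`, `a(x) ↦ a(x ^ u)`. -/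
def Coset.subst {J J' : P.Coset} (u : ℕ) (h : ∀ j ∈ J'.1, (u : ZMod P.m) * j ∈ J.1) :
    J.K →ₐ[F] J'.K :=
  AdjoinRoot.liftAlgHom J.f (Algebra.ofId F J'.K) (AdjoinRoot.root J'.f ^ u)
    (Coset.eval₂_root_pow h)

@[simp] theorem Coset.subst_root {J J' : P.Coset} (u : ℕ)
    (h : ∀ j ∈ J'.1, (u : ZMod P.m) * j ∈ J.1) :
    Coset.subst u h (AdjoinRoot.root J.f) = AdjoinRoot.root J'.f ^ u := by
  exact AdjoinRoot.liftAlgHom_root _ _ _ _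

theorem Coset.f_dvd_X_pow_sub_one (J : P.Coset) : J.f ∣ X ^ P.m - 1 := by
  rw [← map_dvd_map' (algebraMap F L), J.map_f]
  refine Finset.prod_dvd_of_coprime (fun a _ b _ hab => ?_) fun j _ => ?_
  · exact pairwise_coprime_X_sub_C (zeta_injective (P := P)) hab
  · have h : (P.ζ ^ j.val) ^ P.m = 1 := by
      rw [← pow_mul, mul_comm, pow_mul, P.primitive.pow_eq_one, one_pow]
    rw [dvd_iff_isRoot, IsRoot.def]
    simp [h]

theorem Coset.root_pow (J : P.Coset) : AdjoinRoot.root J.f ^ P.m = 1 := by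
  have h := J.f_dvd_X_pow_sub_one
  rw [← AdjoinRoot.mk_eq_zero] at h
  simpa [sub_eq_zero] using h

/-- The endomorphism `θ : a(x) ↦ a(x ^ r)` of `K`; its cube is the identity. -/
def Coset.theta (J : P.Coset) : {σ : J.K →+* J.K // ∀ a, σ (σ (σ a)) = a} :=
  ⟨(Coset.subst P.r fun _ hj => J.r_mul_mem hj : J.K →ₐ[F] J.K), by
    set s : J.K →ₐ[F] J.K := Coset.subst P.r fun _ hj => J.r_mul_mem hj with hs
    have h : (s.comp (s.comp s)) = AlgHom.id F J.K := by
      apply AdjoinRoot.algHom_ext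
      have h3 := pow_eq_pow_of_modEq P.cube J.root_pow
      simp only [AlgHom.comp_apply, hs, Coset.subst_root, map_pow, AlgHom.id_apply]
      rw [← pow_mul, ← pow_mul]
      convert h3 using 2 <;> ring
    intro a
    exact DFunLike.congr_fun h a⟩

/-- The map `μ : K_J → K_J'`, `a(x) ↦ a(x⁻¹) = a(x ^ (m - 1))`, where `J' = -J`. -/
def Coset.conj {J J' : P.Coset} (h : J.mu = J') : J.K →ₐ[F] J'.K :=
  Coset.subst (P.m - 1) fun _ hj => Coset.neg_mem_of_mu h hj

/-- `θ` on the units of `K`. -/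
def Coset.thetaUnits (J : P.Coset) : J.Kˣ →* J.Kˣ := Units.map (J.theta.1 : J.K →* J.K)

/-- `μ` on the units of `K`. -/
def Coset.conjUnits {J J' : P.Coset} (h : J.mu = J') : J.Kˣ →* J'.Kˣ :=
  Units.map (Coset.conj h : J.K →* J'.K)

/-! ### The idempotents and the concatenated codes -/

/-- `(x ^ m - 1) / f(x)`. -/
def Coset.cofactor (J : P.Coset) : F[X] := (X ^ P.m - 1) /ₘ J.f

theorem Coset.exists_bezout (J : P.Coset) : ∃ u v : F[X], u * J.cofactor + v * J.f = 1 := by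
  have hm : (P.m : F) ≠ 0 := by
    intro h
    obtain ⟨p, hp⟩ := CharP.exists F
    have h1 : p ∣ P.m := (CharP.cast_eq_zero_iff F p P.m).1 h
    have h2 : p ∣ Fintype.card F :=
      (CharP.cast_eq_zero_iff F p _).1 (FiniteField.cast_card_eq_zero F)
    have h3 : p ∣ 1 := by
      have := Nat.dvd_gcd h1 h2
      rwa [P.coprime] at this
    exact CharP.char_ne_one F p (Nat.dvd_one.1 h3)
  have hmul : J.cofactor * J.f = X ^ P.m - 1 := by
    have h0 := (modByMonic_eq_zero_iff_dvd J.monic_f).2 J.f_dvd_X_pow_sub_one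
    have h1 := modByMonic_add_div (X ^ P.m - 1) J.f
    rw [h0, zero_add] at h1
    rw [Coset.cofactor, mul_comm, h1]
  have hs : (J.cofactor * J.f).Separable := by
    rw [hmul]
    exact X_pow_sub_one_separable_iff.2 hm
  exact hs.isCoprime

/-- A polynomial representing the idempotent `ε(x) = u(x) F(x)`, where `F = (x ^ m - 1) / f` and
`u F + v f = 1`. Modulo `x ^ m - 1` it does not depend on the choice of `u` and `v`. -/
def Coset.eps (J : P.Coset) : F[X] := J.exists_bezout.choose * J.cofactor

/-- The ring `𝓡 = K[y;θ]/⟨y³ - 1⟩`. -/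
abbrev Coset.R (J : P.Coset) : Type _ := SkewCyclicRing J.K J.theta

/-- The isomorphism `φ : K → 𝓐`, `a(x) ↦ ε(x) a(x) mod (x ^ m - 1)`, with values in `F[G]`. -/
def Coset.phi (J : P.Coset) : J.K →ₗ[F] P.GA :=
  (aeval (R := F) (MonoidAlgebra.of F P.G G.x)).toLinearMap ∘ₗ
    LinearMap.mulLeft F J.eps ∘ₗ AdjoinRoot.modByMonicHom J.monic_f

/-- The concatenated code `𝓐 □_φ C = {ε(x) ξ | ξ ∈ C}` in `F[G]`, where
`ε(x) (ξ₀ + ξ₁ y + ξ₂ y²) = φ(ξ₀) + φ(ξ₁) y + φ(ξ₂) y²`. -/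
def Coset.concat (J : P.Coset) (C : Ideal J.R) : Submodule F P.GA where
  carrier := (fun ξ : J.R => J.phi ξ.c₀ + J.phi ξ.c₁ * MonoidAlgebra.of F P.G G.y +
    J.phi ξ.c₂ * MonoidAlgebra.of F P.G G.y ^ 2) '' (C : Set J.R)
  zero_mem' := ⟨0, C.zero_mem, by simp⟩
  add_mem' := by
    rintro _ _ ⟨a, ha, rfl⟩ ⟨b, hb, rfl⟩
    refine ⟨a + b, C.add_mem ha hb, ?_⟩
    simp only [SkewCyclicRing.add_c₀, SkewCyclicRing.add_c₁, SkewCyclicRing.add_c₂, map_add,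
      add_mul]
    abel
  smul_mem' := by
    rintro c _ ⟨a, ha, rfl⟩
    refine ⟨SkewCyclicRing.const (algebraMap F J.K c) * a, C.mul_mem_left _ ha, ?_⟩
    simp only [SkewCyclicRing.const, SkewCyclicRing.mul_c₀, SkewCyclicRing.mul_c₁,
      SkewCyclicRing.mul_c₂, zero_mul, add_zero, ← Algebra.smul_def, map_smul, smul_mul_assoc,
      smul_add]

variable (P) in
/-- The sum over all cosets of the concatenated codes `𝓐_J □ C_J`. -/
def code (D : ∀ J : P.Coset, Ideal J.R) : Submodule F P.GA := ⨆ J : P.Coset, J.concat (D J)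

/-! ### Components with trivial `θ` -/

open SkewCyclicRing

/-- The cube root of unity `ω = z ^ ((q ^ d - 1) / 3)`, for a primitive element `z` of `K` and
`q ^ d ≡ 1 (mod 3)`. -/
def Coset.omega (J : P.Coset) (z : J.Kˣ) : J.Kˣ := z ^ ((P.q ^ J.d - 1) / 3)

/-- The admissible codes for `J` fixed by `μ`, with `θ` trivial. -/
def Coset.CaseI (J : P.Coset) (h : J.mu = J) (z : J.Kˣ) (C : Ideal J.R) : Prop :=
  (P.q ≡ 0 [MOD 3] → C = ⊥ ∨ C = Ideal.span {(y - 1) ^ 2}) ∧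
  (P.q ^ J.d ≡ 2 [MOD 3] → C = ⊥) ∧
  (P.q ^ J.d ≡ 1 [MOD 3] →
    (Coset.conjUnits h (J.omega z) = J.omega z →
      C = ⊥ ∨ C = Ideal.span {(y - 1) * (y - const (J.omega z : J.K))} ∨
        C = Ideal.span {(y - 1) * (y - const ((J.omega z : J.K) ^ 2))}) ∧
    (Coset.conjUnits h (J.omega z) ≠ J.omega z → C = ⊥))

/-- The table of pairs of generators for `q ≡ 0 (mod 3)`. -/
def Coset.IsPair₀ (J J' : P.Coset) (g : J.R) (t : J'.R) : Prop :=
  (g = y ^ 3 - 1 ∧ t ∈ ({y ^ 3 - 1, (y - 1) ^ 2, y - 1, 1} : Set J'.R)) ∨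
  (g = (y - 1) ^ 2 ∧ t ∈ ({y ^ 3 - 1, (y - 1) ^ 2, y - 1} : Set J'.R)) ∨
  (g = y - 1 ∧ t ∈ ({y ^ 3 - 1, (y - 1) ^ 2} : Set J'.R)) ∨
  (g = 1 ∧ t = y ^ 3 - 1)

/-- The table of pairs of generators for `q ^ d ≡ 2 (mod 3)`. -/
def Coset.IsPair₂ (J J' : P.Coset) (g : J.R) (t : J'.R) : Prop :=
  (g = y ^ 3 - 1 ∧ t ∈ ({y ^ 3 - 1, y ^ 2 + y + 1, y - 1, 1} : Set J'.R)) ∨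
  (g = y ^ 2 + y + 1 ∧ t ∈ ({y ^ 3 - 1, y - 1} : Set J'.R)) ∨
  (g = y - 1 ∧ t ∈ ({y ^ 3 - 1, y ^ 2 + y + 1} : Set J'.R)) ∨
  (g = 1 ∧ t = y ^ 3 - 1)

/-- The table of pairs of generators for `q ^ d ≡ 1 (mod 3)`, where `ω = ω_J` and
`w = ω_J(x⁻¹)` in `K_J'`. -/
def Coset.IsPair₁ (J J' : P.Coset) (ω : J.K) (w : J'.K) (g : J.R) (t : J'.R) : Prop :=
  (g = y ^ 3 - 1 ∧ t ∈ ({1, y ^ 2 + y + 1, (y - 1) * (y - const w), (y - 1) * (y - const (w ^ 2)),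
    y - 1, y - const (w ^ 2), y - const w, y ^ 3 - 1} : Set J'.R)) ∨
  (g = y ^ 2 + y + 1 ∧ t ∈ ({y ^ 3 - 1, (y - 1) * (y - const w), (y - 1) * (y - const (w ^ 2)),
    y - 1} : Set J'.R)) ∨
  (g = (y - 1) * (y - const ω) ∧ t ∈ ({y ^ 3 - 1, (y - 1) * (y - const w), y ^ 2 + y + 1,
    y - const w} : Set J'.R)) ∨
  (g = (y - 1) * (y - const (ω ^ 2)) ∧ t ∈ ({y ^ 3 - 1, (y - 1) * (y - const (w ^ 2)),
    y ^ 2 + y + 1, y - const (w ^ 2)} : Set J'.R)) ∨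
  (g = y - 1 ∧ t ∈ ({y ^ 3 - 1, y ^ 2 + y + 1} : Set J'.R)) ∨
  (g = y - const ω ∧ t ∈ ({y ^ 3 - 1, (y - 1) * (y - const w)} : Set J'.R)) ∨
  (g = y - const (ω ^ 2) ∧ t ∈ ({y ^ 3 - 1, (y - 1) * (y - const (w ^ 2))} : Set J'.R)) ∨
  (g = 1 ∧ t = y ^ 3 - 1)

/-- The admissible pairs of codes for `J' = μ(J) ≠ J`, with `θ` trivial. -/
def Coset.CaseII (J J' : P.Coset) (h : J.mu = J') (z : J.Kˣ) (C : Ideal J.R) (C' : Ideal J'.R) :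
    Prop :=
  (P.q ≡ 0 [MOD 3] →
    ∃ g t, J.IsPair₀ J' g t ∧ C = Ideal.span {g} ∧ C' = Ideal.span {t}) ∧
  (P.q ^ J.d ≡ 2 [MOD 3] →
    ∃ g t, J.IsPair₂ J' g t ∧ C = Ideal.span {g} ∧ C' = Ideal.span {t}) ∧
  (P.q ^ J.d ≡ 1 [MOD 3] →
    ∃ g t, J.IsPair₁ J' (J.omega z) (Coset.conj h (J.omega z)) g t ∧
      C = Ideal.span {g} ∧ C' = Ideal.span {t})

/-! ### Components with `θ` of order `3` -/

/-- `q ^ (d / 3)`; here `d` is a multiple of `3` whenever `θ` is nontrivial on `K`. -/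
def Coset.Q (J : P.Coset) : ℕ := P.q ^ (J.d / 3)

/-- The cyclic group `𝓖` of order `1 + Q + Q ^ 2` with `Q = q ^ (d / 3)`, generated by
`ϱ = z ^ (Q - 1)` for a primitive element `z` of `K`. -/
def Coset.Gr (J : P.Coset) (z : J.Kˣ) : Subgroup J.Kˣ := Subgroup.zpowers (z ^ (J.Q - 1))

/-- `C_{2,α} = 𝓡 (-α + y)`. -/
def Coset.C2 (J : P.Coset) (α : J.Kˣ) : Ideal J.R := Ideal.span {-const (α : J.K) + y}

/-- `C_{1,α} = 𝓡 (α⁻¹ + θ²(α) y + y²)`. -/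
def Coset.C1 (J : P.Coset) (α : J.Kˣ) : Ideal J.R :=
  Ideal.span {const ((α⁻¹ : J.Kˣ) : J.K) + const (J.theta.1 (J.theta.1 α)) * y + y ^ 2}

/-- `φ_γ(X) = X ^ (Q + 1) + γ ^ (Q ^ 2) X + γ⁻¹`. -/
def Coset.phiPoly (J : P.Coset) (γ : J.Kˣ) : J.K[X] :=
  X ^ (J.Q + 1) + C ((γ : J.K) ^ J.Q ^ 2) * X + C ((γ⁻¹ : J.Kˣ) : J.K)

/-- `ψ_γ(X) = γ ^ Q X ^ (Q + 1) + γ⁻¹ X ^ Q + 1`. -/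
def Coset.psiPoly (J : P.Coset) (γ : J.Kˣ) : J.K[X] :=
  C ((γ : J.K) ^ J.Q) * X ^ (J.Q + 1) + C ((γ⁻¹ : J.Kˣ) : J.K) * X ^ J.Q + 1

/-- `α̂(x) = α(x⁻¹) ^ (Q ^ 2 + Q)` in `K_J'`, where `J' = -J`. -/
def Coset.hat {J J' : P.Coset} (h : J.mu = J') (α : J.Kˣ) : J'.K :=
  Coset.conj h α ^ (J.Q ^ 2 + J.Q)

/-- The admissible codes for `J` fixed by `μ`, with `θ` of order `3`. -/
def Coset.CaseIII (J : P.Coset) (h : J.mu = J) (z : J.Kˣ) (C : Ideal J.R) : Prop :=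
  C = ⊥ ∨ ∃ α ∈ J.Gr z,
    J.theta.1 (Coset.hat h α) * J.theta.1 (J.theta.1 (Coset.hat h α)) * α +
      J.theta.1 (Coset.hat h α) * α * J.theta.1 (J.theta.1 α) + 1 = 0 ∧
    C = J.C1 α

/-- The list of left ideals of `𝓡`. -/
def Coset.IsListed (J : P.Coset) (z : J.Kˣ) (C : Ideal J.R) : Prop :=
  C = ⊥ ∨ C = ⊤ ∨ (∃ α ∈ J.Gr z, C = J.C2 α) ∨ ∃ α ∈ J.Gr z, C = J.C1 α

/-- The pairs `({0}, C')`. -/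
def Coset.CaseIV1 (J J' : P.Coset) (z' : J'.Kˣ) (C : Ideal J.R) (C' : Ideal J'.R) : Prop :=
  C = ⊥ ∧ J'.IsListed z' C'

/-- The partners `C'` of `C_{1,α}`. -/
def Coset.PartnerC1 (J J' : P.Coset) (h : J.mu = J') (z : J.Kˣ) (α : J.Kˣ) (C' : Ideal J'.R) :
    Prop :=
  C' = ⊥ ∨
  (∃ γ ∈ J.Gr z,
    (((∀ a : J.K, J.theta.1 a = a ^ J.Q) ∧ (J.phiPoly α).eval (γ : J.K) = 0) ∨
      ((∀ a : J.K, J.theta.1 a = a ^ J.Q ^ 2) ∧ (J.psiPoly α).eval (γ : J.K) = 0)) ∧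
    C' = J'.C1 (J'.thetaUnits (J'.thetaUnits (Coset.conjUnits h γ)⁻¹))) ∨
  C' = J'.C2 (J'.thetaUnits (Coset.conjUnits h α)⁻¹)

/-- The pairs `(C_{1,α}, C')`. -/
def Coset.CaseIV2 (J J' : P.Coset) (h : J.mu = J') (z : J.Kˣ) (C : Ideal J.R) (C' : Ideal J'.R) :
    Prop :=
  ∃ α ∈ J.Gr z, C = J.C1 α ∧ J.PartnerC1 J' h z α C'

/-- The partners `C'` of `C_{2,α}`. -/
def Coset.PartnerC2 (J J' : P.Coset) (h : J.mu = J') (α : J.Kˣ) (C' : Ideal J'.R) : Prop :=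
  C' = ⊥ ∨ C' = J'.C1 (J'.thetaUnits (J'.thetaUnits (Coset.conjUnits h α)⁻¹))

/-- The pairs `(C_{2,α}, C')`. -/
def Coset.CaseIV3 (J J' : P.Coset) (h : J.mu = J') (z : J.Kˣ) (C : Ideal J.R) (C' : Ideal J'.R) :
    Prop :=
  ∃ α ∈ J.Gr z, C = J.C2 α ∧ J.PartnerC2 J' h α C'

/-- The pair `(𝓡, {0})`. -/
def Coset.CaseIV4 (J J' : P.Coset) (C : Ideal J.R) (C' : Ideal J'.R) : Prop :=
  C = ⊤ ∧ C' = ⊥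

/-- The admissible pairs of codes for `J' = μ(J) ≠ J`, with `θ` of order `3`. -/
def Coset.CaseIV (J J' : P.Coset) (h : J.mu = J') (z : J.Kˣ) (z' : J'.Kˣ) (C : Ideal J.R)
    (C' : Ideal J'.R) : Prop :=
  J.CaseIV1 J' z' C C' ∨ J.CaseIV2 J' h z C C' ∨ J.CaseIV3 J' h z C C' ∨ J.CaseIV4 J' C C'

/-- The admissible families `(C_J)` of left ideals; `z J` is a primitive element of `K_J`, and `T`
contains exactly one coset of each pair `{J, μ(J)}` with `μ(J) ≠ J`. -/
def IsAdmissible (z : ∀ J : P.Coset, J.Kˣ) (T : Set P.Coset) (D : ∀ J : P.Coset, Ideal J.R) :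
    Prop :=
  (∀ (J : P.Coset) (h : J.mu = J), J.IsFixed → J.CaseI h (z J) (D J)) ∧
  (∀ J : P.Coset, J.mu ≠ J → J ∈ T → J.IsFixed → J.CaseII J.mu rfl (z J) (D J) (D J.mu)) ∧
  (∀ (J : P.Coset) (h : J.mu = J), ¬ J.IsFixed → J.CaseIII h (z J) (D J)) ∧
  (∀ J : P.Coset, J.mu ≠ J → J ∈ T → ¬ J.IsFixed →
    J.CaseIV J.mu rfl (z J) (z J.mu) (D J) (D J.mu))

end MetacyclicData

end

/-! Since gcd(m, q) = 1, the Chinese remainder theorem splits F[x]/(x^m - 1) into the fields K_J.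
Since r is a power of q, conjugation by y preserves every coset J, so F[G] is the product of the
rings R_J = K_J[y;θ]/(y³ - 1). The maps `Coset.proj` and `Coset.incl` realise this, and `ext_proj`
says that an element is determined by its components. Left ideals of the product are families of
left ideals (`mem_code`, `exists_code_eq`).

For a left ideal, self-orthogonality means ξ η* = 0 for all ξ, η in it, where * is the antipode g ↦
g⁻¹: the coefficient of g in ξ η* is the inner product of g⁻¹ξ with η (`coeff_mul_antipode`). The
antipode exchanges the components of J and -J and acts there by `conjTranspose`
(`Coset.proj_antipode`). The condition thus becomes `Orth` of C_J and C_{-J}, one pair of components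
at a time. It is symmetric in the pair, so one index of each pair suffices.

Let K be a field and σ an automorphism with σ³ = id, trivial or not. A proper nonzero left ideal of
K[y;σ]/(y³ - 1) is either a plane, generated by y - α, or a line, generated by α⁻¹ + σ²(α)y + y²,
with α σ(α) σ²(α) = 1 (`ideal_classification`). Orthogonality needs to be tested only on generators.
A line and a plane are orthogonal when one linear equation holds, two planes never are, and for two
lines the condition is 1 + δ + δσ²(δ) = 0 with δ = α c(β), where c is the conjugation K' → K
(`orth_iff`). If N is the number of norm-one elements and M the number of such δ, there are 3 + N(6
+ M) orthogonal pairs (`ncard_pairs`).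

For trivial θ the norm-one elements are the cube roots of unity, and (N, M) is (1, 1), (1, 0) or (3,
2), which gives 10, 9 or 27 pairs. For θ of order 3, K has Q³ elements, θ is the Q-th or the Q²-th
power map, N = 1 + Q + Q² and M = Q + 1. The value of M comes from the divisibility of X^(Q+1) + X +
1 and X^(Q+1) + X^Q + 1 into X^(1+Q+Q²) - 1, which splits over K with simple roots. -/

noncomputable section

/-! ### Coordinates and left ideals in K[y;σ]/(y³ - 1). -/

namespace SkewCyclicRing

variable {K K' : Type*} [CommRing K] [CommRing K'] {σ : {σ : K →+* K // ∀ a, σ (σ (σ a)) = a}}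
  {σ' : {σ : K' →+* K' // ∀ a, σ (σ (σ a)) = a}}

@[simp] theorem const_c₀ (a : K) : (const a : SkewCyclicRing K σ).c₀ = a := rfl
@[simp] theorem const_c₁ (a : K) : (const a : SkewCyclicRing K σ).c₁ = 0 := rfl
@[simp] theorem const_c₂ (a : K) : (const a : SkewCyclicRing K σ).c₂ = 0 := rfl
@[simp] theorem y_c₀ : (y : SkewCyclicRing K σ).c₀ = 0 := rfl
@[simp] theorem y_c₁ : (y : SkewCyclicRing K σ).c₁ = 1 := rfl
@[simp] theorem y_c₂ : (y : SkewCyclicRing K σ).c₂ = 0 := rfl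
@[simp] theorem sub_c₀ (a b : SkewCyclicRing K σ) : (a - b).c₀ = a.c₀ - b.c₀ := by
  simp [sub_eq_add_neg]
@[simp] theorem sub_c₁ (a b : SkewCyclicRing K σ) : (a - b).c₁ = a.c₁ - b.c₁ := by
  simp [sub_eq_add_neg]
@[simp] theorem sub_c₂ (a b : SkewCyclicRing K σ) : (a - b).c₂ = a.c₂ - b.c₂ := by
  simp [sub_eq_add_neg]

theorem y_pow_two : (y : SkewCyclicRing K σ) ^ 2 = ⟨0, 0, 1⟩ := by
  rw [pow_two]; ext <;> simp

theorem y_pow_three : (y : SkewCyclicRing K σ) ^ 3 = 1 := by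
  rw [pow_succ, y_pow_two]; ext <;> simp

/-- Finiteness here and for ideals makes `Set.ncard` additive on the disjoint unions of sets of
ideals counted later. -/
instance [Finite K] : Finite (SkewCyclicRing K σ) :=
  Finite.of_injective (fun a => (a.c₀, a.c₁, a.c₂)) fun a b h => by
    simp only [Prod.mk.injEq] at h
    exact SkewCyclicRing.ext h.1 h.2.1 h.2.2

instance {R : Type*} [Ring R] [Finite R] : Finite (Ideal R) :=
  Finite.of_injective (fun I : Ideal R => (I : Set R)) SetLike.coe_injective

/-! ### Left ideals -/

/-- The units of norm one. -/
def normOne (σ : {σ : K →+* K // ∀ a, σ (σ (σ a)) = a}) : Subgroup Kˣ where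
  carrier := {α | (α : K) * σ.1 α * σ.1 (σ.1 α) = 1}
  one_mem' := by simp
  mul_mem' {a b} ha hb := by
    simp only [Set.mem_ofPred_eq, Units.val_mul, map_mul] at *
    linear_combination (b : K) * σ.1 b * σ.1 (σ.1 b) * ha + hb
  inv_mem' {a} ha := by
    simp only [Set.mem_ofPred_eq] at *
    have h1 : (a : K) * (a⁻¹ : Kˣ) = 1 := a.mul_inv
    have h2 : σ.1 (a : K) * σ.1 (a⁻¹ : Kˣ) = 1 := by rw [← map_mul, h1, map_one]
    have h3 : σ.1 (σ.1 (a : K)) * σ.1 (σ.1 (a⁻¹ : Kˣ)) = 1 := by rw [← map_mul, h2, map_one]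
    calc _ = (a * σ.1 a * σ.1 (σ.1 a)) * ((a⁻¹ : Kˣ) * σ.1 (a⁻¹ : Kˣ) * σ.1 (σ.1 (a⁻¹ : Kˣ))) := by
            rw [ha, one_mul]
      _ = (a * (a⁻¹ : Kˣ)) * (σ.1 a * σ.1 (a⁻¹ : Kˣ)) * (σ.1 (σ.1 a) * σ.1 (σ.1 (a⁻¹ : Kˣ))) := by
            ring
      _ = 1 := by rw [h1, h2, h3]; simp

theorem mem_normOne {α : Kˣ} : α ∈ normOne σ ↔ (α : K) * σ.1 α * σ.1 (σ.1 α) = 1 := Iff.rfl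

/-- Eliminates inverses, so that later identities are polynomial in the conjugates of α and
accessible to `linear_combination`. -/
theorem inv_eq_of_mem_normOne {α : Kˣ} (h : α ∈ normOne σ) :
    ((α⁻¹ : Kˣ) : K) = σ.1 α * σ.1 (σ.1 α) := by
  rw [Units.inv_eq_of_mul_eq_one_right]
  rw [← mul_assoc]; exact h

/-- The left ideal generated by `y - α`. -/
def planeIdeal (σ : {σ : K →+* K // ∀ a, σ (σ (σ a)) = a}) (α : Kˣ) :
    Ideal (SkewCyclicRing K σ) := Ideal.span {-const (α : K) + y}

/-- The left ideal generated by `α⁻¹ + σ²(α) y + y²`. -/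
def lineIdeal (σ : {σ : K →+* K // ∀ a, σ (σ (σ a)) = a}) (α : Kˣ) :
    Ideal (SkewCyclicRing K σ) :=
  Ideal.span {const ((α⁻¹ : Kˣ) : K) + const (σ.1 (σ.1 α)) * y + y ^ 2}

/-- Right division by y - α: modulo the left ideal, y becomes α and y² = y·y becomes yα = σ(α)y,
hence ασ(α). The expression is the remainder. Norm one means that y - α divides y³ - 1 on the right,
so the remainder is well defined. -/
theorem mem_planeIdeal {α : Kˣ} (h : α ∈ normOne σ) {ξ : SkewCyclicRing K σ} :
    ξ ∈ planeIdeal σ α ↔ ξ.c₀ + ξ.c₁ * α + ξ.c₂ * (α * σ.1 α) = 0 := by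
  rw [planeIdeal, Ideal.mem_span_singleton']
  rw [mem_normOne] at h
  constructor
  · rintro ⟨η, rfl⟩
    simp only [mul_c₀, mul_c₁, mul_c₂, add_c₀, add_c₁, add_c₂, neg_c₀, neg_c₁, neg_c₂, const_c₀,
      const_c₁, const_c₂, y_c₀, y_c₁, y_c₂, map_add, map_neg, map_zero, map_one]
    linear_combination -η.c₂ * h
  · intro hξ
    -- The quotient of ξ by y - α.
    refine ⟨⟨ξ.c₁ + ξ.c₂ * σ.1 α, ξ.c₂, 0⟩, ?_⟩
    ext
    · simp; linear_combination -hξ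
    · simp
    · simp

/-- The generator g satisfies yg = αg because α has norm one. Hence the left ideal is just Kg, and
membership is proportionality to g. -/
theorem mem_lineIdeal {α : Kˣ} (h : α ∈ normOne σ) {ξ : SkewCyclicRing K σ} :
    ξ ∈ lineIdeal σ α ↔
      ξ.c₀ = ξ.c₂ * (σ.1 α * σ.1 (σ.1 α)) ∧ ξ.c₁ = ξ.c₂ * σ.1 (σ.1 α) := by
  rw [lineIdeal, Ideal.mem_span_singleton', inv_eq_of_mem_normOne h]
  rw [mem_normOne] at h
  constructor
  · rintro ⟨η, rfl⟩
    simp only [mul_c₀, mul_c₁, mul_c₂, add_c₀, add_c₁, add_c₂, const_c₀, const_c₁, const_c₂,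
      y_c₀, y_c₁, y_c₂, map_add, map_zero, map_one, y_pow_two, map_mul, σ.2]
    constructor
    · linear_combination (-η.c₁ - η.c₂ * σ.1 α) * h
    · linear_combination (-η.c₂) * h
  · rintro ⟨h0, h1⟩
    refine ⟨const ξ.c₂, ?_⟩
    ext
    · simp [y_pow_two, h0]
    · simp [y_pow_two, h1]
    · simp [y_pow_two]

/-- Every left ideal is one of the listed ones. -/
theorem ideal_classification (hK : ∀ a : K, a ≠ 0 → IsUnit a) (C : Ideal (SkewCyclicRing K σ)) :
    C = ⊥ ∨ C = ⊤ ∨ (∃ α ∈ normOne σ, C = planeIdeal σ α) ∨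
      ∃ α ∈ normOne σ, C = lineIdeal σ α := by
  by_cases hbot : C = ⊥
  · exact Or.inl hbot
  by_cases htop : C = ⊤
  · exact Or.inr (Or.inl htop)
  have hconst : ∀ a : K, const a ∈ C → a = 0 := by
    intro a ha
    by_contra h0
    obtain ⟨u, rfl⟩ := hK a h0
    refine htop ((Ideal.eq_top_iff_one _).2 ?_)
    have := C.mul_mem_left (const ((u⁻¹ : Kˣ) : K)) ha
    convert this using 1
    ext <;> simp
  have hyC : ∀ ξ ∈ C, (⟨σ.1 ξ.c₂, σ.1 ξ.c₀, σ.1 ξ.c₁⟩ : SkewCyclicRing K σ) ∈ C := by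
    intro ξ hξ
    convert C.mul_mem_left y hξ using 1
    ext <;> simp
  have hs0 : ∀ a : K, σ.1 a = 0 → a = 0 := fun a h => by rw [← σ.2 a, h]; simp
  -- The least degree of a nonzero element decides: degree at most one gives a plane, degree two a
  -- line.
  by_cases hex : ∃ ξ ∈ C, ξ ≠ 0 ∧ ξ.c₂ = 0
  · obtain ⟨ξ, hξ, h0, h2⟩ := hex
    have h1 : ξ.c₁ ≠ 0 := by
      intro h1
      have : ξ.c₀ = 0 := hconst _ (by convert hξ; ext <;> simp [h1, h2])
      exact h0 (by ext <;> simp [*])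
    have h0' : ξ.c₀ ≠ 0 := by
      intro h0
      have : const (σ.1 (σ.1 ξ.c₁)) ∈ C := by
        convert hyC _ (hyC _ hξ) using 1
        ext <;> simp [h0, h2]
      exact h1 (hs0 _ (hs0 _ (hconst _ this)))
    obtain ⟨u, hu⟩ := hK _ h1
    obtain ⟨v, hv⟩ := hK _ h0'
    have hα : -const ((-(u⁻¹ * v) : Kˣ) : K) + y ∈ C := by
      convert C.mul_mem_left (const ((u⁻¹ : Kˣ) : K)) hξ using 1
      ext <;> simp [← hu, ← hv, h2]
    set α : Kˣ := -(u⁻¹ * v)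
    have hN : α ∈ normOne σ := by
      rw [mem_normOne, ← sub_eq_zero]
      apply hconst
      -- The factor is minus the cofactor of y - α in y³ - N(α), so the product is the constant N(α)
      -- - 1.
      have := C.mul_mem_left (-(⟨σ.1 α * σ.1 (σ.1 α), σ.1 (σ.1 α), 1⟩ : SkewCyclicRing K σ)) hα
      convert this using 1
      ext <;> simp <;> ring
    refine Or.inr (Or.inr (Or.inl ⟨α, hN, le_antisymm ?_ ?_⟩))
    · intro η hη
      rw [mem_planeIdeal hN]
      apply hconst
      -- The remainder of η on division by y - α is a constant of C, hence zero.
      have h3 : η - const (η.c₀ + η.c₁ * α + η.c₂ * (α * σ.1 α)) ∈ planeIdeal σ α := by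
        rw [mem_planeIdeal hN]; simp; ring
      have h4 : planeIdeal σ α ≤ C := (Ideal.span_singleton_le_iff_mem _).2 hα
      have := C.sub_mem hη (h4 h3)
      simpa using this
    · exact (Ideal.span_singleton_le_iff_mem _).2 hα
  · push Not at hex
    obtain ⟨ξ, hξ, h0⟩ := (Submodule.ne_bot_iff _).1 hbot
    obtain ⟨u, hu⟩ := hK _ (hex ξ hξ h0)
    set a := ((u⁻¹ : Kˣ) : K) * ξ.c₀ with ha
    set b := ((u⁻¹ : Kˣ) : K) * ξ.c₁ with hb
    have hab : (⟨a, b, 1⟩ : SkewCyclicRing K σ) ∈ C := by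
      convert C.mul_mem_left (const ((u⁻¹ : Kˣ) : K)) hξ using 1
      ext <;> simp [← hu, ha, hb]
    -- C is spanned over K by a + by + y². Comparing y times this element with a multiple of it
    -- gives the equations for a and b.
    have huniq : ∀ η ∈ C, η = const η.c₂ * ⟨a, b, 1⟩ := by
      intro η hη
      by_contra hne
      exact hex _ (C.sub_mem hη (C.mul_mem_left (const η.c₂) hab)) (sub_ne_zero.2 hne) (by simp)
    have h1 := huniq _ (hyC _ hab)
    have e0 := congrArg c₀ h1
    have e1 := congrArg c₁ h1
    simp only [mul_c₀, mul_c₁, const_c₀, const_c₁, const_c₂, zero_mul, add_zero, map_one] at e0 e1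
    have hN0 : b * σ.1 b * σ.1 (σ.1 b) = 1 := by
      have e2 := congrArg (fun t => σ.1 (σ.1 t)) e1
      simp only [map_mul, σ.2] at e2
      rw [e0, e2]; ring
    -- The y-coefficient of a line generator is σ²(α), which forces α = σ(b).
    let α : Kˣ := ⟨σ.1 b, b * σ.1 (σ.1 b), by linear_combination hN0, by linear_combination hN0⟩
    have hαv : (α : K) = σ.1 b := rfl
    have hN : α ∈ normOne σ := by
      rw [mem_normOne, hαv, σ.2]; linear_combination hN0
    have hmem : (⟨a, b, 1⟩ : SkewCyclicRing K σ) ∈ lineIdeal σ α := by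
      rw [mem_lineIdeal hN, hαv, σ.2]
      have e2 := congrArg (fun t => σ.1 (σ.1 t)) e1
      simp only [map_mul, σ.2] at e2
      exact ⟨by simp only [one_mul]; rw [e2]; ring, by simp⟩
    refine Or.inr (Or.inr (Or.inr ⟨α, hN, le_antisymm ?_ ?_⟩))
    · intro η hη
      rw [huniq η hη]
      exact (lineIdeal σ α).mul_mem_left _ hmem
    · refine (Ideal.span_singleton_le_iff_mem _).2 ?_
      convert hab using 1
      have := (mem_lineIdeal hN).1 hmem
      rw [inv_eq_of_mem_normOne hN]
      ext <;> simp [y_pow_two]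
      all_goals simp only [one_mul] at this
      · exact this.1.symm
      · exact this.2.symm

section Injectivity

theorem planeIdeal_injOn : Set.InjOn (planeIdeal σ) (normOne σ) := by
  intro α hα β hβ h
  have : -const (α : K) + y ∈ planeIdeal σ β := by
    rw [← h]; exact Ideal.subset_span rfl
  rw [mem_planeIdeal hβ] at this
  simp only [add_c₀, neg_c₀, const_c₀, y_c₀, add_c₁, neg_c₁, const_c₁, y_c₁, add_c₂, neg_c₂,
    const_c₂, y_c₂] at this
  exact Units.ext (by linear_combination -this)

theorem lineIdeal_injOn : Set.InjOn (lineIdeal σ) (normOne σ) := by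
  intro α hα β hβ h
  have h1 : (⟨σ.1 α * σ.1 (σ.1 α), σ.1 (σ.1 α), 1⟩ : SkewCyclicRing K σ) ∈ lineIdeal σ β := by
    rw [← h, mem_lineIdeal hα]; simp
  rw [mem_lineIdeal hβ] at h1
  have h2 := congrArg σ.1 h1.2
  simp only [one_mul, σ.2] at h2
  exact Units.ext h2

variable [Nontrivial K]

theorem planeIdeal_ne_top {α : Kˣ} (h : α ∈ normOne σ) : planeIdeal σ α ≠ ⊤ := by
  rw [Ideal.ne_top_iff_one, mem_planeIdeal h]; simp

theorem lineIdeal_ne_top {α : Kˣ} (h : α ∈ normOne σ) : lineIdeal σ α ≠ ⊤ := by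
  rw [Ideal.ne_top_iff_one, mem_lineIdeal h]; simp

theorem planeIdeal_ne_bot {α : Kˣ} : planeIdeal σ α ≠ ⊥ := by
  rw [planeIdeal, Ne, Ideal.span_singleton_eq_bot]
  intro h
  simpa using congrArg c₁ h

theorem lineIdeal_ne_bot {α : Kˣ} : lineIdeal σ α ≠ ⊥ := by
  rw [lineIdeal, Ne, Ideal.span_singleton_eq_bot]
  intro h
  simpa [y_pow_two] using congrArg c₂ h

theorem planeIdeal_ne_lineIdeal {α β : Kˣ} (h : β ∈ normOne σ) :
    planeIdeal σ α ≠ lineIdeal σ β := by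
  intro e
  have : -const (α : K) + y ∈ lineIdeal σ β := by
    rw [← e]; exact Ideal.subset_span rfl
  rw [mem_lineIdeal h] at this
  simpa using this.2

instance : Nontrivial (SkewCyclicRing K σ) := ⟨0, 1, fun h => by simpa using congrArg c₀ h⟩

end Injectivity

/-! ### Conjugate transposition -/

/-- The semilinear map with `y ↦ y⁻¹`, for `c : K' → K`. -/
def conjTranspose (σ : {σ : K →+* K // ∀ a, σ (σ (σ a)) = a}) (c : K' →+* K)
    (η : SkewCyclicRing K' σ') : SkewCyclicRing K σ :=
  ⟨c η.c₀, σ.1 (c η.c₂), σ.1 (σ.1 (c η.c₁))⟩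

theorem conjTranspose_add (c : K' →+* K) (η ξ : SkewCyclicRing K' σ') :
    conjTranspose σ c (η + ξ) = conjTranspose σ c η + conjTranspose σ c ξ := by
  ext <;> simp [conjTranspose]

/-- The map sends a yʲ to y⁻ʲ c(a), so it reverses products; moving the coefficients back to the
left produces the powers of σ. -/
theorem conjTranspose_mul {c : K' →+* K} (hc : ∀ a, c (σ'.1 a) = σ.1 (c a))
    (η ξ : SkewCyclicRing K' σ') :
    conjTranspose σ c (η * ξ) = conjTranspose σ c ξ * conjTranspose σ c η := by
  ext <;> simp [conjTranspose, hc, σ.2] <;> ring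

theorem conjTranspose_conjTranspose {c : K' →+* K} {c' : K →+* K'}
    (hc : ∀ a, c (σ'.1 a) = σ.1 (c a)) (hcc : ∀ a, c (c' a) = a) (η : SkewCyclicRing K σ) :
    conjTranspose σ c (conjTranspose σ' c' η) = η := by
  ext <;> simp [conjTranspose, hc, hcc, σ.2]

/-- `ξ η* = 0` for all `ξ ∈ C` and `η ∈ C'`. -/
def Orth (c : K' →+* K) (C : Ideal (SkewCyclicRing K σ)) (C' : Ideal (SkewCyclicRing K' σ')) :
    Prop := ∀ ξ ∈ C, ∀ η ∈ C', ξ * conjTranspose σ c η = 0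

/-- The conjugate transpose of ξ η* is η ξ*. This is why the conditions at J and at -J coincide. -/
theorem orth_symm {c : K' →+* K} {c' : K →+* K'}
    (hc' : ∀ a, c' (σ.1 a) = σ'.1 (c' a)) (hcc : ∀ a, c' (c a) = a)
    {C : Ideal (SkewCyclicRing K σ)} {C' : Ideal (SkewCyclicRing K' σ')} (h : Orth c C C') :
    Orth c' C' C := by
  intro η hη ξ hξ
  have := congrArg (conjTranspose σ' c') (h ξ hξ η hη)
  rw [conjTranspose_mul hc', conjTranspose_conjTranspose hc' hcc] at this
  rw [this]
  ext <;> simp [conjTranspose]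

/-- Since (a g)(b t)* = a (g t*) b*, the product of the generators decides. -/
theorem orth_span {c : K' →+* K} (hc : ∀ a, c (σ'.1 a) = σ.1 (c a))
    (g : SkewCyclicRing K σ) (t : SkewCyclicRing K' σ') :
    Orth c (Ideal.span {g}) (Ideal.span {t}) ↔ g * conjTranspose σ c t = 0 := by
  constructor
  · exact fun h => h _ (Ideal.subset_span rfl) _ (Ideal.subset_span rfl)
  · intro h ξ hξ η hη
    obtain ⟨a, rfl⟩ := Ideal.mem_span_singleton'.1 hξ
    obtain ⟨b, rfl⟩ := Ideal.mem_span_singleton'.1 hη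
    rw [conjTranspose_mul hc, mul_assoc, ← mul_assoc g, h, zero_mul, mul_zero]

theorem orth_bot_left (c : K' →+* K) (C' : Ideal (SkewCyclicRing K' σ')) :
    Orth c (⊥ : Ideal (SkewCyclicRing K σ)) C' := by
  intro ξ hξ η _
  rw [(Submodule.mem_bot _).1 hξ, zero_mul]

theorem orth_bot_right (c : K' →+* K) (C : Ideal (SkewCyclicRing K σ)) :
    Orth c C (⊥ : Ideal (SkewCyclicRing K' σ')) := by
  intro ξ _ η hη
  rw [(Submodule.mem_bot _).1 hη]
  ext <;> simp [conjTranspose]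

theorem orth_top_left {c : K' →+* K} (hinj : Function.Injective c)
    {C' : Ideal (SkewCyclicRing K' σ')} :
    Orth c (⊤ : Ideal (SkewCyclicRing K σ)) C' ↔ C' = ⊥ := by
  refine ⟨fun h => (Submodule.eq_bot_iff _).2 fun η hη => ?_, fun h => h ▸ orth_bot_right c _⟩
  have hs0 : ∀ a : K, σ.1 a = 0 → a = 0 := fun a h => by rw [← σ.2 a, h]; simp
  have hc0 : ∀ a : K', c a = 0 → a = 0 := fun a h => hinj (by simpa using h)
  have := h 1 trivial η hη
  rw [one_mul] at this
  ext
  · exact hc0 _ (congrArg c₀ this)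
  · exact hc0 _ (hs0 _ (hs0 _ (congrArg c₂ this)))
  · exact hc0 _ (hs0 _ (congrArg c₁ this))

theorem orth_top_right {c : K' →+* K} {C : Ideal (SkewCyclicRing K σ)} :
    Orth c C (⊤ : Ideal (SkewCyclicRing K' σ')) ↔ C = ⊥ := by
  refine ⟨fun h => (Submodule.eq_bot_iff _).2 fun ξ hξ => ?_, fun h => h ▸ orth_bot_left c _⟩
  have := h ξ hξ 1 trivial
  rwa [show conjTranspose σ c (1 : SkewCyclicRing K' σ') = 1 by ext <;> simp [conjTranspose],
    mul_one] at this

/-- The first generator satisfies yg = αg, hence so does the product g t*. Its coefficients then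
determine one another, and one equation suffices; it depends only on δ = α c(β). -/
theorem orth_line_line {c : K' →+* K} (hc : ∀ a, c (σ'.1 a) = σ.1 (c a)) {α : Kˣ} {β : K'ˣ}
    (hα : α ∈ normOne σ) (hβ : β ∈ normOne σ') :
    Orth c (lineIdeal σ α) (lineIdeal σ' β) ↔
      1 + α * c β + α * c β * σ.1 (σ.1 (α * c β)) = 0 := by
  rw [lineIdeal, lineIdeal, orth_span hc, inv_eq_of_mem_normOne hα, inv_eq_of_mem_normOne hβ]
  rw [mem_normOne] at hα hβ
  have hβ := congrArg c hβ
  simp only [map_mul, hc, map_one] at hβ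
  rw [SkewCyclicRing.ext_iff]
  simp only [conjTranspose, mul_c₀, mul_c₁, mul_c₂, add_c₀, add_c₁, add_c₂, const_c₀, const_c₁,
      const_c₂, y_c₀, y_c₁, y_c₂, map_add, map_zero, map_one, y_pow_two, map_mul, σ.2, hc,
      zero_c₀, zero_c₁, zero_c₂]
  generalize (α : K) = a at *
  generalize c (β : K') = b at *
  constructor
  · rintro ⟨h, -⟩
    linear_combination a * b * h - b * σ.1 b * σ.1 (σ.1 b) * hα - hβ
  · intro h
    -- The constant coefficient of the product. It is the hypothesis times σ(δ)σ²(δ), where δ = ab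
    -- has norm one.
    have hX : σ.1 a * σ.1 (σ.1 a) * (σ.1 b * σ.1 (σ.1 b)) + σ.1 (σ.1 a) * σ.1 (σ.1 b) + 1 = 0 := by
      linear_combination σ.1 a * σ.1 (σ.1 a) * (σ.1 b * σ.1 (σ.1 b)) * h +
        (-1 - σ.1 (σ.1 a) * σ.1 (σ.1 b)) * (b * σ.1 b * σ.1 (σ.1 b) * hα + hβ)
    refine ⟨by linear_combination hX, ?_, ?_⟩
    · linear_combination b * hX - σ.1 a * σ.1 (σ.1 a) * hβ
    · linear_combination b * σ.1 b * hX - (σ.1 a * σ.1 (σ.1 a) * σ.1 b + σ.1 (σ.1 a)) * hβ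

theorem orth_line_plane {c : K' →+* K} (hc : ∀ a, c (σ'.1 a) = σ.1 (c a)) {α : Kˣ} {β : K'ˣ}
    (hα : α ∈ normOne σ) :
    Orth c (lineIdeal σ α) (planeIdeal σ' β) ↔ σ.1 α * c β = 1 := by
  rw [lineIdeal, planeIdeal, orth_span hc, inv_eq_of_mem_normOne hα]
  rw [mem_normOne] at hα
  rw [SkewCyclicRing.ext_iff]
  simp only [conjTranspose, mul_c₀, mul_c₁, mul_c₂, add_c₀, add_c₁, add_c₂, const_c₀, const_c₁,
      const_c₂, y_c₀, y_c₁, y_c₂, map_add, map_zero, map_one, y_pow_two,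
      zero_c₀, zero_c₁, zero_c₂, neg_c₀, neg_c₁, neg_c₂, map_neg]
  generalize (α : K) = a at *
  generalize c (β : K') = b at *
  constructor
  · rintro ⟨h, h1, h2⟩
    linear_combination -a * σ.1 a * h + (1 - σ.1 a * b) * hα
  · intro h
    have h1 := congrArg σ.1 h
    have h2 := congrArg σ.1 h1
    simp only [map_mul, map_one, σ.2] at h1 h2
    refine ⟨?_, ?_, ?_⟩
    · linear_combination -σ.1 (σ.1 a) * h
    · linear_combination -h1
    · linear_combination -σ.1 a * σ.1 (σ.1 a) * h2 + σ.1 (σ.1 b) * hα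

theorem orth_plane_line {c : K' →+* K} (hc : ∀ a, c (σ'.1 a) = σ.1 (c a)) {α : Kˣ} {β : K'ˣ}
    (hβ : β ∈ normOne σ') :
    Orth c (planeIdeal σ α) (lineIdeal σ' β) ↔ α * σ.1 (c β) = 1 := by
  rw [lineIdeal, planeIdeal, orth_span hc, inv_eq_of_mem_normOne hβ]
  rw [mem_normOne] at hβ
  have hβ := congrArg c hβ
  simp only [map_mul, hc, map_one] at hβ
  rw [SkewCyclicRing.ext_iff]
  simp only [conjTranspose, mul_c₀, mul_c₁, mul_c₂, add_c₀, add_c₁, add_c₂, const_c₀, const_c₁,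
      const_c₂, y_c₀, y_c₁, y_c₂, map_add, map_zero, map_one, y_pow_two, map_mul, σ.2, hc,
      zero_c₀, zero_c₁, zero_c₂, neg_c₀, neg_c₁, neg_c₂]
  generalize (α : K) = a at *
  generalize c (β : K') = b at *
  constructor
  · rintro ⟨h, h1, h2⟩
    linear_combination -h2
  · intro h
    refine ⟨?_, ?_, ?_⟩
    · linear_combination -σ.1 (σ.1 b) * h
    · linear_combination a * hβ - b * σ.1 (σ.1 b) * h
    · linear_combination -h

/-- The y²-coefficient of the product of the generators is -α, a unit. -/
theorem not_orth_plane_plane [Nontrivial K] {c : K' →+* K} (hc : ∀ a, c (σ'.1 a) = σ.1 (c a))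
    {α : Kˣ} {β : K'ˣ} : ¬ Orth c (planeIdeal σ α) (planeIdeal σ' β) := by
  rw [planeIdeal, planeIdeal, orth_span hc]
  intro h
  have := congrArg c₂ h
  simp [conjTranspose] at this

end SkewCyclicRing

/-- Used to count pairs of ideals fibrewise over the first ideal. -/
theorem Set.ncard_setOf_mem_prod {A B : Type*} [Finite A] [Finite B] (s : Set A) (t : A → Set B)
    (k : ℕ) (ht : ∀ a ∈ s, (t a).ncard = k) :
    {p : A × B | p.1 ∈ s ∧ p.2 ∈ t p.1}.ncard = s.ncard * k := by
  classical
  have := Fintype.ofFinite A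
  have := Fintype.ofFinite B
  have h : {p : A × B | p.1 ∈ s ∧ p.2 ∈ t p.1} =
      ((s.toFinset.sigma fun a => (t a).toFinset).map
        (Equiv.sigmaEquivProd A B).toEmbedding : Finset (A × B)) := by
    ext ⟨a, b⟩
    simp [Equiv.sigmaEquivProd]
  rw [h, Set.ncard_coe_finset, Finset.card_map, Finset.card_sigma,
    Finset.sum_congr rfl (g := fun _ => k), Finset.sum_const, smul_eq_mul,
    ← Set.ncard_eq_toFinset_card']
  intro a ha
  rw [← Set.ncard_eq_toFinset_card', ht a (by simpa using ha)]

/-! ### Orthogonal pairs of left ideals: classification and counting. -/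

namespace SkewCyclicRing

variable {K K' : Type*} [CommRing K] [CommRing K'] {σ : {σ : K →+* K // ∀ a, σ (σ (σ a)) = a}}
  {σ' : {σ : K' →+* K' // ∀ a, σ (σ (σ a)) = a}}

/-- The elements `δ` for which the line ideals of `α` and `β`, where `α c(β) = δ`, are
orthogonal. -/
def lineSet (σ : {σ : K →+* K // ∀ a, σ (σ (σ a)) = a}) : Set K :=
  {δ | 1 + δ + δ * σ.1 (σ.1 δ) = 0}

theorem mem_lineSet {δ : K} : δ ∈ lineSet σ ↔ 1 + δ + δ * σ.1 (σ.1 δ) = 0 := Iff.rfl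

/-- Apply σ² to the defining equation, multiply by δ and subtract the equation. Consequently every δ
in the set is α c(β) for some β of norm one. -/
theorem norm_eq_one_of_mem_lineSet {δ : K} (h : δ ∈ lineSet σ) :
    δ * σ.1 δ * σ.1 (σ.1 δ) = 1 := by
  rw [mem_lineSet] at h
  have h1 := congrArg (fun t => σ.1 (σ.1 t)) h
  simp only [map_add, map_mul, map_one, map_zero, σ.2] at h1
  linear_combination δ * h1 - h

/-- The common source of all the tables: the classification applied to both ideals, with the tests
on generators. It covers σ = id and σ of order three alike. -/
theorem orth_iff [Nontrivial K] (hK : ∀ a : K, a ≠ 0 → IsUnit a)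
    (hK' : ∀ a : K', a ≠ 0 → IsUnit a) {c : K' →+* K} (hc : ∀ a, c (σ'.1 a) = σ.1 (c a))
    (hinj : Function.Injective c)
    {C : Ideal (SkewCyclicRing K σ)} {C' : Ideal (SkewCyclicRing K' σ')} :
    Orth c C C' ↔ C = ⊥ ∨
      (∃ α ∈ normOne σ, C = lineIdeal σ α ∧ (C' = ⊥ ∨
        (∃ β ∈ normOne σ', (α : K) * c β ∈ lineSet σ ∧ C' = lineIdeal σ' β) ∨
        ∃ β ∈ normOne σ', σ.1 α * c β = 1 ∧ C' = planeIdeal σ' β)) ∨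
      (∃ α ∈ normOne σ, C = planeIdeal σ α ∧ (C' = ⊥ ∨
        ∃ β ∈ normOne σ', α * σ.1 (c β) = 1 ∧ C' = lineIdeal σ' β)) ∨
      (C = ⊤ ∧ C' = ⊥) := by
  constructor
  · intro h
    rcases ideal_classification hK C with rfl | rfl | ⟨α, hα, rfl⟩ | ⟨α, hα, rfl⟩
    · exact Or.inl rfl
    · exact Or.inr (Or.inr (Or.inr ⟨rfl, (orth_top_left hinj).1 h⟩))
    · refine Or.inr (Or.inr (Or.inl ⟨α, hα, rfl, ?_⟩))
      rcases ideal_classification hK' C' with rfl | rfl | ⟨β, hβ, rfl⟩ | ⟨β, hβ, rfl⟩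
      · exact Or.inl rfl
      · exact absurd (orth_top_right.1 h) planeIdeal_ne_bot
      · exact absurd h (not_orth_plane_plane hc)
      · exact Or.inr ⟨β, hβ, (orth_plane_line hc hβ).1 h, rfl⟩
    · refine Or.inr (Or.inl ⟨α, hα, rfl, ?_⟩)
      rcases ideal_classification hK' C' with rfl | rfl | ⟨β, hβ, rfl⟩ | ⟨β, hβ, rfl⟩
      · exact Or.inl rfl
      · exact absurd (orth_top_right.1 h) lineIdeal_ne_bot
      · exact Or.inr (Or.inr ⟨β, hβ, (orth_line_plane hc hα).1 h, rfl⟩)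
      · exact Or.inr (Or.inl ⟨β, hβ, (orth_line_line hc hα hβ).1 h, rfl⟩)
  · rintro (rfl | ⟨α, hα, rfl, rfl | ⟨β, hβ, h, rfl⟩ | ⟨β, hβ, h, rfl⟩⟩ |
      ⟨α, hα, rfl, rfl | ⟨β, hβ, h, rfl⟩⟩ | ⟨rfl, rfl⟩)
    · exact orth_bot_left _ _
    · exact orth_bot_right _ _
    · exact (orth_line_line hc hα hβ).2 h
    · exact (orth_line_plane hc hα).2 h
    · exact orth_bot_right _ _
    · exact (orth_plane_line hc hβ).2 h
    · exact orth_bot_right _ _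

/-- With C' = C the mixed cases disappear, because a line is never a plane. -/
theorem orth_self_iff [Nontrivial K] (hK : ∀ a : K, a ≠ 0 → IsUnit a)
    {c : K →+* K} (hc : ∀ a, c (σ.1 a) = σ.1 (c a)) (hinj : Function.Injective c)
    {C : Ideal (SkewCyclicRing K σ)} :
    Orth c C C ↔ C = ⊥ ∨
      ∃ α ∈ normOne σ, (α : K) * c α ∈ lineSet σ ∧ C = lineIdeal σ α := by
  rw [orth_iff hK hK hc hinj]
  constructor
  · rintro (rfl | ⟨α, hα, rfl, h | ⟨β, hβ, h, e⟩ | ⟨β, hβ, h, e⟩⟩ |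
      ⟨α, hα, rfl, h | ⟨β, hβ, h, e⟩⟩ | ⟨rfl, h⟩)
    · exact Or.inl rfl
    · exact absurd h lineIdeal_ne_bot
    · obtain rfl := lineIdeal_injOn hα hβ e
      exact Or.inr ⟨α, hα, h, rfl⟩
    · exact absurd e.symm (planeIdeal_ne_lineIdeal hα)
    · exact absurd h planeIdeal_ne_bot
    · exact absurd e (planeIdeal_ne_lineIdeal hβ)
    · exact absurd h top_ne_bot
  · rintro (rfl | ⟨α, hα, h, rfl⟩)
    · exact Or.inl rfl
    · exact Or.inr (Or.inl ⟨α, hα, rfl, Or.inr (Or.inl ⟨α, hα, h, rfl⟩)⟩)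

theorem map_mem_normOne {c : K' →+* K} (hc : ∀ a, c (σ'.1 a) = σ.1 (c a)) {β : K'ˣ}
    (h : β ∈ normOne σ') : Units.map (c : K' →* K) β ∈ normOne σ := by
  rw [mem_normOne] at *
  have := congrArg c h
  simpa [hc] using this

theorem frob_mem_normOne {α : Kˣ} (h : α ∈ normOne σ) :
    Units.map (σ.1 : K →* K) α ∈ normOne σ := map_mem_normOne (fun _ => rfl) h

section Counting

variable [Finite K] [Finite K'] [Nontrivial K] [Nontrivial K']
  (hK : ∀ a : K, a ≠ 0 → IsUnit a) (hK' : ∀ a : K', a ≠ 0 → IsUnit a)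

include hK in
theorem ncard_ideals :
    (Set.univ : Set (Ideal (SkewCyclicRing K σ))).ncard = 2 + 2 * (normOne σ : Set Kˣ).ncard := by
  have h : (Set.univ : Set (Ideal (SkewCyclicRing K σ))) =
      {⊥, ⊤} ∪ (planeIdeal σ '' normOne σ ∪ lineIdeal σ '' normOne σ) := by
    refine (Set.eq_univ_of_forall fun C => ?_).symm
    rcases ideal_classification hK C with rfl | rfl | ⟨α, hα, rfl⟩ | ⟨α, hα, rfl⟩
    · simp
    · simp
    · exact Or.inr (Or.inl ⟨α, hα, rfl⟩)
    · exact Or.inr (Or.inr ⟨α, hα, rfl⟩)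
  rw [h, Set.ncard_union_eq _ (Set.toFinite _) (Set.toFinite _),
    Set.ncard_union_eq _ (Set.toFinite _) (Set.toFinite _), Set.ncard_pair bot_ne_top,
    planeIdeal_injOn.ncard_image, lineIdeal_injOn.ncard_image, two_mul]
  · rw [Set.disjoint_left]
    rintro _ ⟨α, hα, rfl⟩ ⟨β, hβ, h⟩
    exact planeIdeal_ne_lineIdeal hβ h.symm
  · rw [Set.disjoint_left]
    rintro _ (rfl | rfl) (⟨α, hα, h⟩ | ⟨α, hα, h⟩)
    · exact planeIdeal_ne_bot h
    · exact lineIdeal_ne_bot h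
    · exact planeIdeal_ne_top hα h
    · exact lineIdeal_ne_top hα h

variable {c : K' →+* K} {c' : K →+* K'} (hc : ∀ a, c (σ'.1 a) = σ.1 (c a))
  (hc' : ∀ a, c' (σ.1 a) = σ'.1 (c' a)) (h₁ : ∀ a, c (c' a) = a) (h₂ : ∀ a, c' (c a) = a)

omit [Finite K] [Finite K'] [Nontrivial K] [Nontrivial K'] in
include hc hc' h₁ h₂ in
theorem ncard_normOne : (normOne σ' : Set K'ˣ).ncard = (normOne σ : Set Kˣ).ncard := by
  refine Set.ncard_congr (fun β _ => Units.map (c : K' →* K) β) (fun β hβ => map_mem_normOne hc hβ)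
    (fun a b _ _ h => ?_) fun α hα => ⟨Units.map (c' : K →* K') α, map_mem_normOne hc' hα, ?_⟩
  · have := congrArg (fun u : Kˣ => c' u) h
    simpa [h₂, Units.ext_iff] using this
  · ext; simp [h₁]

include hK hK' hc hc' h₁ h₂

omit [Finite K] [Finite K'] [Nontrivial K'] hK in
theorem setOf_orth_plane {α : Kˣ} (hα : α ∈ normOne σ) :
    {C' : Ideal (SkewCyclicRing K' σ') | Orth c (planeIdeal σ α) C'} =
      {⊥, lineIdeal σ' (Units.map (σ'.1 : K' →* K') (Units.map (σ'.1 : K' →* K')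
        (Units.map (c' : K →* K') α)⁻¹))} := by
  have hinj : Function.Injective c := Function.LeftInverse.injective h₂
  set β₀ := Units.map (σ'.1 : K' →* K') (Units.map (σ'.1 : K' →* K')
        (Units.map (c' : K →* K') α)⁻¹)
  have hβ₀ : β₀ ∈ normOne σ' :=
    frob_mem_normOne (frob_mem_normOne (inv_mem (map_mem_normOne hc' hα)))
  -- `β₀` solves the plane–line equation; injectivity of c makes the solution unique.
  have hu : (α : K) * σ.1 (c β₀) = 1 := by
    have : σ.1 (c β₀) = ((α⁻¹ : Kˣ) : K) := by simp [β₀, hc, σ.2, ← map_inv, h₁]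
    rw [this, Units.mul_inv]
  ext C'
  rw [Set.mem_ofPred_eq, Set.mem_insert_iff, Set.mem_singleton_iff]
  constructor
  · intro h
    rcases ideal_classification hK' C' with rfl | rfl | ⟨β, hβ, rfl⟩ | ⟨β, hβ, rfl⟩
    · exact Or.inl rfl
    · exact absurd (orth_top_right.1 h) planeIdeal_ne_bot
    · exact absurd h (not_orth_plane_plane hc)
    · right
      have h := (orth_plane_line hc hβ).1 h
      have h3 : σ.1 (c β) = σ.1 (c β₀) := by
        rw [← α.inv_mul_cancel_left (σ.1 (c β)), h, ← hu, α.inv_mul_cancel_left]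
      rw [← hc, ← hc] at h3
      have h4 := congrArg (fun t => σ'.1 (σ'.1 t)) (hinj h3)
      simp only [σ'.2] at h4
      rw [Units.ext h4]
  · rintro (rfl | rfl)
    · exact orth_bot_right _ _
    · exact (orth_plane_line hc hβ₀).2 hu

omit [Finite K] [Finite K'] hK in
theorem ncard_orth_plane {α : Kˣ} (hα : α ∈ normOne σ) :
    {C' : Ideal (SkewCyclicRing K' σ') | Orth c (planeIdeal σ α) C'}.ncard = 2 := by
  rw [setOf_orth_plane hK' hc hc' h₁ h₂ hα, Set.ncard_pair lineIdeal_ne_bot.symm]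

omit [Finite K] [Finite K'] [Nontrivial K'] hK hc' in
theorem setOf_orth_line {α : Kˣ} (hα : α ∈ normOne σ) :
    {C' : Ideal (SkewCyclicRing K' σ') | Orth c (lineIdeal σ α) C'} =
      {⊥, planeIdeal σ' (Units.map (σ'.1 : K' →* K') (Units.map (c' : K →* K') α)⁻¹)} ∪
        lineIdeal σ' '' {β | β ∈ normOne σ' ∧ (α : K) * c β ∈ lineSet σ} := by
  have hinj : Function.Injective c := Function.LeftInverse.injective h₂
  set β₀ := Units.map (σ'.1 : K' →* K') (Units.map (c' : K →* K') α)⁻¹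
  have hu' : c β₀ = σ.1 ((α⁻¹ : Kˣ) : K) := by simp [β₀, hc, ← map_inv, h₁]
  have hu : σ.1 α * c β₀ = 1 := by
    rw [hu', ← map_mul, Units.mul_inv, map_one]
  ext C'
  rw [Set.mem_ofPred_eq, Set.mem_union, Set.mem_insert_iff, Set.mem_singleton_iff]
  constructor
  · intro h
    rcases ideal_classification hK' C' with rfl | rfl | ⟨β, hβ, rfl⟩ | ⟨β, hβ, rfl⟩
    · exact Or.inl (Or.inl rfl)
    · exact absurd (orth_top_right.1 h) lineIdeal_ne_bot
    · left; right
      have h := (orth_line_plane hc hα).1 h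
      have h3 : c β = c β₀ := by linear_combination c β₀ * h - c β * hu
      rw [Units.ext (hinj h3)]
    · exact Or.inr ⟨β, ⟨hβ, (orth_line_line hc hα hβ).1 h⟩, rfl⟩
  · rintro ((rfl | rfl) | ⟨β, ⟨hβ, h⟩, rfl⟩)
    · exact orth_bot_right _ _
    · exact (orth_line_plane hc hα).2 hu
    · exact (orth_line_line hc hα hβ).2 h

omit hK in
-- Besides zero and one plane, the orthogonal ideals are lines. Under β ↦ α c(β) these lines
-- correspond bijectively to `lineSet σ`, so the number does not depend on α.
theorem ncard_orth_line {α : Kˣ} (hα : α ∈ normOne σ) :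
    {C' : Ideal (SkewCyclicRing K' σ') | Orth c (lineIdeal σ α) C'}.ncard =
      2 + (lineSet σ).ncard := by
  have hinj : Function.Injective c := Function.LeftInverse.injective h₂
  have himg : (fun β : K'ˣ => (α : K) * c β) ''
      {β | β ∈ normOne σ' ∧ (α : K) * c β ∈ lineSet σ} = lineSet σ := by
    ext δ
    constructor
    · rintro ⟨β, ⟨-, h⟩, rfl⟩
      exact h
    · intro h
      have hN := norm_eq_one_of_mem_lineSet h
      let d : Kˣ := Units.mkOfMulEqOne δ (σ.1 δ * σ.1 (σ.1 δ)) (by rw [← mul_assoc, hN])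
      have hd : d ∈ normOne σ := hN
      have e : (α : K) * c (Units.map (c' : K →* K') (α⁻¹ * d)) = δ := by
        simp [h₁]; rfl
      exact ⟨Units.map (c' : K →* K') (α⁻¹ * d),
        ⟨map_mem_normOne hc' (mul_mem (inv_mem hα) hd), by rw [e]; exact h⟩, e⟩
  rw [setOf_orth_line hK' hc h₁ h₂ hα,
    Set.ncard_union_eq _ (Set.toFinite _) (Set.toFinite _), Set.ncard_pair planeIdeal_ne_bot.symm,
    (lineIdeal_injOn.mono fun _ h => h.1).ncard_image]
  · conv_rhs => rw [← himg]
    rw [Set.ncard_image_of_injective]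
    intro a b h
    exact Units.ext (hinj (α.isUnit.mul_left_cancel h))
  · rw [Set.disjoint_left]
    rintro _ (rfl | rfl) ⟨β, ⟨hβ, -⟩, h⟩
    · exact lineIdeal_ne_bot h
    · exact planeIdeal_ne_lineIdeal hβ h.symm

omit [Nontrivial K] hK in
theorem ncard_pairs_bot :
    {p : Ideal (SkewCyclicRing K σ) × Ideal (SkewCyclicRing K' σ') |
      p.1 = ⊥ ∧ Orth c p.1 p.2}.ncard = 2 + 2 * (normOne σ : Set Kˣ).ncard := by
  have := Set.ncard_setOf_mem_prod {(⊥ : Ideal (SkewCyclicRing K σ))}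
    (fun C => {C' : Ideal (SkewCyclicRing K' σ') | Orth c C C'})
    (2 + 2 * (normOne σ : Set Kˣ).ncard) (by
      rintro _ rfl
      rw [← ncard_normOne hc hc' h₁ h₂, ← ncard_ideals hK']
      congr 1
      exact Set.eq_univ_of_forall fun C' => orth_bot_left c C')
  rwa [Set.ncard_singleton, one_mul] at this

omit hK in
theorem ncard_pairs_line :
    {p : Ideal (SkewCyclicRing K σ) × Ideal (SkewCyclicRing K' σ') |
      p.1 ∈ lineIdeal σ '' normOne σ ∧ Orth c p.1 p.2}.ncard =
        (normOne σ : Set Kˣ).ncard * (2 + (lineSet σ).ncard) := by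
  have := Set.ncard_setOf_mem_prod (lineIdeal σ '' normOne σ)
    (fun C => {C' : Ideal (SkewCyclicRing K' σ') | Orth c C C'})
    (2 + (lineSet σ).ncard) (by
      rintro _ ⟨α, hα, rfl⟩
      exact ncard_orth_line hK' hc hc' h₁ h₂ hα)
  rwa [lineIdeal_injOn.ncard_image] at this

omit hK in
theorem ncard_pairs_plane :
    {p : Ideal (SkewCyclicRing K σ) × Ideal (SkewCyclicRing K' σ') |
      p.1 ∈ planeIdeal σ '' normOne σ ∧ Orth c p.1 p.2}.ncard =
        (normOne σ : Set Kˣ).ncard * 2 := by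
  have := Set.ncard_setOf_mem_prod (planeIdeal σ '' normOne σ)
    (fun C => {C' : Ideal (SkewCyclicRing K' σ') | Orth c C C'}) 2 (by
      rintro _ ⟨α, hα, rfl⟩
      exact ncard_orth_plane hK' hc hc' h₁ h₂ hα)
  rwa [planeIdeal_injOn.ncard_image] at this

omit [Finite K] [Finite K'] [Nontrivial K] [Nontrivial K'] hK hK' hc hc' h₁ in
theorem ncard_pairs_top :
    {p : Ideal (SkewCyclicRing K σ) × Ideal (SkewCyclicRing K' σ') |
      p.1 = ⊤ ∧ Orth c p.1 p.2}.ncard = 1 := by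
  have hinj : Function.Injective c := Function.LeftInverse.injective h₂
  rw [Set.ncard_eq_one]
  refine ⟨(⊤, ⊥), ?_⟩
  ext ⟨C, C'⟩
  simp only [Set.mem_ofPred_eq, Set.mem_singleton_iff, Prod.mk.injEq]
  refine and_congr_right ?_
  rintro rfl
  exact orth_top_left hinj

/-- With N norm-one elements and M = |`lineSet σ`|, the first ideal contributes 2 + 2N pairs if it
is zero, 1 if it is the whole ring, N(2 + M) if it is a line and 2N if it is a plane. -/
theorem ncard_pairs :
    {p : Ideal (SkewCyclicRing K σ) × Ideal (SkewCyclicRing K' σ') | Orth c p.1 p.2}.ncard =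
      3 + (normOne σ : Set Kˣ).ncard * (6 + (lineSet σ).ncard) := by
  have h : {p : Ideal (SkewCyclicRing K σ) × Ideal (SkewCyclicRing K' σ') | Orth c p.1 p.2} =
      ({p | p.1 = ⊥ ∧ Orth c p.1 p.2} ∪ {p | p.1 = ⊤ ∧ Orth c p.1 p.2}) ∪
      ({p | p.1 ∈ lineIdeal σ '' normOne σ ∧ Orth c p.1 p.2} ∪
        {p | p.1 ∈ planeIdeal σ '' normOne σ ∧ Orth c p.1 p.2}) := by
    ext ⟨C, C'⟩
    simp only [Set.mem_ofPred_eq, Set.mem_union, ← or_and_right]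
    refine (and_iff_right ?_).symm
    rcases ideal_classification hK C with rfl | rfl | ⟨α, hα, rfl⟩ | ⟨α, hα, rfl⟩
    · exact Or.inl (Or.inl rfl)
    · exact Or.inl (Or.inr rfl)
    · exact Or.inr (Or.inr ⟨α, hα, rfl⟩)
    · exact Or.inr (Or.inl ⟨α, hα, rfl⟩)
  rw [h, Set.ncard_union_eq _ (Set.toFinite _) (Set.toFinite _),
    Set.ncard_union_eq _ (Set.toFinite _) (Set.toFinite _),
    Set.ncard_union_eq _ (Set.toFinite _) (Set.toFinite _),
    ncard_pairs_bot hK' hc hc' h₁ h₂, ncard_pairs_line hK' hc hc' h₁ h₂,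
    ncard_pairs_plane hK' hc hc' h₁ h₂, ncard_pairs_top h₂]
  · ring
  · rw [Set.disjoint_left]
    rintro ⟨_, _⟩ ⟨⟨α, hα, rfl⟩, -⟩ ⟨⟨β, hβ, e⟩, -⟩
    exact planeIdeal_ne_lineIdeal hα e
  · rw [Set.disjoint_left]
    rintro ⟨_, _⟩ ⟨rfl, -⟩ ⟨e, -⟩
    exact bot_ne_top e
  · rw [Set.disjoint_left]
    rintro ⟨_, _⟩ (⟨rfl, -⟩ | ⟨rfl, -⟩) (⟨⟨β, hβ, e⟩, -⟩ | ⟨⟨β, hβ, e⟩, -⟩)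
    · exact lineIdeal_ne_bot e
    · exact planeIdeal_ne_bot e
    · exact lineIdeal_ne_top hβ e
    · exact planeIdeal_ne_top hβ e

end Counting

end SkewCyclicRing

/-- A polynomial over a finite field that divides `X ^ n - 1`, where `n` divides the order of the
group of units, has as many roots as its degree. -/
theorem FiniteField.ncard_roots_of_dvd {K : Type*} [Field K] [Finite K] {p : K[X]} {n : ℕ}
    (hn : n ∣ Nat.card K - 1) (hp : p ∣ X ^ n - 1) :
    {a : K | p.eval a = 0}.ncard = p.natDegree := by
  classical
  have := Fintype.ofFinite K
  have hcard : Nat.card K = Fintype.card K := Nat.card_eq_fintype_card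
  have h1 : 1 < Fintype.card K := Fintype.one_lt_card
  -- X^n - 1 divides X^(|K|-1) - 1, and X^|K| - X has every element of K as a simple root.
  have hd : p ∣ X ^ Fintype.card K - X := by
    have : (X ^ Fintype.card K - X : K[X]) = X * (X ^ (Fintype.card K - 1) - 1) := by
      rw [mul_sub, ← pow_succ', Nat.sub_add_cancel h1.le, mul_one]
    rw [this]
    refine (hp.trans ?_).mul_left _
    rw [← hcard]
    obtain ⟨l, hl⟩ := hn
    rw [hl, pow_mul]
    simpa using sub_dvd_pow_sub_pow ((X : K[X]) ^ n) 1 l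
  have h0 : (X ^ Fintype.card K - X : K[X]) ≠ 0 := FiniteField.X_pow_card_sub_X_ne_zero K h1
  have hp0 : p ≠ 0 := fun h => h0 (zero_dvd_iff.1 (h ▸ hd))
  have hsplit : (X ^ Fintype.card K - X : K[X]).Splits := by
    rw [splits_iff_card_roots, FiniteField.roots_X_pow_card_sub_X,
      FiniteField.X_pow_card_sub_X_natDegree_eq K h1]
    rfl
  have hnodup : p.roots.Nodup := by
    refine Multiset.nodup_of_le (roots.le_of_dvd h0 hd) ?_
    rw [FiniteField.roots_X_pow_card_sub_X]
    exact Finset.univ.nodup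
  have hs := hsplit.of_dvd h0 hd
  have : {a : K | p.eval a = 0} = (p.roots.toFinset : Set K) := by
    ext a; simp [hp0]
  rw [this, Set.ncard_coe_finset, Multiset.toFinset_card_of_nodup hnodup,
    hs.natDegree_eq_card_roots]

/-! ### Trinomials over a field with Q³ elements. -/

section

variable {K : Type*} [Field K] [Finite K] {p k Q : ℕ}

omit [Field K] [Finite K] in
theorem norm_exponent_dvd (h : Nat.card K = Q ^ 3) : 1 + Q + Q ^ 2 ∣ Nat.card K - 1 := by
  rw [h]
  refine ⟨Q - 1, ?_⟩
  -- For Q = 0 the truncated subtractions make both sides zero.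
  rcases Q with _ | Q
  · rfl
  · simp only [Nat.add_sub_cancel]
    apply Nat.sub_eq_of_eq_add; ring

/-- For f = X^(Q+1) + X + 1 the Q-th power acts termwise, and X f^Q - f = X^(1+Q+Q²) - 1. So f
divides the latter and splits with simple roots. -/
theorem ncard_one_add_add_pow [ExpChar K p] (hQ : Q = p ^ k) (h : Nat.card K = Q ^ 3) :
    {a : K | 1 + a + a ^ (Q + 1) = 0}.ncard = Q + 1 := by
  have h0 : Q ≠ 0 := by rw [hQ]; exact pow_ne_zero _ (expChar_pos K p).ne'
  have hd : (X ^ (Q + 1) + X + 1 : K[X]) ∣ X ^ (1 + Q + Q ^ 2) - 1 := by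
    have e : (X ^ (Q + 1) + X + 1 : K[X]) ^ Q = X ^ ((Q + 1) * Q) + X ^ Q + 1 := by
      rw [pow_mul]
      generalize (X : K[X]) ^ (Q + 1) = Y
      rw [hQ, add_pow_expChar_pow, add_pow_expChar_pow, one_pow]
    refine ⟨X * (X ^ (Q + 1) + X + 1) ^ (Q - 1) - 1, ?_⟩
    have e2 : (X ^ (Q + 1) + X + 1 : K[X]) * (X ^ (Q + 1) + X + 1) ^ (Q - 1) =
      (X ^ (Q + 1) + X + 1) ^ Q := mul_pow_sub_one h0 _
    calc _ = X * (X ^ ((Q + 1) * Q) + X ^ Q + 1) - (X ^ (Q + 1) + X + 1 : K[X]) := by ring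
      _ = _ := by rw [← e, ← e2]; ring
  have := FiniteField.ncard_roots_of_dvd (norm_exponent_dvd h) hd
  have hdeg : (X ^ (Q + 1) + X + 1 : K[X]).natDegree = Q + 1 := by
    compute_degree!
    simp [h0]
  rw [hdeg] at this
  refine Eq.trans (congrArg Set.ncard ?_) this
  ext a
  simp only [Set.mem_ofPred_eq, eval_add, eval_pow, eval_X, eval_one]
  rw [show 1 + a + a ^ (Q + 1) = a ^ (Q + 1) + a + 1 by ring]

/-- Here, for f = X^(Q+1) + X^Q + 1, the identity is X^(Q²) f - f^Q = X^(1+Q+Q²) - 1. -/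
theorem ncard_one_add_pow_add_pow [ExpChar K p] (hQ : Q = p ^ k) (h : Nat.card K = Q ^ 3) :
    {a : K | 1 + a ^ Q + a ^ (Q + 1) = 0}.ncard = Q + 1 := by
  have h0 : Q ≠ 0 := by rw [hQ]; exact pow_ne_zero _ (expChar_pos K p).ne'
  have hd : (X ^ (Q + 1) + X ^ Q + 1 : K[X]) ∣ X ^ (1 + Q + Q ^ 2) - 1 := by
    have e : (X ^ (Q + 1) + X ^ Q + 1 : K[X]) ^ Q = X ^ ((Q + 1) * Q) + X ^ (Q * Q) + 1 := by
      rw [pow_mul, pow_mul X Q Q]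
      generalize (X : K[X]) ^ (Q + 1) = Y
      generalize (X : K[X]) ^ Q = Z
      rw [hQ, add_pow_expChar_pow, add_pow_expChar_pow, one_pow]
    refine ⟨X ^ (Q * Q) - (X ^ (Q + 1) + X ^ Q + 1) ^ (Q - 1), ?_⟩
    have e2 : (X ^ (Q + 1) + X ^ Q + 1 : K[X]) * (X ^ (Q + 1) + X ^ Q + 1) ^ (Q - 1) =
      (X ^ (Q + 1) + X ^ Q + 1) ^ Q := mul_pow_sub_one h0 _
    rw [mul_sub, e2, e]
    ring
  have := FiniteField.ncard_roots_of_dvd (norm_exponent_dvd h) hd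
  have hdeg : (X ^ (Q + 1) + X ^ Q + 1 : K[X]).natDegree = Q + 1 := by
    compute_degree!
  rw [hdeg] at this
  refine Eq.trans (congrArg Set.ncard ?_) this
  ext a
  simp only [Set.mem_ofPred_eq, eval_add, eval_pow, eval_X, eval_one]
  rw [show 1 + a ^ Q + a ^ (Q + 1) = a ^ (Q + 1) + a ^ Q + 1 by ring]

end

/-! ### The subgroup of order 1 + Q + Q² in a cyclic group. -/

section

variable {H : Type*} [Group H] [Finite H] {z : H} {Q : ℕ}

omit [Finite H] in
theorem mem_zpowers_pow_sub_one_iff (hz : ∀ u : H, u ∈ Subgroup.zpowers z)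
    (hc : Nat.card H = (Q - 1) * (1 + Q + Q ^ 2)) (u : H) :
    u ∈ Subgroup.zpowers (z ^ (Q - 1)) ↔ u ^ (1 + Q + Q ^ 2) = 1 := by
  constructor
  · rintro ⟨k, rfl⟩
    simp only
    rw [← zpow_natCast, zpow_comm, zpow_natCast, ← pow_mul, ← hc, pow_card_eq_one', one_zpow]
  · intro h
    obtain ⟨k, rfl⟩ := hz u
    simp only at h
    rw [← zpow_natCast, ← zpow_mul, ← orderOf_dvd_iff_zpow_eq_one,
      orderOf_eq_card_of_forall_mem_zpowers hz, hc] at h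
    obtain ⟨l, hl⟩ : ((Q - 1 : ℕ) : ℤ) ∣ k := by
      refine Int.dvd_of_mul_dvd_mul_right (a := ((1 + Q + Q ^ 2 : ℕ) : ℤ)) (by positivity) ?_
      exact_mod_cast h
    exact ⟨l, by simp only; rw [hl, zpow_mul, zpow_natCast]⟩

theorem card_zpowers_pow_sub_one (hz : ∀ u : H, u ∈ Subgroup.zpowers z)
    (hc : Nat.card H = (Q - 1) * (1 + Q + Q ^ 2)) :
    Nat.card (Subgroup.zpowers (z ^ (Q - 1))) = 1 + Q + Q ^ 2 := by
  have hpos : 0 < Nat.card H := Nat.card_pos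
  have hQ : Q - 1 ≠ 0 := fun h => by rw [hc, h, zero_mul] at hpos; exact hpos.false
  rw [Nat.card_zpowers, orderOf_pow_of_dvd hQ, orderOf_eq_card_of_forall_mem_zpowers hz, hc,
    Nat.mul_div_cancel_left _ (Nat.pos_of_ne_zero hQ)]
  rw [orderOf_eq_card_of_forall_mem_zpowers hz, hc]
  exact dvd_mul_right _ _

end

namespace MetacyclicData

variable {F L : Type*} [Field F] [Fintype F] [Field L] [Algebra F L] {P : MetacyclicData F L}

/-! ### The coset fields -/

theorem isUnit_q (P : MetacyclicData F L) : IsUnit (P.q : ZMod P.m) :=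
  (ZMod.isUnit_iff_coprime _ _).2 P.coprime.symm

theorem Coset.mem_iff (J : P.Coset) {a : ZMod P.m} (ha : a ∈ J.1) (b : ZMod P.m) :
    b ∈ J.1 ↔ ∃ k : ℕ, b = a * (P.q : ZMod P.m) ^ k := by
  obtain ⟨a₀, h₀⟩ := J.2
  rw [h₀, mem_cyclotomicCoset] at ha ⊢
  obtain ⟨k, rfl⟩ := ha
  constructor
  · rintro ⟨l, rfl⟩
    obtain ⟨u, hu⟩ := P.isUnit_q
    have h1 : (P.q : ZMod P.m) ^ Nat.card (ZMod P.m)ˣ = 1 := by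
      rw [← hu, ← Units.val_pow_eq_pow_val, pow_card_eq_one', Units.val_one]
    -- The exponent l - k, made nonnegative by adding k times the order of the unit group.
    refine ⟨k * (Nat.card (ZMod P.m)ˣ - 1) + l, ?_⟩
    have h2 : k + (k * (Nat.card (ZMod P.m)ˣ - 1) + l) = Nat.card (ZMod P.m)ˣ * k + l := by
      have : 0 < Nat.card (ZMod P.m)ˣ := Nat.card_pos
      obtain ⟨n, hn⟩ := Nat.exists_eq_succ_of_ne_zero this.ne'
      rw [hn, Nat.succ_sub_one, Nat.succ_eq_add_one]; ring
    rw [mul_assoc, ← pow_add, h2, pow_add, pow_mul, h1, one_pow, one_mul]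
  · rintro ⟨l, rfl⟩
    exact ⟨k + l, by ring⟩

/-- The roots of a polynomial over F are stable under Frobenius, which runs through the whole coset.
Irreducibility of f follows, since f then divides the minimal polynomial of each of its roots. -/
theorem Coset.f_dvd_of_isRoot (J : P.Coset) {a : ZMod P.m} (ha : a ∈ J.1) {g : F[X]}
    (hg : aeval (P.ζ ^ a.val) g = 0) : J.f ∣ g := by
  rw [← map_dvd_map' (algebraMap F L), J.map_f]
  refine Finset.prod_dvd_of_coprime (fun a _ b _ hab => ?_) fun j hj => ?_
  · exact pairwise_coprime_X_sub_C (zeta_injective (P := P)) hab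
  · obtain ⟨k, rfl⟩ := (J.mem_iff ha j).1 hj
    rw [dvd_iff_isRoot, IsRoot.def, eval_map_algebraMap]
    have h1 : P.ζ ^ (a * (P.q : ZMod P.m) ^ k).val =
        (FiniteField.frobeniusAlgHom F L ^ k) (P.ζ ^ a.val) := by
      rw [AlgHom.coe_pow, FiniteField.coe_frobeniusAlgHom, pow_iterate]
      change _ = (P.ζ ^ a.val) ^ Fintype.card F ^ k
      rw [← pow_mul]
      exact zeta_pow_eq (by simp [q])
    rw [h1, aeval_algHom_apply, hg, map_zero]

theorem Coset.nonempty (J : P.Coset) : ∃ a, a ∈ J.1 := by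
  obtain ⟨a, ha⟩ := J.2
  exact ⟨a, ha ▸ mem_cyclotomicCoset.2 ⟨0, by simp⟩⟩

theorem Coset.fact_irreducible_f (J : P.Coset) : Fact (Irreducible J.f) := by
  obtain ⟨a, ha⟩ := J.nonempty
  have hroot : aeval (P.ζ ^ a.val) J.f = 0 := by
    rw [← eval_map_algebraMap, J.map_f, eval_prod]
    exact Finset.prod_eq_zero ha (by simp)
  have hint : IsIntegral F (P.ζ ^ a.val) := ⟨J.f, J.monic_f, hroot⟩
  refine ⟨(associated_of_dvd_dvd (minpoly.dvd F _ hroot) ?_).irreducible (minpoly.irreducible hint)⟩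
  exact J.f_dvd_of_isRoot ha (minpoly.aeval F _)

attribute [local instance] Coset.fact_irreducible_f

theorem Coset.natDegree_f (J : P.Coset) : J.f.natDegree = J.d := by
  rw [← natDegree_map (algebraMap F L), J.map_f, natDegree_prod_of_monic _ _ fun j _ =>
    monic_X_sub_C _, Finset.sum_congr rfl fun j _ => natDegree_X_sub_C _]
  simp [Coset.d]

theorem Coset.finrank_K (J : P.Coset) : Module.finrank F J.K = J.d := by
  rw [(AdjoinRoot.powerBasis' J.monic_f).finrank, AdjoinRoot.powerBasis'_dim, J.natDegree_f]

instance (J : P.Coset) : Module.Finite F J.K := .of_basis (AdjoinRoot.powerBasis' J.monic_f).basis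

instance (J : P.Coset) : Finite J.K := Module.finite_of_finite F

theorem Coset.card_K (J : P.Coset) : Nat.card J.K = P.q ^ J.d := by
  have := Fintype.ofFinite J.K
  rw [Nat.card_eq_fintype_card, Module.card_eq_pow_finrank (K := F), J.finrank_K]
  rfl

theorem Coset.isUnit_K (J : P.Coset) (a : J.K) (h : a ≠ 0) : IsUnit a := h.isUnit

theorem r_eq_pow (P : MetacyclicData F L) :
    ∃ e : ℕ, P.r ≡ Fintype.card F ^ e [MOD P.m] := by
  obtain ⟨e, -, h⟩ := P.frob
  exact ⟨e, h⟩

theorem Coset.theta_apply_algebraMap (J : P.Coset) (c : F) :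
    J.theta.1 (algebraMap F J.K c) = algebraMap F J.K c :=
  AlgHom.commutes (Coset.subst P.r fun _ hj => J.r_mul_mem hj : J.K →ₐ[F] J.K) c

@[simp] theorem Coset.theta_root (J : P.Coset) :
    J.theta.1 (AdjoinRoot.root J.f) = AdjoinRoot.root J.f ^ P.r :=
  Coset.subst_root P.r fun _ hj => J.r_mul_mem hj

/-- Both maps send the root of f to its r-th power, because r ≡ q^e modulo m. -/
theorem Coset.exists_theta_eq_frobenius (J : P.Coset) : ∃ e : ℕ, ∀ a : J.K,
    J.theta.1 a = (FiniteField.frobeniusAlgHom F J.K ^ e) a := by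
  obtain ⟨e, h⟩ := P.r_eq_pow
  refine ⟨e, fun a => ?_⟩
  have : (Coset.subst P.r fun _ hj => J.r_mul_mem hj : J.K →ₐ[F] J.K) =
      FiniteField.frobeniusAlgHom F J.K ^ e := by
    apply AdjoinRoot.algHom_ext
    rw [Coset.subst_root, AlgHom.coe_pow, FiniteField.coe_frobeniusAlgHom, pow_iterate]
    exact pow_eq_pow_of_modEq h J.root_pow
  exact DFunLike.congr_fun this a

theorem Coset.theta_eq_id_iff (J : P.Coset) : (∀ a, J.theta.1 a = a) ↔ J.IsFixed := by
  constructor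
  · intro h j hj
    have h1 := h (AdjoinRoot.root J.f)
    have h2 : J.f ∣ X ^ P.r - X := by
      rw [← AdjoinRoot.mk_eq_zero, map_sub, map_pow, AdjoinRoot.mk_X, ← J.theta_root, h1, sub_self]
    have h3 : aeval (P.ζ ^ j.val) (X ^ P.r - X : F[X]) = 0 := by
      refine aeval_eq_zero_of_dvd_aeval_eq_zero h2 ?_
      rw [← eval_map_algebraMap, J.map_f, eval_prod]
      exact Finset.prod_eq_zero hj (by simp)
    simp only [map_sub, map_pow, aeval_X, sub_eq_zero, ← pow_mul] at h3
    apply zeta_injective (P := P)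
    simp only
    rw [← h3]
    exact zeta_pow_eq (by simp [mul_comm])
  · intro h
    have h2 : J.f ∣ X ^ P.r - X := by
      obtain ⟨a, ha⟩ := J.nonempty
      refine J.f_dvd_of_isRoot ha ?_
      simp only [map_sub, map_pow, aeval_X, sub_eq_zero, ← pow_mul]
      refine zeta_pow_eq ?_
      have := h a ha
      simpa [mul_comm] using this
    have : (Coset.subst P.r fun _ hj => J.r_mul_mem hj : J.K →ₐ[F] J.K) = AlgHom.id F J.K := by
      apply AdjoinRoot.algHom_ext
      rw [Coset.subst_root, AlgHom.id_apply, ← sub_eq_zero]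
      rw [← AdjoinRoot.mk_eq_zero] at h2
      simpa using h2
    exact fun a => DFunLike.congr_fun this a

/-- Frobenius has order d and θ is its e-th power with d ∣ 3e but d ∤ e. Hence 3 ∣ d and e is d/3
times a number prime to 3, whose residue modulo 3 selects the Q-th or the Q²-th power. -/
theorem Coset.card_K_eq_Q_pow_three_and_theta (J : P.Coset) (h : ¬ J.IsFixed) :
    Nat.card J.K = J.Q ^ 3 ∧ 3 ∣ J.d ∧
      ((∀ a, J.theta.1 a = a ^ J.Q) ∨ ∀ a, J.theta.1 a = a ^ J.Q ^ 2) := by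
  rw [← J.theta_eq_id_iff] at h
  obtain ⟨e, he⟩ := J.exists_theta_eq_frobenius
  set φ := FiniteField.frobeniusAlgHom F J.K with hφ
  have hord : orderOf φ = J.d := by
    rw [FiniteField.orderOf_frobeniusAlgHom, J.finrank_K]
  have h3 : J.d ∣ e * 3 := by
    rw [← hord, orderOf_dvd_iff_pow_eq_one, pow_mul]
    refine AlgHom.ext fun a => ?_
    change (φ ^ e) ((φ ^ e) ((φ ^ e) a)) = a
    rw [← he, ← he, ← he, J.theta.2]
  have h1 : ¬ J.d ∣ e := by
    rw [← hord, orderOf_dvd_iff_pow_eq_one]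
    intro h'
    exact h fun a => by rw [he, h', AlgHom.one_apply]
  have hd3 : 3 ∣ J.d := by
    by_contra hcon
    exact h1 (((Nat.Prime.coprime_iff_not_dvd Nat.prime_three).2 hcon).symm.dvd_of_dvd_mul_right h3)
  obtain ⟨s, hs⟩ := hd3
  have hs' : J.d / 3 = s := by omega
  have hcard : Nat.card J.K = J.Q ^ 3 := by
    rw [J.card_K, Coset.Q, hs', hs, ← pow_mul, mul_comm]
  obtain ⟨k, rfl⟩ : s ∣ e := by
    rw [hs, mul_comm] at h3
    exact Nat.dvd_of_mul_dvd_mul_right three_pos h3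
  have hk : k % 3 = 1 ∨ k % 3 = 2 := by
    have : ¬ 3 ∣ k := by
      rintro ⟨t, rfl⟩
      exact h1 ⟨t, by rw [hs]; ring⟩
    omega
  have hpow : ∀ n a, (φ ^ (s * n)) a = a ^ J.Q ^ n := by
    intro n a
    rw [AlgHom.coe_pow, hφ, FiniteField.coe_frobeniusAlgHom, pow_iterate, Coset.Q, hs', ← pow_mul]
    rfl
  have hmod : φ ^ (s * k) = φ ^ (s * (k % 3)) := by
    rw [← pow_mod_orderOf, hord, hs, mul_comm 3, Nat.mul_mod_mul_left]
  refine ⟨hcard, ⟨s, hs⟩, ?_⟩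
  rcases hk with hk | hk
  · left; intro a; rw [he, hmod, hk, hpow, pow_one]
  · right; intro a; rw [he, hmod, hk, hpow]

end MetacyclicData

/-! ### Trivial automorphism: cube roots of unity and the tables. -/

namespace SkewCyclicRing

variable {K K' : Type*} [CommRing K] [CommRing K'] {σ : {σ : K →+* K // ∀ a, σ (σ (σ a)) = a}}
  {σ' : {σ : K' →+* K' // ∀ a, σ (σ (σ a)) = a}}

theorem span_y_pow_three_sub_one :
    Ideal.span {(y : SkewCyclicRing K σ) ^ 3 - 1} = ⊥ := by
  rw [y_pow_three, sub_self, Ideal.span_singleton_eq_bot]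

theorem span_y_sub_const (α : Kˣ) :
    Ideal.span {(y : SkewCyclicRing K σ) - const (α : K)} = planeIdeal σ α := by
  rw [planeIdeal, neg_add_eq_sub]

theorem span_y_sub_one : Ideal.span {(y : SkewCyclicRing K σ) - 1} = planeIdeal σ 1 :=
  span_y_sub_const 1

theorem span_y_sq_add_y_add_one :
    Ideal.span {(y : SkewCyclicRing K σ) ^ 2 + y + 1} = lineIdeal σ 1 := by
  rw [lineIdeal]
  congr 2
  ext <;> simp [y_pow_two]

/-- In characteristic three, (y - 1)² = y² + y + 1. -/
theorem span_y_sub_one_sq (h3 : (3 : K) = 0) :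
    Ideal.span {((y : SkewCyclicRing K σ) - 1) ^ 2} = lineIdeal σ 1 := by
  rw [← span_y_sq_add_y_add_one]
  congr 2
  ext
  · simp [pow_two]
  · simp [pow_two]; linear_combination -h3
  · simp [pow_two]

section FixedBy

variable (hσ : ∀ a, σ.1 a = a) (hσ' : ∀ a, σ'.1 a = a)

include hσ in
theorem mem_normOne_of_fixed {α : Kˣ} : α ∈ normOne σ ↔ α ^ 3 = 1 := by
  rw [mem_normOne, hσ, hσ, Units.ext_iff, Units.val_pow_eq_pow_val, Units.val_one, pow_succ,
    pow_two]

include hσ in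
-- The product is y² + βy + β⁻¹. The line is labelled by the cube root missing from the
-- factorisation, so (y - 1)(y - ω) belongs to ω².
theorem span_y_sub_one_mul {α β : Kˣ} (h : 1 + (α : K) + β = 0) (hαβ : α * β = 1) :
    Ideal.span {((y : SkewCyclicRing K σ) - 1) * (y - const (α : K))} = lineIdeal σ β := by
  have hinv : β⁻¹ = α := by rw [inv_eq_iff_mul_eq_one, mul_comm, hαβ]
  rw [lineIdeal, hinv]
  congr 2
  ext
  · simp [y_pow_two, hσ]
  · simp [y_pow_two, hσ]; linear_combination -h
  · simp [y_pow_two, hσ]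

variable [IsDomain K]

include hσ in
theorem mem_lineSet_of_fixed {δ : K} (h3 : (3 : K) ≠ 0) (h : δ ^ 3 = 1) :
    δ ∈ lineSet σ ↔ δ ≠ 1 := by
  rw [mem_lineSet, hσ, hσ]
  constructor
  · rintro h1 rfl
    exact h3 (by linear_combination h1)
  · intro h1
    refine (mul_eq_zero.1 (?_ : (δ - 1) * _ = 0)).resolve_left (sub_ne_zero.2 h1)
    linear_combination h

/-- In characteristic three, 1 + ω + ω² = (ω - 1)². -/
theorem three_ne_zero_of_cube_root {ω : Kˣ} (hω : 1 + (ω : K) + (ω : K) ^ 2 = 0) (h1 : ω ≠ 1) :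
    (3 : K) ≠ 0 := by
  intro h
  refine h1 (Units.ext (sub_eq_zero.1 ((pow_eq_zero_iff two_ne_zero).1 ?_)))
  rw [Units.val_one]
  linear_combination hω - ω * h

include hσ

theorem mem_normOne_iff_of_cube_root {ω : Kˣ} (hω : 1 + (ω : K) + (ω : K) ^ 2 = 0) {α : Kˣ} :
    α ∈ normOne σ ↔ α = 1 ∨ α = ω ∨ α = ω ^ 2 := by
  have hω3 : (ω : K) ^ 3 = 1 := by linear_combination ((ω : K) - 1) * hω
  rw [mem_normOne_of_fixed hσ]
  constructor
  · intro h
    have h := congrArg Units.val h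
    simp only [Units.val_pow_eq_pow_val, Units.val_one] at h
    have : ((α : K) - 1) * ((α - ω) * (α - ω ^ 2)) = 0 := by
      linear_combination h - hω3 + (α - α ^ 2) * hω + α * hω3
    simpa only [mul_eq_zero, sub_eq_zero, Units.ext_iff, Units.val_one,
      Units.val_pow_eq_pow_val] using this
  · rintro (rfl | rfl | rfl) <;> ext
    · simp
    · simpa using hω3
    · push_cast
      rw [← pow_mul, mul_comm, pow_mul, hω3, one_pow]

omit [IsDomain K] in
theorem cube_eq_one_of_mem_lineSet {δ : K} (h : δ ∈ lineSet σ) : δ ^ 3 = 1 := by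
  have := norm_eq_one_of_mem_lineSet h
  rw [hσ, hσ] at this
  rw [← this]; ring

theorem mem_normOne_iff_of_three_eq_zero (h3 : (3 : K) = 0) (α : Kˣ) :
    α ∈ normOne σ ↔ α = 1 := by
  rw [mem_normOne_of_fixed hσ]
  refine ⟨fun h => ?_, fun h => by rw [h, one_pow]⟩
  have h := congrArg Units.val h
  simp only [Units.val_pow_eq_pow_val, Units.val_one] at h
  refine Units.ext (sub_eq_zero.1 ((pow_eq_zero_iff three_ne_zero).1 ?_))
  rw [Units.val_one]
  linear_combination h + (α - α ^ 2) * h3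

theorem lineSet_of_three_eq_zero (h3 : (3 : K) = 0) : lineSet σ = {1} := by
  ext δ
  rw [mem_lineSet, hσ, hσ, Set.mem_singleton_iff]
  constructor
  · intro h
    refine sub_eq_zero.1 ((pow_eq_zero_iff two_ne_zero).1 ?_)
    linear_combination h - δ * h3
  · rintro rfl
    linear_combination h3

theorem lineSet_of_three_ne_zero (h3 : (3 : K) ≠ 0) (hN : ∀ α, α ∈ normOne σ ↔ α = 1) :
    lineSet σ = ∅ := by
  refine Set.eq_empty_of_forall_notMem fun δ h => ?_
  have h1 := cube_eq_one_of_mem_lineSet hσ h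
  refine (mem_lineSet_of_fixed hσ h3 h1).1 h ?_
  have hu : Units.ofPowEqOne δ 3 h1 three_ne_zero = 1 := by
    rw [← hN, mem_normOne_of_fixed hσ, Units.pow_ofPowEqOne]
  exact congrArg Units.val hu

theorem lineSet_of_cube_root {ω : Kˣ} (hω : 1 + (ω : K) + (ω : K) ^ 2 = 0) :
    lineSet σ = {(ω : K), (ω : K) ^ 2} := by
  ext δ
  rw [mem_lineSet, hσ, hσ, Set.mem_insert_iff, Set.mem_singleton_iff]
  have : 1 + δ + δ * δ = (δ - ω) * (δ - ω ^ 2) := by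
    linear_combination (1 - ω + δ) * hω
  rw [this, mul_eq_zero, sub_eq_zero, sub_eq_zero]

omit hσ

variable (hK : ∀ a : K, a ≠ 0 → IsUnit a) (hK' : ∀ a : K', a ≠ 0 → IsUnit a)
  {c : K' →+* K} (hc : ∀ a, c (σ'.1 a) = σ.1 (c a)) (hinj : Function.Injective c)

include hσ hσ' hK hK' hc hinj

omit hσ' in
/-- The case of characteristic three. -/
theorem orth_iff_of_three_eq_zero (h3 : (3 : K) = 0) (hN : ∀ α, α ∈ normOne σ ↔ α = 1)
    (hN' : ∀ α, α ∈ normOne σ' ↔ α = 1)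
    {C : Ideal (SkewCyclicRing K σ)} {C' : Ideal (SkewCyclicRing K' σ')} :
    Orth c C C' ↔
      (C = ⊥ ∧ (C' = ⊥ ∨ C' = lineIdeal σ' 1 ∨ C' = planeIdeal σ' 1 ∨ C' = ⊤)) ∨
      (C = lineIdeal σ 1 ∧ (C' = ⊥ ∨ C' = lineIdeal σ' 1 ∨ C' = planeIdeal σ' 1)) ∨
      (C = planeIdeal σ 1 ∧ (C' = ⊥ ∨ C' = lineIdeal σ' 1)) ∨
      (C = ⊤ ∧ C' = ⊥) := by
  have hcl := ideal_classification hK' C'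
  simp only [hN', exists_eq_left] at hcl
  have h1 : (1 : K) ∈ lineSet σ := by
    rw [mem_lineSet, hσ, hσ]; linear_combination h3
  rw [orth_iff hK hK' hc hinj]
  simp only [hN, hN', exists_eq_left, Units.val_one, map_one, mul_one, h1, true_and]
  refine or_congr (by tauto) Iff.rfl

omit hσ' in
/-- The case where the only cube root of unity is `1`, in characteristic other than three. -/
theorem orth_iff_of_three_ne_zero (h3 : (3 : K) ≠ 0) (hN : ∀ α, α ∈ normOne σ ↔ α = 1)
    (hN' : ∀ α, α ∈ normOne σ' ↔ α = 1)
    {C : Ideal (SkewCyclicRing K σ)} {C' : Ideal (SkewCyclicRing K' σ')} :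
    Orth c C C' ↔
      (C = ⊥ ∧ (C' = ⊥ ∨ C' = lineIdeal σ' 1 ∨ C' = planeIdeal σ' 1 ∨ C' = ⊤)) ∨
      (C = lineIdeal σ 1 ∧ (C' = ⊥ ∨ C' = planeIdeal σ' 1)) ∨
      (C = planeIdeal σ 1 ∧ (C' = ⊥ ∨ C' = lineIdeal σ' 1)) ∨
      (C = ⊤ ∧ C' = ⊥) := by
  have hcl := ideal_classification hK' C'
  simp only [hN', exists_eq_left] at hcl
  have h1 : (1 : K) ∉ lineSet σ := by
    rw [mem_lineSet, hσ, hσ]; intro h; exact h3 (by linear_combination h)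
  rw [orth_iff hK hK' hc hinj]
  simp only [hN, hN', exists_eq_left, Units.val_one, map_one, mul_one, h1, true_and, false_and,
    false_or]
  refine or_congr (by tauto) Iff.rfl

/-- The case where `1`, `ω` and `ω²` are the cube roots of unity. -/
theorem orth_iff_of_cube_root {ω : Kˣ} {w : K'ˣ} (hω : 1 + (ω : K) + (ω : K) ^ 2 = 0)
    (h1 : ω ≠ 1) (hw : c w = ω)
    {C : Ideal (SkewCyclicRing K σ)} {C' : Ideal (SkewCyclicRing K' σ')} :
    Orth c C C' ↔
      (C = ⊥ ∧ (C' = ⊤ ∨ C' = lineIdeal σ' 1 ∨ C' = lineIdeal σ' (w ^ 2) ∨ C' = lineIdeal σ' w ∨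
        C' = planeIdeal σ' 1 ∨ C' = planeIdeal σ' (w ^ 2) ∨ C' = planeIdeal σ' w ∨ C' = ⊥)) ∨
      (C = lineIdeal σ 1 ∧ (C' = ⊥ ∨ C' = lineIdeal σ' (w ^ 2) ∨ C' = lineIdeal σ' w ∨
        C' = planeIdeal σ' 1)) ∨
      (C = lineIdeal σ (ω ^ 2) ∧ (C' = ⊥ ∨ C' = lineIdeal σ' (w ^ 2) ∨ C' = lineIdeal σ' 1 ∨
        C' = planeIdeal σ' w)) ∨
      (C = lineIdeal σ ω ∧ (C' = ⊥ ∨ C' = lineIdeal σ' w ∨ C' = lineIdeal σ' 1 ∨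
        C' = planeIdeal σ' (w ^ 2))) ∨
      (C = planeIdeal σ 1 ∧ (C' = ⊥ ∨ C' = lineIdeal σ' 1)) ∨
      (C = planeIdeal σ ω ∧ (C' = ⊥ ∨ C' = lineIdeal σ' (w ^ 2))) ∨
      (C = planeIdeal σ (ω ^ 2) ∧ (C' = ⊥ ∨ C' = lineIdeal σ' w)) ∨
      (C = ⊤ ∧ C' = ⊥) := by
  have hωK : (ω : K) ≠ 1 := fun h => h1 (Units.ext h)
  have hω3 : (ω : K) ^ 3 = 1 := by linear_combination ((ω : K) - 1) * hω
  have h3 : (3 : K) ≠ 0 := three_ne_zero_of_cube_root hω h1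
  have hω2 : (ω : K) ^ 2 ≠ 1 := fun h => hωK (by linear_combination hω3 - ω * h)
  have hN : ∀ {α : Kˣ}, α ∈ normOne σ ↔ α = 1 ∨ α = ω ∨ α = ω ^ 2 :=
    mem_normOne_iff_of_cube_root hσ hω
  have hN' : ∀ {β : K'ˣ}, β ∈ normOne σ' ↔ β = 1 ∨ β = w ∨ β = w ^ 2 := by
    intro β
    have : β ∈ normOne σ' ↔ Units.map (c : K' →* K) β ∈ normOne σ := by
      rw [mem_normOne_of_fixed hσ, mem_normOne_of_fixed hσ', ← map_pow]
      exact (map_eq_one_iff _ (Units.map_injective hinj)).symm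
    rw [this, hN]
    simp only [Units.ext_iff, Units.coe_map, MonoidHom.coe_coe, Units.val_one,
      Units.val_pow_eq_pow_val, ← hw, ← map_pow, hinj.eq_iff]
    rw [← map_one c, hinj.eq_iff]
  have hcl := ideal_classification hK' C'
  have m1 : (1 : K) ∉ lineSet σ := by
    rw [mem_lineSet_of_fixed hσ h3 (one_pow _)]; simp
  have m2 : (ω : K) ∈ lineSet σ := (mem_lineSet_of_fixed hσ h3 hω3).2 hωK
  have m3 : (ω : K) ^ 2 ∈ lineSet σ :=
    (mem_lineSet_of_fixed hσ h3 (by rw [← pow_mul, mul_comm, pow_mul, hω3, one_pow])).2 hω2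
  -- The multiplication table of the cube roots evaluates every product α c(β).
  have p1 : (ω : K) * ω = ω ^ 2 := by ring
  have p2 : (ω : K) * ω ^ 2 = 1 := by rw [← hω3]; ring
  have p3 : (ω : K) ^ 2 * ω = 1 := by rw [← hω3]; ring
  have p4 : (ω : K) ^ 2 * ω ^ 2 = ω := by linear_combination ω * hω3
  rw [orth_iff hK hK' hc hinj]
  simp only [hN, hN', or_and_right, exists_or, exists_eq_left, Units.val_one, map_one,
    Units.val_pow_eq_pow_val, map_pow, hw, mul_one, one_mul, hσ, p1, p2, p3, p4, m1, m2, m3, hωK,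
    hω2, true_and, false_and, or_false, false_or] at hcl ⊢
  -- `orth_iff` leaves C' free when C = ⊥, whereas the table lists eight ideals; by `hcl` these are
  -- all.
  rw [and_iff_left (a := C = ⊥) ((Iff.of_eq (by ac_rfl)).1 hcl)]
  exact Iff.of_eq (by ac_rfl)

end FixedBy

end SkewCyclicRing

/-! ### Translation of the tables of generators into lines and planes. -/

namespace MetacyclicData

variable {F L : Type*} [Field F] [Fintype F] [Field L] [Algebra F L] {P : MetacyclicData F L}

open SkewCyclicRing

attribute [local instance] Coset.fact_irreducible_f

theorem Coset.isPair₀_iff (J J' : P.Coset) {C : Ideal J.R} {C' : Ideal J'.R}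
    (h3 : (3 : J.K) = 0) (h3' : (3 : J'.K) = 0) :
    (∃ g t, J.IsPair₀ J' g t ∧ C = Ideal.span {g} ∧ C' = Ideal.span {t}) ↔
      (C = ⊥ ∧ (C' = ⊥ ∨ C' = lineIdeal J'.theta 1 ∨ C' = planeIdeal J'.theta 1 ∨ C' = ⊤)) ∨
      (C = lineIdeal J.theta 1 ∧ (C' = ⊥ ∨ C' = lineIdeal J'.theta 1 ∨
        C' = planeIdeal J'.theta 1)) ∨
      (C = planeIdeal J.theta 1 ∧ (C' = ⊥ ∨ C' = lineIdeal J'.theta 1)) ∨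
      (C = ⊤ ∧ C' = ⊥) := by
  simp only [Coset.IsPair₀, Set.mem_insert_iff, Set.mem_singleton_iff, or_and_right, exists_or,
    and_assoc, exists_and_left, exists_eq_left, span_y_pow_three_sub_one, span_y_sub_one,
    span_y_sub_one_sq h3, span_y_sub_one_sq h3', Ideal.span_singleton_one, and_or_left, or_assoc]

theorem Coset.isPair₂_iff (J J' : P.Coset) {C : Ideal J.R} {C' : Ideal J'.R} :
    (∃ g t, J.IsPair₂ J' g t ∧ C = Ideal.span {g} ∧ C' = Ideal.span {t}) ↔
      (C = ⊥ ∧ (C' = ⊥ ∨ C' = lineIdeal J'.theta 1 ∨ C' = planeIdeal J'.theta 1 ∨ C' = ⊤)) ∨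
      (C = lineIdeal J.theta 1 ∧ (C' = ⊥ ∨ C' = planeIdeal J'.theta 1)) ∨
      (C = planeIdeal J.theta 1 ∧ (C' = ⊥ ∨ C' = lineIdeal J'.theta 1)) ∨
      (C = ⊤ ∧ C' = ⊥) := by
  simp only [Coset.IsPair₂, Set.mem_insert_iff, Set.mem_singleton_iff, or_and_right, exists_or,
    and_assoc, exists_and_left, exists_eq_left, span_y_pow_three_sub_one, span_y_sub_one,
    span_y_sq_add_y_add_one, Ideal.span_singleton_one, and_or_left, or_assoc]

theorem Coset.isPair₁_iff (J J' : P.Coset) {C : Ideal J.R} {C' : Ideal J'.R}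
    (hJ : ∀ a, J.theta.1 a = a) (hJ' : ∀ a, J'.theta.1 a = a) {ω : J.Kˣ} {w : J'.Kˣ}
    (hω : 1 + (ω : J.K) + (ω : J.K) ^ 2 = 0) (hw : 1 + (w : J'.K) + (w : J'.K) ^ 2 = 0) :
    (∃ g t, J.IsPair₁ J' ω w g t ∧ C = Ideal.span {g} ∧ C' = Ideal.span {t}) ↔
      (C = ⊥ ∧ (C' = ⊤ ∨ C' = lineIdeal J'.theta 1 ∨ C' = lineIdeal J'.theta (w ^ 2) ∨
        C' = lineIdeal J'.theta w ∨ C' = planeIdeal J'.theta 1 ∨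
        C' = planeIdeal J'.theta (w ^ 2) ∨ C' = planeIdeal J'.theta w ∨ C' = ⊥)) ∨
      (C = lineIdeal J.theta 1 ∧ (C' = ⊥ ∨ C' = lineIdeal J'.theta (w ^ 2) ∨
        C' = lineIdeal J'.theta w ∨ C' = planeIdeal J'.theta 1)) ∨
      (C = lineIdeal J.theta (ω ^ 2) ∧ (C' = ⊥ ∨ C' = lineIdeal J'.theta (w ^ 2) ∨
        C' = lineIdeal J'.theta 1 ∨ C' = planeIdeal J'.theta w)) ∨
      (C = lineIdeal J.theta ω ∧ (C' = ⊥ ∨ C' = lineIdeal J'.theta w ∨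
        C' = lineIdeal J'.theta 1 ∨ C' = planeIdeal J'.theta (w ^ 2))) ∨
      (C = planeIdeal J.theta 1 ∧ (C' = ⊥ ∨ C' = lineIdeal J'.theta 1)) ∨
      (C = planeIdeal J.theta ω ∧ (C' = ⊥ ∨ C' = lineIdeal J'.theta (w ^ 2))) ∨
      (C = planeIdeal J.theta (ω ^ 2) ∧ (C' = ⊥ ∨ C' = lineIdeal J'.theta w)) ∨
      (C = ⊤ ∧ C' = ⊥) := by
  have key : ∀ (I : P.Coset) (_ : ∀ a, I.theta.1 a = a) (u : I.Kˣ)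
      (_ : 1 + (u : I.K) + (u : I.K) ^ 2 = 0),
      Ideal.span {((y : I.R) - 1) * (y - const (u : I.K))} = lineIdeal I.theta (u ^ 2) ∧
      Ideal.span {((y : I.R) - 1) * (y - const ((u : I.K) ^ 2))} = lineIdeal I.theta u ∧
      Ideal.span {(y : I.R) - const (u : I.K)} = planeIdeal I.theta u ∧
      Ideal.span {(y : I.R) - const ((u : I.K) ^ 2)} = planeIdeal I.theta (u ^ 2) := by
    intro I hI u hu
    have h3 : u * u ^ 2 = 1 := by
      ext
      push_cast
      linear_combination ((u : I.K) - 1) * hu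
    refine ⟨span_y_sub_one_mul hI (by push_cast; exact hu) h3, ?_, span_y_sub_const u, ?_⟩
    · rw [← Units.val_pow_eq_pow_val]
      exact span_y_sub_one_mul hI (by push_cast; linear_combination hu) (by rw [mul_comm, h3])
    · rw [← Units.val_pow_eq_pow_val]
      exact span_y_sub_const _
  obtain ⟨a1, a2, a3, a4⟩ := key J hJ ω hω
  obtain ⟨b1, b2, b3, b4⟩ := key J' hJ' w hw
  simp only [Coset.IsPair₁, Set.mem_insert_iff, Set.mem_singleton_iff, or_and_right, exists_or,
    and_assoc, exists_and_left, exists_eq_left, span_y_pow_three_sub_one, span_y_sub_one,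
    span_y_sq_add_y_add_one, Ideal.span_singleton_one, and_or_left, or_assoc, a1, a2, a3, a4, b1,
    b2, b3, b4]

end MetacyclicData

theorem three_dvd_card_of_three_eq_zero {K : Type*} [CommRing K] [Nontrivial K]
    (h : (3 : K) = 0) : 3 ∣ Nat.card K := by
  have h1 : addOrderOf (1 : K) = 3 := by
    refine addOrderOf_eq_prime ?_ one_ne_zero
    simpa using h
  rw [← h1]
  exact addOrderOf_dvd_natCard _

namespace MetacyclicData

variable {F L : Type*} [Field F] [Fintype F] [Field L] [Algebra F L] {P : MetacyclicData F L}

open SkewCyclicRing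

attribute [local instance] Coset.fact_irreducible_f

/-! ### The involution on cosets and the conjugation of coset fields -/

theorem Coset.mu_mu (J : P.Coset) : J.mu.mu = J := by
  apply Subtype.ext
  simp [Coset.mu, Finset.image_image]

theorem Coset.d_mu (J : P.Coset) : J.mu.d = J.d := by
  simp only [Coset.d, Coset.mu]
  exact Finset.card_image_of_injective _ neg_injective

theorem Coset.isFixed_mu {J : P.Coset} (h : J.IsFixed) : J.mu.IsFixed := by
  intro j hj
  simp only [Coset.mu, Finset.mem_image] at hj
  obtain ⟨i, hi, rfl⟩ := hj
  rw [mul_neg, h i hi]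

theorem Coset.isFixed_mu_iff {J : P.Coset} : J.mu.IsFixed ↔ J.IsFixed :=
  ⟨fun h => J.mu_mu ▸ isFixed_mu h, isFixed_mu⟩

theorem Coset.conj_root {J J' : P.Coset} (h : J.mu = J') :
    Coset.conj h (AdjoinRoot.root J.f) = AdjoinRoot.root J'.f ^ (P.m - 1) :=
  Coset.subst_root _ _

theorem Coset.conj_conj {J J' : P.Coset} (h : J.mu = J') (h' : J'.mu = J) (a : J.K) :
    Coset.conj h' (Coset.conj h a) = a := by
  have : (Coset.conj h').comp (Coset.conj h) = AlgHom.id F J.K := by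
    apply AdjoinRoot.algHom_ext
    rw [AlgHom.comp_apply, Coset.conj_root, map_pow, Coset.conj_root, AlgHom.id_apply, ← pow_mul]
    have h2 : (P.m - 1) * (P.m - 1) = P.m * (P.m - 2) + 1 := by
      obtain ⟨n, hn⟩ : ∃ n, P.m = n + 2 := ⟨P.m - 2, by have := P.three_le; omega⟩
      rw [hn]
      simp only [Nat.add_sub_cancel]
      rw [show n + 2 - 1 = n + 1 by omega]
      ring
    rw [h2, pow_succ, pow_mul, J.root_pow, one_pow, one_mul]
  exact DFunLike.congr_fun this a

theorem Coset.conj_theta {J J' : P.Coset} (h : J.mu = J') (a : J.K) :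
    Coset.conj h (J.theta.1 a) = J'.theta.1 (Coset.conj h a) := by
  have : (Coset.conj h).comp (Coset.subst P.r fun _ hj => J.r_mul_mem hj : J.K →ₐ[F] J.K) =
      (Coset.subst P.r fun _ hj => J'.r_mul_mem hj : J'.K →ₐ[F] J'.K).comp (Coset.conj h) := by
    apply AdjoinRoot.algHom_ext
    rw [AlgHom.comp_apply, AlgHom.comp_apply, Coset.subst_root, Coset.conj_root, map_pow, map_pow,
      Coset.conj_root, Coset.subst_root, ← pow_mul, ← pow_mul, mul_comm]
  exact DFunLike.congr_fun this a

theorem Coset.conj_injective {J J' : P.Coset} (h : J.mu = J') :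
    Function.Injective (Coset.conj h) := (Coset.conj h).injective

theorem Coset.coe_conjUnits {J J' : P.Coset} (h : J.mu = J') (u : J.Kˣ) :
    (Coset.conjUnits h u : J'.K) = Coset.conj h (u : J.K) := rfl

/-- Orthogonality of left ideals for opposite cosets. -/
def Coset.Orth {J J' : P.Coset} (h : J'.mu = J) (C : Ideal J.R) (C' : Ideal J'.R) : Prop :=
  SkewCyclicRing.Orth (Coset.conj h : J'.K →+* J.K) C C'

theorem Coset.natCard_units (J : P.Coset) : Nat.card J.Kˣ = P.q ^ J.d - 1 := by
  rw [Nat.card_units, J.card_K]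

theorem one_lt_q (P : MetacyclicData F L) : 1 < P.q := Fintype.one_lt_card

theorem Coset.one_le_pow (J : P.Coset) : 1 ≤ P.q ^ J.d :=
  Nat.one_le_pow _ _ (by have := P.one_lt_q; omega)

/-! ### Components with trivial `θ` -/

theorem Coset.three_eq_zero (J : P.Coset) (h : P.q ≡ 0 [MOD 3]) : (3 : J.K) = 0 := by
  obtain ⟨p, hp⟩ := CharP.exists F
  obtain ⟨n, hprime, hn⟩ := FiniteField.card F p
  rw [q, hn] at h
  have h3 : 3 ∣ p := Nat.prime_three.dvd_of_dvd_pow (Nat.modEq_zero_iff_dvd.1 h)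
  obtain rfl : 3 = p := (Nat.prime_dvd_prime_iff_eq Nat.prime_three hprime).1 h3
  have : (3 : F) = 0 := by exact_mod_cast CharP.cast_eq_zero F 3
  rw [← map_ofNat (algebraMap F J.K) 3, this, map_zero]

theorem Coset.three_ne_zero_of_not_dvd (J : P.Coset) (h : ¬ 3 ∣ P.q ^ J.d) : (3 : J.K) ≠ 0 :=
  fun h' => h (J.card_K ▸ three_dvd_card_of_three_eq_zero h')

/-- The unit group has order ≡ 1 modulo 3, so it has no element of order three. -/
theorem Coset.mem_normOne_iff_eq_one (J : P.Coset) (hJ : J.IsFixed) (h : P.q ^ J.d ≡ 2 [MOD 3])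
    (α : J.Kˣ) : α ∈ normOne J.theta ↔ α = 1 := by
  rw [mem_normOne_of_fixed (J.theta_eq_id_iff.2 hJ)]
  refine ⟨fun h3 => ?_, fun h => by rw [h, one_pow]⟩
  have hcard : α ^ (P.q ^ J.d - 1) = 1 := by rw [← J.natCard_units, pow_card_eq_one']
  have hmod : P.q ^ J.d - 1 = 3 * ((P.q ^ J.d - 1) / 3) + 1 := by
    have := J.one_le_pow
    unfold Nat.ModEq at h
    omega
  rwa [hmod, pow_succ, pow_mul, h3, one_pow, one_mul] at hcard

theorem Coset.omega_spec (J : P.Coset) {z : J.Kˣ} (hz : ∀ u : J.Kˣ, u ∈ Subgroup.zpowers z)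
    (h : P.q ^ J.d ≡ 1 [MOD 3]) :
    1 + (J.omega z : J.K) + (J.omega z : J.K) ^ 2 = 0 ∧ J.omega z ≠ 1 := by
  have hord : orderOf z = P.q ^ J.d - 1 := by
    rw [orderOf_eq_card_of_forall_mem_zpowers hz, J.natCard_units]
  have h1 : 3 ∣ P.q ^ J.d - 1 := (Nat.modEq_iff_dvd' J.one_le_pow).1 h.symm
  have hpos : 0 < P.q ^ J.d - 1 := by rw [← hord]; exact orderOf_pos z
  have hne : J.omega z ≠ 1 := by
    intro h2
    have := orderOf_dvd_of_pow_eq_one h2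
    rw [hord] at this
    have := Nat.le_of_dvd (by omega) this
    omega
  have h3 : J.omega z ^ 3 = 1 := by
    rw [Coset.omega, ← pow_mul, Nat.div_mul_cancel h1, ← hord, pow_orderOf_eq_one]
  refine ⟨?_, hne⟩
  have h3 := congrArg Units.val h3
  simp only [Units.val_pow_eq_pow_val, Units.val_one] at h3
  refine (mul_eq_zero.1 (?_ : ((J.omega z : J.K) - 1) * _ = 0)).resolve_left
    (sub_ne_zero.2 fun h => hne (Units.ext h))
  linear_combination h3

theorem Coset.caseII_iff_orth {J J' : P.Coset} (h : J.mu = J') (h' : J'.mu = J) (hJ : J.IsFixed)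
    {z : J.Kˣ} (hz : ∀ u : J.Kˣ, u ∈ Subgroup.zpowers z) (C : Ideal J.R) (C' : Ideal J'.R) :
    J.CaseII J' h z C C' ↔ Coset.Orth h' C C' := by
  have hJ' : J'.IsFixed := h ▸ isFixed_mu hJ
  have hd : J'.d = J.d := h ▸ J.d_mu
  have i1 := J.theta_eq_id_iff.2 hJ
  have i2 := J'.theta_eq_id_iff.2 hJ'
  have hc : ∀ a, (Coset.conj h' : J'.K →+* J.K) (J'.theta.1 a) =
    J.theta.1 ((Coset.conj h' : J'.K →+* J.K) a) := Coset.conj_theta h'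
  have hinj : Function.Injective (Coset.conj h' : J'.K →+* J.K) := Coset.conj_injective h'
  have hmod : P.q % 3 = 0 ∨ ¬ 3 ∣ P.q ^ J.d := by
    by_cases h3 : 3 ∣ P.q
    · exact Or.inl (Nat.mod_eq_zero_of_dvd h3)
    · exact Or.inr fun h => h3 (Nat.prime_three.dvd_of_dvd_pow h)
  have e0 : P.q ≡ 0 [MOD 3] →
      ((∃ g t, J.IsPair₀ J' g t ∧ C = Ideal.span {g} ∧ C' = Ideal.span {t}) ↔
        Coset.Orth h' C C') := by
    intro h0
    have a1 := J.three_eq_zero h0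
    have a2 := J'.three_eq_zero h0
    rw [J.isPair₀_iff J' a1 a2, Coset.Orth, orth_iff_of_three_eq_zero i1 J.isUnit_K J'.isUnit_K
      hc hinj a1 (mem_normOne_iff_of_three_eq_zero i1 a1)
      (mem_normOne_iff_of_three_eq_zero i2 a2)]
  have e2 : P.q ^ J.d ≡ 2 [MOD 3] →
      ((∃ g t, J.IsPair₂ J' g t ∧ C = Ideal.span {g} ∧ C' = Ideal.span {t}) ↔
        Coset.Orth h' C C') := by
    intro h0
    have a1 := J.three_ne_zero_of_not_dvd (by unfold Nat.ModEq at h0; omega)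
    rw [J.isPair₂_iff J', Coset.Orth, orth_iff_of_three_ne_zero i1 J.isUnit_K J'.isUnit_K
      hc hinj a1 (J.mem_normOne_iff_eq_one hJ h0) (J'.mem_normOne_iff_eq_one hJ' (by rwa [hd]))]
  have e1 : P.q ^ J.d ≡ 1 [MOD 3] →
      ((∃ g t, J.IsPair₁ J' (J.omega z) (Coset.conj h (J.omega z)) g t ∧
        C = Ideal.span {g} ∧ C' = Ideal.span {t}) ↔ Coset.Orth h' C C') := by
    intro h0
    obtain ⟨hω, hne⟩ := J.omega_spec hz h0
    have hw : 1 + (Coset.conjUnits h (J.omega z) : J'.K) +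
        (Coset.conjUnits h (J.omega z) : J'.K) ^ 2 = 0 := by
      have := congrArg (Coset.conj h) hω
      simpa [Coset.coe_conjUnits] using this
    rw [Coset.Orth, orth_iff_of_cube_root i1 i2 J.isUnit_K J'.isUnit_K hc hinj
      (w := Coset.conjUnits h (J.omega z)) hω hne (Coset.conj_conj h h' _),
      ← J.isPair₁_iff J' i1 i2 hω hw]
    rfl
  rw [Coset.CaseII]
  unfold Nat.ModEq at *
  have h3 : P.q % 3 = 0 → 0 < J.d → P.q ^ J.d % 3 = 0 := fun h hd =>
    Nat.mod_eq_zero_of_dvd (dvd_pow (Nat.dvd_of_mod_eq_zero h) hd.ne')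
  have hd0 : 0 < J.d := by
    obtain ⟨a, ha⟩ := J.nonempty
    exact Finset.card_pos.2 ⟨a, ha⟩
  constructor
  · rintro ⟨k0, k2, k1⟩
    rcases hmod with h0 | h0
    · exact (e0 h0).1 (k0 h0)
    · have : P.q ^ J.d % 3 = 1 ∨ P.q ^ J.d % 3 = 2 := by omega
      rcases this with h0 | h0
      · exact (e1 h0).1 (k1 h0)
      · exact (e2 h0).1 (k2 h0)
  · exact fun ho => ⟨fun h0 => (e0 h0).2 ho, fun h0 => (e2 h0).2 ho, fun h0 => (e1 h0).2 ho⟩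

theorem Coset.caseI_iff_orth {J : P.Coset} (h : J.mu = J) (hJ : J.IsFixed)
    {z : J.Kˣ} (hz : ∀ u : J.Kˣ, u ∈ Subgroup.zpowers z) (C : Ideal J.R) :
    J.CaseI h z C ↔ Coset.Orth h C C := by
  have i1 := J.theta_eq_id_iff.2 hJ
  have hc : ∀ a, (Coset.conj h : J.K →+* J.K) (J.theta.1 a) =
    J.theta.1 ((Coset.conj h : J.K →+* J.K) a) := Coset.conj_theta h
  have hinj : Function.Injective (Coset.conj h : J.K →+* J.K) := Coset.conj_injective h
  have hmod : P.q % 3 = 0 ∨ ¬ 3 ∣ P.q ^ J.d := by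
    by_cases h3 : 3 ∣ P.q
    · exact Or.inl (Nat.mod_eq_zero_of_dvd h3)
    · exact Or.inr fun h => h3 (Nat.prime_three.dvd_of_dvd_pow h)
  have e0 : P.q ≡ 0 [MOD 3] →
      ((C = ⊥ ∨ C = Ideal.span {(y - 1) ^ 2}) ↔ Coset.Orth h C C) := by
    intro h0
    have a1 := J.three_eq_zero h0
    rw [Coset.Orth, orth_self_iff J.isUnit_K hc hinj, span_y_sub_one_sq a1]
    simp only [mem_normOne_iff_of_three_eq_zero i1 a1, exists_eq_left,
      lineSet_of_three_eq_zero i1 a1]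
    simp
  have e2 : P.q ^ J.d ≡ 2 [MOD 3] → (C = ⊥ ↔ Coset.Orth h C C) := by
    intro h0
    have a1 := J.three_ne_zero_of_not_dvd (by unfold Nat.ModEq at h0; omega)
    rw [Coset.Orth, orth_self_iff J.isUnit_K hc hinj,
      lineSet_of_three_ne_zero i1 a1 (J.mem_normOne_iff_eq_one hJ h0)]
    simp
  have e1 : P.q ^ J.d ≡ 1 [MOD 3] →
    (((Coset.conjUnits h (J.omega z) = J.omega z →
      C = ⊥ ∨ C = Ideal.span {(y - 1) * (y - const (J.omega z : J.K))} ∨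
        C = Ideal.span {(y - 1) * (y - const ((J.omega z : J.K) ^ 2))}) ∧
    (Coset.conjUnits h (J.omega z) ≠ J.omega z → C = ⊥)) ↔ Coset.Orth h C C) := by
    intro h0
    obtain ⟨hω, hne⟩ := J.omega_spec hz h0
    have hw : 1 + Coset.conj h (J.omega z : J.K) + Coset.conj h (J.omega z : J.K) ^ 2 = 0 := by
      have := congrArg (Coset.conj h) hω
      simpa using this
    have hcω : (Coset.conjUnits h (J.omega z) = J.omega z) ↔
      Coset.conj h (J.omega z : J.K) = J.omega z := by
      rw [Units.ext_iff, Coset.coe_conjUnits]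
    rw [hcω, Ne, hcω]
    generalize J.omega z = ω at *
    have h3 : (3 : J.K) ≠ 0 := three_ne_zero_of_cube_root hω hne
    have hωK : (ω : J.K) ≠ 1 := fun h => hne (Units.ext h)
    have hω3 : (ω : J.K) ^ 3 = 1 := by linear_combination ((ω : J.K) - 1) * hω
    have hω2 : (ω : J.K) ^ 2 ≠ 1 := fun h => hωK (by linear_combination hω3 - ω * h)
    have p0 : ω ^ 3 = 1 := Units.ext (by simpa using hω3)
    have m1 : (1 : J.K) ∉ lineSet J.theta := by
      rw [mem_lineSet_of_fixed i1 h3 (one_pow _)]; simp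
    have m2 : (ω : J.K) ∈ lineSet J.theta := (mem_lineSet_of_fixed i1 h3 hω3).2 hωK
    have m3 : (ω : J.K) ^ 2 ∈ lineSet J.theta :=
      (mem_lineSet_of_fixed i1 h3 (by rw [← pow_mul, mul_comm, pow_mul, hω3, one_pow])).2 hω2
    have s1 : Ideal.span {((y : J.R) - 1) * (y - const (ω : J.K))} = lineIdeal J.theta (ω ^ 2) :=
      span_y_sub_one_mul i1 (by push_cast; exact hω) (by rw [← pow_succ', p0])
    have s2 : Ideal.span {((y : J.R) - 1) * (y - const ((ω : J.K) ^ 2))} =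
        lineIdeal J.theta ω := by
      rw [← Units.val_pow_eq_pow_val]
      exact span_y_sub_one_mul i1 (by push_cast; linear_combination hω) (by rw [← pow_succ, p0])
    have p1 : (ω : J.K) * ω = ω ^ 2 := by ring
    have p2 : (ω : J.K) * ω ^ 2 = 1 := by rw [← hω3]; ring
    have p3 : (ω : J.K) ^ 2 * ω = 1 := by rw [← hω3]; ring
    have p4 : (ω : J.K) ^ 2 * ω ^ 2 = ω := by linear_combination ω * hω3
    rw [Coset.Orth, orth_self_iff J.isUnit_K hc hinj, s1, s2]
    simp only [mem_normOne_iff_of_cube_root i1 hω, or_and_right, exists_or, exists_eq_left,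
      Units.val_one, map_one, one_mul, m1, false_and, false_or, Units.val_pow_eq_pow_val,
      map_pow, RingHom.coe_coe]
    -- Conjugation fixes or interchanges ω and ω². If it fixes them, α·conj(α) = α² is a primitive
    -- cube root for α ≠ 1; if not, the product is 1, which is not in `lineSet`.
    by_cases hcase : Coset.conj h (ω : J.K) = ω
    · simp only [hcase, p1, p4, m2, m3, true_and, forall_const, not_true, false_imp_iff, and_true]
      rw [or_comm (a := C = lineIdeal J.theta ω)]
    · have hcase2 : Coset.conj h (ω : J.K) = ω ^ 2 := by
        refine sub_eq_zero.1 ((mul_eq_zero.1 ?_).resolve_left (sub_ne_zero.2 hcase))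
        linear_combination hw - Coset.conj h (ω : J.K) * hω + hω3
      have hn : ¬ (ω : J.K) ^ 2 = ω := fun h => hcase (hcase2.trans h)
      simp only [hcase2, p2, hn, m1, ← pow_mul, false_imp_iff, true_and, not_false_eq_true,
        forall_const]
      have p5 : (ω : J.K) ^ 2 * ω ^ (2 * 2) = 1 := by
        rw [← pow_add, show 2 + 2 * 2 = 3 * 2 by rfl, pow_mul, hω3, one_pow]
      simp [p5, m1]
  rw [Coset.CaseI]
  unfold Nat.ModEq at *
  constructor
  · rintro ⟨k0, k2, k1⟩
    rcases hmod with h0 | h0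
    · exact (e0 h0).1 (k0 h0)
    · have : P.q ^ J.d % 3 = 1 ∨ P.q ^ J.d % 3 = 2 := by omega
      rcases this with h0 | h0
      · exact (e1 h0).1 (k1 h0)
      · exact (e2 h0).1 (k2 h0)
  · exact fun ho => ⟨fun h0 => (e0 h0).2 ho, fun h0 => (e2 h0).2 ho, fun h0 => (e1 h0).2 ho⟩

end MetacyclicData

namespace SkewCyclicRing

variable {K : Type*} [CommRing K] {σ : {σ : K →+* K // ∀ a, σ (σ (σ a)) = a}}

/-- For lines the partner is parametrised by γ with c(β) = σ²(γ⁻¹) = γσ(γ). This form of the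
equation is the one compared with φ and ψ. -/
theorem mul_inv_mem_lineSet_iff {α γ : Kˣ} (hγ : γ ∈ normOne σ) :
    (α : K) * σ.1 (σ.1 ((γ⁻¹ : Kˣ) : K)) ∈ lineSet σ ↔
      1 + α * (γ * σ.1 γ) + α * σ.1 (σ.1 α) * γ = 0 := by
  rw [mem_lineSet, inv_eq_of_mem_normOne hγ]
  rw [mem_normOne] at hγ
  simp only [map_mul, σ.2]
  constructor <;> intro h
  · linear_combination h - α * σ.1 (σ.1 α) * γ * hγ
  · linear_combination h + α * σ.1 (σ.1 α) * γ * hγ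

end SkewCyclicRing

namespace MetacyclicData

variable {F L : Type*} [Field F] [Fintype F] [Field L] [Algebra F L] {P : MetacyclicData F L}

open SkewCyclicRing

attribute [local instance] Coset.fact_irreducible_f

/-! ### Numbers of pairs for trivial `θ` -/

theorem Coset.ncard_orth {J J' : P.Coset} (h : J.mu = J') (h' : J'.mu = J) :
    {p : Ideal J.R × Ideal J'.R | Coset.Orth h' p.1 p.2}.ncard =
      3 + (normOne J.theta : Set J.Kˣ).ncard * (6 + (lineSet J.theta).ncard) :=
  ncard_pairs J.isUnit_K J'.isUnit_K (c := (Coset.conj h' : J'.K →+* J.K))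
    (c' := (Coset.conj h : J.K →+* J'.K)) (Coset.conj_theta h')
    (Coset.conj_theta h) (Coset.conj_conj h h') (Coset.conj_conj h' h)

theorem Coset.ncard_caseII {J J' : P.Coset} (h : J.mu = J') (h' : J'.mu = J) (hJ : J.IsFixed)
    {z : J.Kˣ} (hz : ∀ u : J.Kˣ, u ∈ Subgroup.zpowers z) :
    (P.q ≡ 0 [MOD 3] →
      {p : Ideal J.R × Ideal J'.R | J.CaseII J' h z p.1 p.2}.ncard = 10) ∧
    (P.q ^ J.d ≡ 2 [MOD 3] →
      {p : Ideal J.R × Ideal J'.R | J.CaseII J' h z p.1 p.2}.ncard = 9) ∧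
    (P.q ^ J.d ≡ 1 [MOD 3] →
      {p : Ideal J.R × Ideal J'.R | J.CaseII J' h z p.1 p.2}.ncard = 27) := by
  simp only [Coset.caseII_iff_orth h h' hJ hz, Coset.ncard_orth h h']
  have i1 := J.theta_eq_id_iff.2 hJ
  refine ⟨fun h0 => ?_, fun h0 => ?_, fun h0 => ?_⟩
  · have a1 := J.three_eq_zero h0
    have : (normOne J.theta : Set J.Kˣ) = {1} :=
      Set.ext fun α => mem_normOne_iff_of_three_eq_zero i1 a1 α
    rw [this, lineSet_of_three_eq_zero i1 a1, Set.ncard_singleton, Set.ncard_singleton]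
  · have a1 := J.three_ne_zero_of_not_dvd (by unfold Nat.ModEq at h0; omega)
    have : (normOne J.theta : Set J.Kˣ) = {1} :=
      Set.ext fun α => J.mem_normOne_iff_eq_one hJ h0 α
    rw [this, lineSet_of_three_ne_zero i1 a1 (J.mem_normOne_iff_eq_one hJ h0),
      Set.ncard_singleton, Set.ncard_empty]
  · obtain ⟨hω, hne⟩ := J.omega_spec hz h0
    generalize J.omega z = ω at *
    have hne2 : ω ≠ ω ^ 2 := fun h => hne (by
      rw [pow_two] at h
      exact (mul_eq_left.1 h.symm))
    have hne3 : (1 : J.Kˣ) ≠ ω ^ 2 := by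
      intro h
      have h3 : ω * ω ^ 2 = 1 := by
        ext
        push_cast
        linear_combination ((ω : J.K) - 1) * hω
      rw [← h, mul_one] at h3
      exact hne h3
    have : (normOne J.theta : Set J.Kˣ) = {1, ω, ω ^ 2} :=
      Set.ext fun α => mem_normOne_iff_of_cube_root i1 hω
    rw [this, lineSet_of_cube_root i1 hω,
      Set.ncard_pair (fun h => hne2 (Units.ext (by simpa using h))),
      Set.ncard_insert_of_notMem (by simp [hne.symm, hne3]), Set.ncard_pair hne2]

/-! ### Components with `θ` of order three -/

section Nontrivial

variable {J J' : P.Coset} (hJ : ¬ J.IsFixed)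

include hJ

/-- Both possible θ have the conjugates u, u^Q, u^(Q²), so the norm is the same power. -/
theorem Coset.mem_normOne_iff (u : J.Kˣ) :
    u ∈ normOne J.theta ↔ u ^ (1 + J.Q + J.Q ^ 2) = 1 := by
  obtain ⟨hcard, -, hθ⟩ := J.card_K_eq_Q_pow_three_and_theta hJ
  have h3 : (u : J.K) ^ J.Q ^ 3 = u := by
    have := Fintype.ofFinite J.K
    rw [← hcard, Nat.card_eq_fintype_card, FiniteField.pow_card]
  rw [mem_normOne, Units.ext_iff, Units.val_pow_eq_pow_val, Units.val_one]
  rcases hθ with hθ | hθ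
  · rw [hθ, hθ, ← pow_mul, ← pow_two, pow_add, pow_add, pow_one]
  · have : J.Q ^ 2 * J.Q ^ 2 = J.Q ^ 3 * J.Q := by ring
    rw [hθ, hθ, ← pow_mul, this, pow_mul, h3, pow_add, pow_add, pow_one, mul_right_comm]

theorem Coset.natCard_units_eq :
    Nat.card J.Kˣ = (J.Q - 1) * (1 + J.Q + J.Q ^ 2) := by
  obtain ⟨hcard, -, -⟩ := J.card_K_eq_Q_pow_three_and_theta hJ
  have hQ : 1 ≤ J.Q := Nat.one_le_pow _ _ (by have := P.one_lt_q; omega)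
  rw [Nat.card_units, hcard]
  obtain ⟨n, hn⟩ := Nat.exists_eq_add_of_le' hQ
  rw [hn, Nat.add_sub_cancel]
  apply Nat.sub_eq_of_eq_add; ring

theorem Coset.Gr_eq_normOne {z : J.Kˣ} (hz : ∀ u : J.Kˣ, u ∈ Subgroup.zpowers z) :
    J.Gr z = normOne J.theta := by
  ext u
  rw [Coset.mem_normOne_iff hJ, Coset.Gr,
    mem_zpowers_pow_sub_one_iff hz (Coset.natCard_units_eq hJ)]

theorem Coset.ncard_normOne : (normOne J.theta : Set J.Kˣ).ncard = 1 + J.Q + J.Q ^ 2 := by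
  obtain ⟨z, hz⟩ := IsCyclic.exists_generator (α := J.Kˣ)
  rw [← Coset.Gr_eq_normOne hJ hz]
  exact card_zpowers_pow_sub_one hz (Coset.natCard_units_eq hJ)

theorem Coset.ncard_lineSet : (lineSet J.theta).ncard = J.Q + 1 := by
  obtain ⟨hcard, -, hθ⟩ := J.card_K_eq_Q_pow_three_and_theta hJ
  have h3 : ∀ u : J.K, u ^ J.Q ^ 3 = u := by
    intro u
    have := Fintype.ofFinite J.K
    rw [← hcard, Nat.card_eq_fintype_card, FiniteField.pow_card]
  obtain ⟨p, hp⟩ := CharP.exists F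
  obtain ⟨n, hprime, hn⟩ := FiniteField.card F p
  have hpF : ExpChar F p := ExpChar.prime hprime
  have : ExpChar J.K p := expChar_of_injective_ringHom (algebraMap F J.K).injective p
  have hQ : J.Q = p ^ (n * (J.d / 3)) := by
    rw [Coset.Q, q, hn, pow_mul]
  rcases hθ with hθ | hθ
  · rw [← ncard_one_add_pow_add_pow hQ hcard]
    congr 1
    ext a
    rw [mem_lineSet, Set.mem_ofPred_eq]
    -- Applying θ once replaces θ² by θ³ = id and keeps the exponents at most Q + 1.
    have e : J.theta.1 (1 + a + a * J.theta.1 (J.theta.1 a)) = 1 + a ^ J.Q + a ^ (J.Q + 1) := by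
      simp only [map_add, map_mul, map_one, J.theta.2]
      rw [hθ, pow_succ]
    rw [← e, map_eq_zero_iff _ (RingHom.injective _)]
  · rw [← ncard_one_add_add_pow hQ hcard]
    congr 1
    ext a
    have : J.Q ^ 2 * J.Q ^ 2 = J.Q ^ 3 * J.Q := by ring
    rw [mem_lineSet, Set.mem_ofPred_eq, hθ, hθ, ← pow_mul, this, pow_mul, h3, pow_succ' a]

/-- One equation in θ has two polynomial forms: it is α φ(γ) when θ is the Q-th power, and its image
under θ² is ψ(γ) when θ is the Q²-th power. -/
theorem Coset.phi_psi_iff {α γ : J.Kˣ} (hα : α ∈ normOne J.theta) :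
    (((∀ a : J.K, J.theta.1 a = a ^ J.Q) ∧ (J.phiPoly α).eval (γ : J.K) = 0) ∨
      ((∀ a : J.K, J.theta.1 a = a ^ J.Q ^ 2) ∧ (J.psiPoly α).eval (γ : J.K) = 0)) ↔
      1 + (α : J.K) * (γ * J.theta.1 γ) + α * J.theta.1 (J.theta.1 α) * γ = 0 := by
  obtain ⟨hcard, -, hθ⟩ := J.card_K_eq_Q_pow_three_and_theta hJ
  have h3 : ∀ u : J.K, u ^ J.Q ^ 3 = u := by
    intro u
    have := Fintype.ofFinite J.K
    rw [← hcard, Nat.card_eq_fintype_card, FiniteField.pow_card]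
  have e1 : (∀ a : J.K, J.theta.1 a = a ^ J.Q) → ((J.phiPoly α).eval (γ : J.K) = 0 ↔
      1 + (α : J.K) * (γ * J.theta.1 γ) + α * J.theta.1 (J.theta.1 α) * γ = 0) := by
    intro hθ
    have h2 : J.theta.1 (J.theta.1 (α : J.K)) = (α : J.K) ^ J.Q ^ 2 := by
      rw [hθ, hθ, ← pow_mul, ← pow_two]
    have : 1 + (α : J.K) * (γ * J.theta.1 γ) + α * J.theta.1 (J.theta.1 α) * γ =
        α * (J.phiPoly α).eval (γ : J.K) := by
      simp only [Coset.phiPoly, eval_add, eval_mul, eval_pow, eval_X, eval_C, h2, hθ (γ : J.K)]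
      linear_combination -α.mul_inv
    rw [this, mul_eq_zero, or_iff_right α.ne_zero]
  have e2 : (∀ a : J.K, J.theta.1 a = a ^ J.Q ^ 2) → ((J.psiPoly α).eval (γ : J.K) = 0 ↔
      1 + (α : J.K) * (γ * J.theta.1 γ) + α * J.theta.1 (J.theta.1 α) * γ = 0) := by
    intro hθ
    have h2 : ∀ a, J.theta.1 (J.theta.1 a) = a ^ J.Q := by
      intro a
      have : J.Q ^ 2 * J.Q ^ 2 = J.Q ^ 3 * J.Q := by ring
      rw [hθ, hθ, ← pow_mul, this, pow_mul, h3]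
    have : (J.psiPoly α).eval (γ : J.K) = J.theta.1 (J.theta.1
        (1 + (α : J.K) * (γ * J.theta.1 γ) + α * J.theta.1 (J.theta.1 α) * γ)) := by
      simp only [Coset.psiPoly, eval_add, eval_mul, eval_pow, eval_X, eval_C, eval_one, map_add,
        map_mul, map_one, J.theta.2, inv_eq_of_mem_normOne hα, ← h2, pow_succ]
      ring
    rw [this, map_eq_zero_iff _ (RingHom.injective _), map_eq_zero_iff _ (RingHom.injective _)]
  constructor
  · rintro (⟨h1, h2⟩ | ⟨h1, h2⟩)
    · exact (e1 h1).1 h2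
    · exact (e2 h1).1 h2
  · intro h
    rcases hθ with hθ | hθ
    · exact Or.inl ⟨hθ, (e1 hθ).2 h⟩
    · exact Or.inr ⟨hθ, (e2 hθ).2 h⟩

theorem Coset.isListed {z : J.Kˣ} (hz : ∀ u : J.Kˣ, u ∈ Subgroup.zpowers z) (C : Ideal J.R) :
    J.IsListed z C := by
  rw [Coset.IsListed, Coset.Gr_eq_normOne hJ hz]
  exact ideal_classification J.isUnit_K C

/-- On norm-one elements the power Q² + Q is inversion, that is, the product of the other two
conjugates. -/
theorem Coset.hat_eq {h : J.mu = J'} {α : J.Kˣ} (hα : α ∈ normOne J.theta) :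
    Coset.hat h α = J'.theta.1 (Coset.conj h α) * J'.theta.1 (J'.theta.1 (Coset.conj h α)) := by
  obtain ⟨hcard, -, hθ⟩ := J.card_K_eq_Q_pow_three_and_theta hJ
  have h1 : (α : J.K) ^ (J.Q ^ 2 + J.Q) = J.theta.1 α * J.theta.1 (J.theta.1 α) := by
    have h1 := (Coset.mem_normOne_iff hJ α).1 hα
    have h2 : α⁻¹ = α ^ (J.Q ^ 2 + J.Q) := by
      rw [inv_eq_iff_mul_eq_one, ← pow_succ', ← h1]
      congr 1; ring
    rw [← inv_eq_of_mem_normOne hα, h2, Units.val_pow_eq_pow_val]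
  rw [Coset.hat, ← map_pow, h1, map_mul, Coset.conj_theta, Coset.conj_theta, Coset.conj_theta]

/-- With b = conj(α) of norm one, θ(α̂)θ²(α̂) = b and θ(α̂) = bθ²(b). The stated equation is thus
the line condition for δ = αb. -/
theorem Coset.caseIII_iff_orth (h : J.mu = J) {z : J.Kˣ}
    (hz : ∀ u : J.Kˣ, u ∈ Subgroup.zpowers z) (C : Ideal J.R) :
    J.CaseIII h z C ↔ Coset.Orth h C C := by
  have hc : ∀ a, (Coset.conj h : J.K →+* J.K) (J.theta.1 a) =
    J.theta.1 ((Coset.conj h : J.K →+* J.K) a) := Coset.conj_theta h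
  have hinj : Function.Injective (Coset.conj h : J.K →+* J.K) := Coset.conj_injective h
  rw [Coset.CaseIII, Coset.Orth, orth_self_iff J.isUnit_K hc hinj, Coset.Gr_eq_normOne hJ hz]
  refine or_congr_right (exists_congr fun α => and_congr_right fun hα => and_congr ?_ Iff.rfl)
  rw [Coset.hat_eq hJ hα, mem_lineSet]
  have hN : Coset.conj h (α : J.K) * J.theta.1 (Coset.conj h α) *
      J.theta.1 (J.theta.1 (Coset.conj h α)) = 1 := by
    have := congrArg (Coset.conj h) (mem_normOne.1 hα)
    simpa only [map_mul, map_one, Coset.conj_theta] using this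
  simp only [map_mul, J.theta.2, RingHom.coe_coe]
  generalize Coset.conj h (α : J.K) = b at *
  constructor <;> intro hh
  · linear_combination hh - b * α * hN
  · linear_combination hh + b * α * hN

variable (h : J.mu = J') (h' : J'.mu = J) {z : J.Kˣ} (hz : ∀ u : J.Kˣ, u ∈ Subgroup.zpowers z)

include h h' hz

theorem Coset.partnerC1_iff_orth {α : J.Kˣ} (hα : α ∈ normOne J.theta) (C' : Ideal J'.R) :
    J.PartnerC1 J' h z α C' ↔ Coset.Orth h' (lineIdeal J.theta α) C' := by
  have key := Set.ext_iff.1 (setOf_orth_line J'.isUnit_K (c := (Coset.conj h' : J'.K →+* J.K))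
    (c' := (Coset.conj h : J.K →+* J'.K)) (Coset.conj_theta h')
    (Coset.conj_conj h h') (Coset.conj_conj h' h) hα) C'
  have hc : ∀ a, (Coset.conj h' : J'.K →+* J.K) (J'.theta.1 a) =
    J.theta.1 ((Coset.conj h' : J'.K →+* J.K) a) := Coset.conj_theta h'
  have hc' : ∀ a, (Coset.conj h : J.K →+* J'.K) (J.theta.1 a) =
    J'.theta.1 ((Coset.conj h : J.K →+* J'.K) a) := Coset.conj_theta h
  rw [Set.mem_ofPred_eq] at key
  rw [Coset.Orth, key, Coset.PartnerC1, Set.mem_union, Set.mem_insert_iff, Set.mem_singleton_iff,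
    or_assoc]
  refine or_congr_right (or_comm.trans (or_congr Iff.rfl ?_))
  simp only [Coset.phi_psi_iff hJ hα, Coset.Gr_eq_normOne hJ hz]
  have hval : ∀ γ : J.Kˣ, (Coset.conj h' : J'.K →+* J.K)
      ((J'.thetaUnits (J'.thetaUnits (Coset.conjUnits h γ)⁻¹) : J'.Kˣ) : J'.K) =
        J.theta.1 (J.theta.1 ((γ⁻¹ : J.Kˣ) : J.K)) := by
    intro γ
    have : ((J'.thetaUnits (J'.thetaUnits (Coset.conjUnits h γ)⁻¹) : J'.Kˣ) : J'.K) =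
      J'.theta.1 (J'.theta.1 (Coset.conj h ((γ⁻¹ : J.Kˣ) : J.K))) := by
      rw [← map_inv]; rfl
    rw [this, hc, hc]
    congr 2
    exact Coset.conj_conj h h' _
  constructor
  · rintro ⟨γ, hγ, h1, rfl⟩
    refine ⟨J'.thetaUnits (J'.thetaUnits (Coset.conjUnits h γ)⁻¹), ⟨?_, ?_⟩, rfl⟩
    · exact frob_mem_normOne (frob_mem_normOne (inv_mem (map_mem_normOne hc' hγ)))
    · rw [hval, mul_inv_mem_lineSet_iff hγ, h1]
  · rintro ⟨β, ⟨hβ, h1⟩, rfl⟩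
    -- Inverts the parametrisation of β by γ: since θ³ = id, γ is the inverse of the conjugate of
    -- θ(β).
    have e : J'.thetaUnits (J'.thetaUnits (Coset.conjUnits h
        (Coset.conjUnits h' (J'.thetaUnits β))⁻¹)⁻¹) = β := by
      have : (Coset.conjUnits h (Coset.conjUnits h' (J'.thetaUnits β))⁻¹)⁻¹ = J'.thetaUnits β := by
        rw [← map_inv, inv_inv]
        exact Units.ext (Coset.conj_conj h' h _)
      rw [this]
      exact Units.ext (J'.theta.2 β)
    have hγ : (Coset.conjUnits h' (J'.thetaUnits β))⁻¹ ∈ normOne J.theta :=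
      inv_mem (map_mem_normOne hc (frob_mem_normOne hβ))
    refine ⟨(Coset.conjUnits h' (J'.thetaUnits β))⁻¹, hγ, ?_, by rw [e]; rfl⟩
    rw [← mul_inv_mem_lineSet_iff hγ, ← hval, e]
    exact h1

omit hJ hz in
theorem Coset.partnerC2_iff_orth {α : J.Kˣ} (hα : α ∈ normOne J.theta) (C' : Ideal J'.R) :
    J.PartnerC2 J' h α C' ↔ Coset.Orth h' (planeIdeal J.theta α) C' := by
  have key := Set.ext_iff.1 (setOf_orth_plane J'.isUnit_K (c := (Coset.conj h' : J'.K →+* J.K))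
    (c' := (Coset.conj h : J.K →+* J'.K)) (Coset.conj_theta h') (Coset.conj_theta h)
    (Coset.conj_conj h h') (Coset.conj_conj h' h) hα) C'
  rw [Set.mem_ofPred_eq] at key
  rw [Coset.Orth, key]
  rfl

omit hJ h hz in
theorem Coset.caseIV1_iff (hJ' : ¬ J'.IsFixed) {z' : J'.Kˣ}
    (hz' : ∀ u : J'.Kˣ, u ∈ Subgroup.zpowers z') (C : Ideal J.R) (C' : Ideal J'.R) :
    J.CaseIV1 J' z' C C' ↔ C = ⊥ ∧ Coset.Orth h' C C' := by
  rw [Coset.CaseIV1, and_iff_left (Coset.isListed hJ' hz' C'), and_iff_left_iff_imp.2]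
  rintro rfl
  exact orth_bot_left _ _

theorem Coset.caseIV2_iff (C : Ideal J.R) (C' : Ideal J'.R) :
    J.CaseIV2 J' h z C C' ↔ C ∈ lineIdeal J.theta '' normOne J.theta ∧ Coset.Orth h' C C' := by
  rw [Coset.CaseIV2, Coset.Gr_eq_normOne hJ hz]
  constructor
  · rintro ⟨α, hα, rfl, h1⟩
    exact ⟨⟨α, hα, rfl⟩, (Coset.partnerC1_iff_orth hJ h h' hz hα C').1 h1⟩
  · rintro ⟨⟨α, hα, rfl⟩, h1⟩
    exact ⟨α, hα, rfl, (Coset.partnerC1_iff_orth hJ h h' hz hα C').2 h1⟩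

theorem Coset.caseIV3_iff (C : Ideal J.R) (C' : Ideal J'.R) :
    J.CaseIV3 J' h z C C' ↔ C ∈ planeIdeal J.theta '' normOne J.theta ∧ Coset.Orth h' C C' := by
  rw [Coset.CaseIV3, Coset.Gr_eq_normOne hJ hz]
  constructor
  · rintro ⟨α, hα, rfl, h1⟩
    exact ⟨⟨α, hα, rfl⟩, (Coset.partnerC2_iff_orth h h' hα C').1 h1⟩
  · rintro ⟨⟨α, hα, rfl⟩, h1⟩
    exact ⟨α, hα, rfl, (Coset.partnerC2_iff_orth h h' hα C').2 h1⟩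

omit hJ h hz in
theorem Coset.caseIV4_iff (C : Ideal J.R) (C' : Ideal J'.R) :
    J.CaseIV4 J' C C' ↔ C = ⊤ ∧ Coset.Orth h' C C' := by
  rw [Coset.CaseIV4]
  refine and_congr_right ?_
  rintro rfl
  exact (orth_top_left (Coset.conj_injective h')).symm

theorem Coset.caseIV_iff_orth (hJ' : ¬ J'.IsFixed) {z' : J'.Kˣ}
    (hz' : ∀ u : J'.Kˣ, u ∈ Subgroup.zpowers z') (C : Ideal J.R) (C' : Ideal J'.R) :
    J.CaseIV J' h z z' C C' ↔ Coset.Orth h' C C' := by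
  rw [Coset.CaseIV, Coset.caseIV1_iff h' hJ' hz', Coset.caseIV2_iff hJ h h' hz,
    Coset.caseIV3_iff hJ h h' hz, Coset.caseIV4_iff h', ← or_and_right, ← or_and_right,
    ← or_and_right, and_iff_right_iff_imp]
  intro _
  rcases ideal_classification J.isUnit_K C with rfl | rfl | ⟨α, hα, rfl⟩ | ⟨α, hα, rfl⟩
  · exact Or.inl rfl
  · exact Or.inr (Or.inr (Or.inr rfl))
  · exact Or.inr (Or.inr (Or.inl ⟨α, hα, rfl⟩))
  · exact Or.inr (Or.inl ⟨α, hα, rfl⟩)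

theorem Coset.ncard_caseIV (hJ' : ¬ J'.IsFixed) {z' : J'.Kˣ}
    (hz' : ∀ u : J'.Kˣ, u ∈ Subgroup.zpowers z') :
    {p : Ideal J.R × Ideal J'.R | J.CaseIV J' h z z' p.1 p.2}.ncard =
        10 + 8 * P.q ^ (J.d / 3) + 8 * P.q ^ (2 * J.d / 3) + P.q ^ J.d ∧
      (∀ C' : Ideal J'.R, J'.IsListed z' C') ∧
      {p : Ideal J.R × Ideal J'.R | J.CaseIV1 J' z' p.1 p.2}.ncard =
        4 + 2 * P.q ^ (J.d / 3) + 2 * P.q ^ (2 * J.d / 3) ∧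
      {p : Ideal J.R × Ideal J'.R | J.CaseIV2 J' h z p.1 p.2}.ncard =
        (1 + P.q ^ (J.d / 3) + P.q ^ (2 * J.d / 3)) * (3 + P.q ^ (J.d / 3)) ∧
      (∀ α ∈ J.Gr z,
        {C' : Ideal J'.R | J.PartnerC1 J' h z α C'}.ncard = 3 + P.q ^ (J.d / 3)) ∧
      {p : Ideal J.R × Ideal J'.R | J.CaseIV3 J' h z p.1 p.2}.ncard =
        2 * (1 + P.q ^ (J.d / 3) + P.q ^ (2 * J.d / 3)) ∧
      (∀ α ∈ J.Gr z, {C' : Ideal J'.R | J.PartnerC2 J' h α C'}.ncard = 2) ∧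
      {p : Ideal J.R × Ideal J'.R | J.CaseIV4 J' p.1 p.2}.ncard = 1 := by
  obtain ⟨hcard, ⟨s, hs⟩, -⟩ := J.card_K_eq_Q_pow_three_and_theta hJ
  have q1 : P.q ^ (J.d / 3) = J.Q := rfl
  -- The exponent is (2d)/3, which equals 2(d/3) because 3 ∣ d.
  have q2 : P.q ^ (2 * J.d / 3) = J.Q ^ 2 := by
    rw [Coset.Q, ← pow_mul]; congr 1; omega
  have q3 : P.q ^ J.d = J.Q ^ 3 := by rw [← hcard, J.card_K]
  let c : J'.K →+* J.K := Coset.conj h'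
  have hc := Coset.conj_theta h'
  have hc' := Coset.conj_theta h
  have h₁ := Coset.conj_conj h h'
  have h₂ := Coset.conj_conj h' h
  have hn := Coset.ncard_normOne hJ
  have hp := Coset.ncard_lineSet hJ
  rw [q1, q2, q3]
  simp only [Coset.caseIV_iff_orth hJ h h' hz hJ' hz', Coset.caseIV1_iff h' hJ' hz',
    Coset.caseIV2_iff hJ h h' hz, Coset.caseIV3_iff hJ h h' hz, Coset.caseIV4_iff h']
  refine ⟨?_, Coset.isListed hJ' hz', ?_, ?_, fun α hα => ?_, ?_, fun α hα => ?_, ?_⟩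
  · rw [Coset.ncard_orth h h', hn, hp]; ring
  · refine (ncard_pairs_bot (c := c) J'.isUnit_K hc hc' h₁ h₂).trans ?_
    rw [hn]; ring
  · refine (ncard_pairs_line (c := c) J'.isUnit_K hc hc' h₁ h₂).trans ?_
    rw [hn, hp]; ring
  · rw [Coset.Gr_eq_normOne hJ hz] at hα
    simp only [Coset.partnerC1_iff_orth hJ h h' hz hα]
    refine (ncard_orth_line (c := c) J'.isUnit_K hc hc' h₁ h₂ hα).trans ?_
    rw [hp]; ring
  · refine (ncard_pairs_plane (c := c) J'.isUnit_K hc hc' h₁ h₂).trans ?_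
    rw [hn]; ring
  · rw [Coset.Gr_eq_normOne hJ hz] at hα
    simp only [Coset.partnerC2_iff_orth h h' hα]
    exact ncard_orth_plane (c := c) J'.isUnit_K hc hc' h₁ h₂ hα
  · exact ncard_pairs_top (c := c) h₂

end Nontrivial

end MetacyclicData

/-! ### The group algebra as a product of skew cyclic rings. -/

namespace SkewCyclicRing

variable {K K' : Type*} [CommRing K] [CommRing K'] {σ : {σ : K →+* K // ∀ a, σ (σ (σ a)) = a}}
  {σ' : {σ : K' →+* K' // ∀ a, σ (σ (σ a)) = a}}

/-- The embedding of the coefficient ring. -/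
def constHom (σ : {σ : K →+* K // ∀ a, σ (σ (σ a)) = a}) : K →+* SkewCyclicRing K σ where
  toFun := const
  map_one' := rfl
  map_zero' := rfl
  map_add' a b := by ext <;> simp
  map_mul' a b := by ext <;> simp

theorem constHom_apply (a : K) : constHom σ a = const a := rfl

theorem y_mul_const (a : K) : (y : SkewCyclicRing K σ) * const a = const (σ.1 a) * y := by
  ext <;> simp

theorem conjTranspose_pow {c : K' →+* K} (hc : ∀ a, c (σ'.1 a) = σ.1 (c a))
    (η : SkewCyclicRing K' σ') (n : ℕ) :
    conjTranspose σ c (η ^ n) = conjTranspose σ c η ^ n := by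
  induction n with
  | zero => ext <;> simp [conjTranspose]
  | succ n ih => rw [pow_succ, conjTranspose_mul hc, ih, ← pow_succ']

end SkewCyclicRing

namespace MetacyclicData

variable {F L : Type*} [Field F] [Fintype F] [Field L] [Algebra F L] {P : MetacyclicData F L}

open SkewCyclicRing

attribute [local instance] Coset.fact_irreducible_f

instance : Finite P.Coset := 
  inferInstanceAs (Finite {J : Finset (ZMod P.m) // ∃ a, J = P.cyclotomicCoset a})

/-- Constants from F are central because θ fixes F. -/
instance (J : P.Coset) : Algebra F J.R :=
  ((constHom J.theta).comp (algebraMap F J.K)).toAlgebra' fun c ξ => by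
    change const (algebraMap F J.K c) * ξ = ξ * const (algebraMap F J.K c)
    ext <;> simp [J.theta_apply_algebraMap, mul_comm, -AdjoinRoot.algebraMap_eq]

theorem Coset.algebraMap_R (J : P.Coset) (c : F) :
    algebraMap F J.R c = const (algebraMap F J.K c) := rfl

theorem Coset.smul_R (J : P.Coset) (c : F) (ξ : J.R) : c • ξ = ⟨c • ξ.c₀, c • ξ.c₁, c • ξ.c₂⟩ := by
  rw [Algebra.smul_def, J.algebraMap_R]
  ext <;> simp [Algebra.smul_def]

/-- The embedding of the coset field as an algebra homomorphism. -/
def Coset.constAlgHom (J : P.Coset) : J.K →ₐ[F] J.R :=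
  { constHom J.theta with commutes' := fun _ => rfl }

theorem Coset.root_pow_eq (J : P.Coset) {a b : ℕ} (h : (a : ZMod P.m) = b) :
    AdjoinRoot.root J.f ^ a = AdjoinRoot.root J.f ^ b := by
  rw [ZMod.natCast_eq_natCast_iff] at h
  exact pow_eq_pow_of_modEq h J.root_pow

theorem Coset.y_pow_mul_const_root (J : P.Coset) (n k : ℕ) :
    (y : J.R) ^ n * const (AdjoinRoot.root J.f ^ k) =
      const (AdjoinRoot.root J.f ^ (P.r ^ n * k)) * y ^ n := by
  induction n generalizing k with
  | zero => simp
  | succ n ih =>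
    rw [pow_succ, mul_assoc, y_mul_const, map_pow, J.theta_root, ← pow_mul, ← mul_assoc, ih,
      mul_assoc]
    congr 3
    ring

/-- The homomorphism with `x ↦ x` and `y ↦ y` from the metacyclic group. -/
def Coset.groupHom (J : P.Coset) : P.G →* J.R where
  toFun g := const (AdjoinRoot.root J.f ^ g.i.val) * y ^ g.j.val
  map_one' := by simp [show const (1 : J.K) = (1 : J.R) from rfl]
  map_mul' g h := by
    have hy : (y : J.R) ^ (g * h).j.val = y ^ g.j.val * y ^ h.j.val := by
      rw [← pow_add]
      refine pow_eq_pow_of_modEq (n := 3) ?_ y_pow_three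
      rw [G.mul_j, ZMod.val_add]
      exact Nat.mod_modEq _ _
    have hx : AdjoinRoot.root J.f ^ (g * h).i.val =
        AdjoinRoot.root J.f ^ g.i.val * AdjoinRoot.root J.f ^ (P.r ^ g.j.val * h.i.val) := by
      rw [← pow_add]
      exact J.root_pow_eq (by simp)
    rw [hy, hx, ← constHom_apply, map_mul, constHom_apply, constHom_apply]
    simp only [mul_assoc]
    rw [← mul_assoc (y ^ g.j.val) (const _), J.y_pow_mul_const_root, mul_assoc]

theorem Coset.groupHom_apply (J : P.Coset) (g : P.G) :
    J.groupHom g = const (AdjoinRoot.root J.f ^ g.i.val) * y ^ g.j.val := rfl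

theorem Coset.groupHom_x (J : P.Coset) : J.groupHom G.x = const (AdjoinRoot.root J.f) := by
  have : Fact (1 < P.m) := ⟨by have := P.three_le; omega⟩
  rw [J.groupHom_apply]
  simp [G.x, ZMod.val_one]

theorem Coset.groupHom_y (J : P.Coset) : J.groupHom G.y = y := by
  rw [J.groupHom_apply]
  simp [G.y, show (1 : ZMod 3).val = 1 from rfl, show const (1 : J.K) = (1 : J.R) from rfl]

/-- The projection of the group algebra to a component. -/
def Coset.proj (J : P.Coset) : P.GA →ₐ[F] J.R := MonoidAlgebra.lift F J.R P.G J.groupHom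

theorem Coset.proj_of (J : P.Coset) (g : P.G) : J.proj (MonoidAlgebra.of F P.G g) = J.groupHom g :=
  MonoidAlgebra.lift_of _ _

theorem Coset.proj_single (J : P.Coset) (g : P.G) (a : F) :
    J.proj (MonoidAlgebra.single g a) = a • J.groupHom g :=
  MonoidAlgebra.lift_single _ _ _

theorem Coset.proj_aeval_x (J : P.Coset) (p : F[X]) :
    J.proj (aeval (MonoidAlgebra.of F P.G G.x) p) = const (AdjoinRoot.mk J.f p) := by
  rw [← aeval_algHom_apply, J.proj_of, J.groupHom_x, ← AdjoinRoot.aeval_eq]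
  exact aeval_algHom_apply J.constAlgHom _ _

theorem Coset.cofactor_mul (J : P.Coset) : J.cofactor * J.f = X ^ P.m - 1 := by
  have h0 := (modByMonic_eq_zero_iff_dvd J.monic_f).2 J.f_dvd_X_pow_sub_one
  have h1 := modByMonic_add_div (X ^ P.m - 1) J.f
  rw [h0, zero_add] at h1
  rw [Coset.cofactor, mul_comm, h1]

theorem Coset.mk_eps_self (J : P.Coset) : AdjoinRoot.mk J.f J.eps = 1 := by
  obtain ⟨v, hv⟩ := J.exists_bezout.choose_spec
  have := congrArg (AdjoinRoot.mk J.f) hv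
  rwa [map_add, map_mul _ v, AdjoinRoot.mk_self, mul_zero, add_zero, map_one] at this

theorem Coset.eq_of_mem {J J' : P.Coset} {a : ZMod P.m} (h : a ∈ J.1) (h' : a ∈ J'.1) : J = J' :=
  Subtype.ext (Finset.ext fun b => (J.mem_iff h b).trans (J'.mem_iff h' b).symm)

theorem Coset.eq_of_f_dvd {J J' : P.Coset} (h : J'.f ∣ J.f) : J = J' := by
  obtain ⟨a, ha⟩ := J'.nonempty
  have hroot : aeval (P.ζ ^ a.val) J'.f = 0 := by
    rw [← eval_map_algebraMap, J'.map_f, eval_prod]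
    exact Finset.prod_eq_zero ha (by simp)
  have h2 := aeval_eq_zero_of_dvd_aeval_eq_zero h hroot
  rw [← eval_map_algebraMap, J.map_f, eval_prod, Finset.prod_eq_zero_iff] at h2
  obtain ⟨b, hb, h3⟩ := h2
  rw [eval_sub, eval_X, eval_C, sub_eq_zero] at h3
  obtain rfl := zeta_injective (P := P) h3
  exact Coset.eq_of_mem hb ha

/-- The polynomial of J' divides x^m - 1 and is coprime to that of J, hence divides the cofactor of
J. -/
theorem Coset.mk_eps_of_ne {J J' : P.Coset} (h : J' ≠ J) : AdjoinRoot.mk J'.f J.eps = 0 := by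
  rw [AdjoinRoot.mk_eq_zero, Coset.eps]
  refine Dvd.dvd.mul_left ?_ _
  have hcop : IsCoprime J'.f J.f :=
    ((Fact.out : Irreducible J'.f).coprime_iff_not_dvd).2 fun hd => h (Coset.eq_of_f_dvd hd).symm
  refine hcop.dvd_of_dvd_mul_right ?_
  rw [J.cofactor_mul]
  exact J'.f_dvd_X_pow_sub_one

/-- The embedding of a component into the group algebra. -/
def Coset.incl (J : P.Coset) (ξ : J.R) : P.GA :=
  J.phi ξ.c₀ + J.phi ξ.c₁ * MonoidAlgebra.of F P.G G.y +
    J.phi ξ.c₂ * MonoidAlgebra.of F P.G G.y ^ 2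

theorem Coset.mem_concat {J : P.Coset} {C : Ideal J.R} {ξ : P.GA} :
    ξ ∈ J.concat C ↔ ∃ η ∈ C, J.incl η = ξ := Iff.rfl

theorem Coset.proj_phi (J J' : P.Coset) (a : J.K) :
    J'.proj (J.phi a) = const (AdjoinRoot.mk J'.f J.eps *
      AdjoinRoot.mk J'.f (AdjoinRoot.modByMonicHom J.monic_f a)) := by
  rw [← map_mul, ← J'.proj_aeval_x]
  rfl

theorem Coset.proj_incl_self (J : P.Coset) (ξ : J.R) : J.proj (J.incl ξ) = ξ := by
  have h : ∀ a : J.K, J.proj (J.phi a) = const a := by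
    intro a
    rw [J.proj_phi, J.mk_eps_self, one_mul, AdjoinRoot.mk_leftInverse J.monic_f]
  simp only [Coset.incl, map_add, map_mul, map_pow, h, J.proj_of, J.groupHom_y, y_pow_two]
  ext <;> simp

theorem Coset.proj_incl_of_ne {J J' : P.Coset} (hne : J' ≠ J) (ξ : J.R) :
    J'.proj (J.incl ξ) = 0 := by
  have h : ∀ a : J.K, J'.proj (J.phi a) = 0 := by
    intro a
    rw [J.proj_phi, Coset.mk_eps_of_ne hne, zero_mul]
    rfl
  simp only [Coset.incl, map_add, map_mul, h, zero_mul, add_zero]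

/-! ### The decomposition of the group algebra -/

/-- The polynomial that collects the coefficients of `x ^ i y ^ j` for fixed `j`. -/
def slice (ξ : P.GA) (j : ZMod 3) : F[X] :=
  ∑ i : ZMod P.m, monomial i.val (ξ.coeff ⟨i, j⟩)

theorem slice_add (ξ η : P.GA) (j : ZMod 3) : slice (ξ + η) j = slice ξ j + slice η j := by
  simp [slice, Finset.sum_add_distrib]

theorem slice_single (g : P.G) (a : F) (j : ZMod 3) :
    slice (MonoidAlgebra.single g a) j = if g.j = j then monomial g.i.val a else 0 := by
  classical
  simp only [slice, MonoidAlgebra.coeff_single, Finsupp.single_apply, G.ext_iff]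
  split_ifs with h
  · rw [Finset.sum_eq_single g.i]
    · simp [h]
    · intro i _ hi
      simp [hi.symm]
    · simp
  · exact Finset.sum_eq_zero fun i _ => by simp [h]

theorem natDegree_slice_lt (ξ : P.GA) (j : ZMod 3) : (slice ξ j).natDegree < P.m := by
  have h : (slice ξ j).natDegree ≤ P.m - 1 := by
    refine natDegree_sum_le_of_forall_le _ _ fun i _ => (natDegree_monomial_le _).trans ?_
    have := ZMod.val_lt i
    omega
  have := P.three_le
  omega

theorem coeff_slice (ξ : P.GA) (i : ZMod P.m) (j : ZMod 3) :
    (slice ξ j).coeff i.val = ξ.coeff ⟨i, j⟩ := by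
  classical
  simp only [slice, finsetSum_coeff, coeff_monomial, (ZMod.val_injective P.m).eq_iff]
  simp

theorem Coset.proj_eq (J : P.Coset) (ξ : P.GA) :
    J.proj ξ = ⟨AdjoinRoot.mk J.f (slice ξ 0), AdjoinRoot.mk J.f (slice ξ 1),
      AdjoinRoot.mk J.f (slice ξ 2)⟩ := by
  induction ξ using MonoidAlgebra.induction_linear with
  | zero => ext <;> simp [slice]
  | add ξ η h1 h2 => rw [map_add, h1, h2]; ext <;> simp [slice_add]
  | single g a =>
    obtain ⟨i, j⟩ := g
    have hm : a • AdjoinRoot.root J.f ^ i.val = AdjoinRoot.mk J.f (monomial i.val a) := by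
      rw [← C_mul_X_pow_eq_monomial, map_mul, map_pow, AdjoinRoot.mk_X, AdjoinRoot.mk_C,
        Algebra.smul_def, AdjoinRoot.algebraMap_eq]
    rw [J.proj_single, J.smul_R, J.groupHom_apply]
    simp only [slice_single]
    have h01 : (0 : ZMod 3) ≠ 1 := by decide
    have h02 : (0 : ZMod 3) ≠ 2 := by decide
    have h12 : (1 : ZMod 3) ≠ 2 := by decide
    have hj : j = 0 ∨ j = 1 ∨ j = 2 := by revert j; decide
    rcases hj with rfl | rfl | rfl
    · ext <;> simp [h01, h02, hm]
    · ext <;> simp [h01.symm, h12, hm, show (1 : ZMod 3).val = 1 from rfl]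
    · ext <;> simp [h02.symm, h12.symm, hm, show (2 : ZMod 3).val = 2 from rfl, y_pow_two]

/-- A slice of an element with zero components vanishes at all m powers of ζ, yet has degree below
m. Identities in F[G] can therefore be checked componentwise. -/
theorem ext_proj {ξ η : P.GA} (h : ∀ J : P.Coset, J.proj ξ = J.proj η) : ξ = η := by
  rw [← sub_eq_zero]
  have h0 : ∀ J : P.Coset, J.proj (ξ - η) = 0 := fun J => by rw [map_sub, h, sub_self]
  generalize ξ - η = δ at h0
  have hs : ∀ j, slice δ j = 0 := by
    intro j
    have hdvd : ∀ J : P.Coset, J.f ∣ slice δ j := by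
      intro J
      have h1 := h0 J
      rw [J.proj_eq, SkewCyclicRing.ext_iff] at h1
      rw [← AdjoinRoot.mk_eq_zero]
      have hj : j = 0 ∨ j = 1 ∨ j = 2 := by revert j; decide
      rcases hj with rfl | rfl | rfl
      exacts [h1.1, h1.2.1, h1.2.2]
    rw [← Polynomial.map_eq_zero (algebraMap F L)]
    refine eq_zero_of_natDegree_lt_card_of_eval_eq_zero _ (zeta_injective (P := P)) (fun i => ?_) ?_
    · have hi : i ∈ P.cyclotomicCoset i := mem_cyclotomicCoset.2 ⟨0, by simp⟩
      let J : P.Coset := ⟨_, i, rfl⟩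
      have h2 := Polynomial.map_dvd (algebraMap F L) (hdvd J)
      rw [J.map_f] at h2
      refine eval_eq_zero_of_dvd_of_eval_eq_zero h2 ?_
      rw [eval_prod]
      exact Finset.prod_eq_zero hi (by simp)
    · rw [natDegree_map, ZMod.card]
      exact natDegree_slice_lt δ j
  ext ⟨i, j⟩
  rw [← coeff_slice, hs]
  simp

theorem Coset.incl_add (J : P.Coset) (ξ η : J.R) : J.incl (ξ + η) = J.incl ξ + J.incl η := by
  refine ext_proj fun J' => ?_
  by_cases h : J' = J
  · subst h; simp [Coset.proj_incl_self]
  · simp [Coset.proj_incl_of_ne h]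

theorem Coset.incl_mul (J : P.Coset) (ξ η : J.R) : J.incl (ξ * η) = J.incl ξ * J.incl η := by
  refine ext_proj fun J' => ?_
  by_cases h : J' = J
  · subst h; simp [Coset.proj_incl_self]
  · simp [Coset.proj_incl_of_ne h]

/-- Projection to a component is a left multiplication, so it keeps elements inside a left ideal. -/
theorem Coset.incl_proj (J : P.Coset) (ξ : P.GA) : J.incl (J.proj ξ) = J.incl 1 * ξ := by
  refine ext_proj fun J' => ?_
  by_cases h : J' = J
  · subst h; simp [Coset.proj_incl_self]
  · simp [Coset.proj_incl_of_ne h]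

theorem finsum_incl_proj (ξ : P.GA) : ∑ᶠ J : P.Coset, J.incl (J.proj ξ) = ξ := by
  classical
  have := Fintype.ofFinite P.Coset
  rw [finsum_eq_sum_of_fintype]
  refine ext_proj fun J => ?_
  rw [map_sum, Finset.sum_eq_single J (fun J' _ h => Coset.proj_incl_of_ne h.symm _) (by simp),
    Coset.proj_incl_self]

theorem mem_code {D : ∀ J : P.Coset, Ideal J.R} {ξ : P.GA} :
    ξ ∈ P.code D ↔ ∀ J : P.Coset, J.proj ξ ∈ D J := by
  constructor
  · intro h J
    refine Submodule.iSup_induction _ (motive := fun ξ => J.proj ξ ∈ D J) h ?_ ?_ ?_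
    · rintro J' _ ⟨η, hη, rfl⟩
      by_cases hne : J = J'
      · subst hne
        change J.proj (J.incl η) ∈ D J
        rwa [J.proj_incl_self]
      · change J.proj (J'.incl η) ∈ D J
        rw [Coset.proj_incl_of_ne hne]
        exact (D J).zero_mem
    · rw [map_zero]; exact (D J).zero_mem
    · intro ξ η h1 h2
      rw [map_add]; exact (D J).add_mem h1 h2
  · intro h
    have := Fintype.ofFinite P.Coset
    rw [← finsum_incl_proj ξ, finsum_eq_sum_of_fintype]
    exact Submodule.sum_mem _ fun J _ =>
      (le_iSup (fun J => J.concat (D J)) J) (Coset.mem_concat.2 ⟨_, h J, rfl⟩)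

theorem incl_mem_code {D : ∀ J : P.Coset, Ideal J.R} {J : P.Coset} {ξ : J.R} :
    J.incl ξ ∈ P.code D ↔ ξ ∈ D J := by
  rw [mem_code]
  constructor
  · intro h
    rw [← J.proj_incl_self ξ]
    exact h J
  · intro h J'
    by_cases hne : J' = J
    · subst hne; rwa [J'.proj_incl_self]
    · rw [Coset.proj_incl_of_ne hne]; exact (D J').zero_mem

theorem code_injective : Function.Injective P.code := by
  intro D D' h
  funext J
  ext ξ
  rw [← incl_mem_code, h, incl_mem_code]

theorem isLeftCode_code (D : ∀ J : P.Coset, Ideal J.R) : P.IsLeftCode (P.code D) := by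
  intro a ξ hξ
  rw [mem_code] at *
  intro J
  rw [map_mul]
  exact (D J).mul_mem_left _ (hξ J)

/-- The J-th ideal is the preimage of C under `Coset.incl`. -/
theorem exists_code_eq {C : Submodule F P.GA} (hC : P.IsLeftCode C) :
    ∃ D : ∀ J : P.Coset, Ideal J.R, P.code D = C := by
  refine ⟨fun J =>
    { carrier := {ξ | J.incl ξ ∈ C}
      zero_mem' := by
        have h : J.incl 0 = 0 := by simpa using J.incl_add 0 0
        rw [Set.mem_ofPred_eq, h]
        exact C.zero_mem
      add_mem' := fun {a b} ha hb => by
        rw [Set.mem_ofPred_eq, J.incl_add]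
        exact C.add_mem ha hb
      smul_mem' := fun a ξ hξ => by
        rw [Set.mem_ofPred_eq, smul_eq_mul, J.incl_mul]
        exact hC _ _ hξ }, ?_⟩
  ext ξ
  rw [mem_code]
  constructor
  · intro h
    have := Fintype.ofFinite P.Coset
    rw [← finsum_incl_proj ξ, finsum_eq_sum_of_fintype]
    exact Submodule.sum_mem _ fun J _ => h J
  · intro h J
    change J.incl (J.proj ξ) ∈ C
    rw [J.incl_proj]
    exact hC _ _ h

theorem iSupIndep_concat (D : ∀ J : P.Coset, Ideal J.R) :
    iSupIndep fun J : P.Coset => J.concat (D J) := by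
  intro J
  rw [Submodule.disjoint_def]
  intro ξ h1 h2
  obtain ⟨η, hη, rfl⟩ := Coset.mem_concat.1 h1
  -- The projection to J kills the other summands and is injective on the image of `J.incl`.
  have hle : (⨆ J', ⨆ (_ : J' ≠ J), J'.concat (D J')) ≤ LinearMap.ker J.proj.toLinearMap := by
    refine iSup₂_le fun J' hne => ?_
    rintro _ ⟨η', -, rfl⟩
    exact Coset.proj_incl_of_ne hne.symm η'
  have h3 : J.proj (J.incl η) = 0 := hle h2
  rw [J.proj_incl_self] at h3
  rw [h3]
  simpa using J.incl_add 0 0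

/-! ### Self-orthogonality -/

theorem inner_add_left (ξ η δ : P.GA) : P.inner (ξ + η) δ = P.inner ξ δ + P.inner η δ := by
  simp [inner, add_mul, Finset.sum_add_distrib]

theorem inner_single_left (g : P.G) (s : F) (η : P.GA) :
    P.inner (MonoidAlgebra.single g s) η = s * η.coeff g := by
  classical
  simp only [inner, MonoidAlgebra.coeff_single, Finsupp.single_apply, G.ext_iff]
  rw [Finset.sum_eq_single g.i, Finset.sum_eq_single g.j]
  · simp
  · intro j _ hj
    simp [hj.symm]
  · simp
  · intro i _ hi
    exact Finset.sum_eq_zero fun j _ => by simp [hi.symm]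
  · simp

/-- The terms contributing to g are those with ab⁻¹ = g, that is, b = g⁻¹a. -/
theorem coeff_mul_antipode (ξ η : P.GA) (g : P.G) :
    (ξ * HopfAlgebra.antipode F η).coeff g = P.inner (MonoidAlgebra.single g⁻¹ 1 * ξ) η := by
  classical
  induction ξ using MonoidAlgebra.induction_linear with
  | zero => simp [inner]
  | add ξ₁ ξ₂ h1 h2 => rw [add_mul, mul_add, inner_add_left, ← h1, ← h2]; rfl
  | single a s =>
    rw [MonoidAlgebra.single_mul_single, one_mul, inner_single_left]
    induction η using MonoidAlgebra.induction_linear with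
    | zero => simp
    | add η₁ η₂ h1 h2 =>
      rw [map_add, mul_add, MonoidAlgebra.coeff_add, MonoidAlgebra.coeff_add, Finsupp.add_apply,
        Finsupp.add_apply, h1, h2, mul_add]
    | single b t =>
      rw [MonoidAlgebra.antipode_single, MonoidAlgebra.single_mul_single,
        MonoidAlgebra.coeff_single, MonoidAlgebra.coeff_single, Finsupp.single_apply,
        Finsupp.single_apply]
      have : a * b⁻¹ = g ↔ b = g⁻¹ * a := by
        rw [mul_inv_eq_iff_eq_mul, eq_inv_mul_iff_mul_eq, eq_comm]
      simp [this]

/-- A left ideal contains g⁻¹ξ with ξ, so all coefficients of ξ η* vanish and not only the one at 1.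
-/
theorem isSelfOrthogonal_iff {C : Submodule F P.GA} (hC : P.IsLeftCode C) :
    P.IsSelfOrthogonal C ↔ ∀ ξ ∈ C, ∀ η ∈ C, ξ * HopfAlgebra.antipode F η = 0 := by
  constructor
  · intro h ξ hξ η hη
    ext g
    rw [coeff_mul_antipode]
    exact h (hC _ _ hξ) η hη
  · intro h ξ hξ η hη
    have := coeff_mul_antipode ξ η 1
    rw [h ξ hξ η hη, inv_one, ← MonoidAlgebra.one_def, one_mul] at this
    rw [← this]
    rfl

theorem Coset.groupHom_inv {J J' : P.Coset} (h : J'.mu = J) (g : P.G) :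
    J.groupHom g⁻¹ = conjTranspose J.theta (Coset.conj h : J'.K →+* J.K) (J'.groupHom g) := by
  have hc : ∀ a, (Coset.conj h : J'.K →+* J.K) (J'.theta.1 a) =
    J.theta.1 ((Coset.conj h : J'.K →+* J.K) a) := Coset.conj_theta h
  obtain ⟨hx, hy, -, hg⟩ := G.presentation (P := P)
  have hx' : (G.x : P.G)⁻¹ = G.x ^ (P.m - 1) := by
    rw [inv_eq_iff_mul_eq_one, ← pow_succ', Nat.sub_add_cancel (by have := P.three_le; omega), hx]
  have hy' : (G.y : P.G)⁻¹ = G.y ^ 2 := by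
    rw [inv_eq_iff_mul_eq_one, ← pow_succ', hy]
  rw [hg g, mul_inv_rev, ← inv_pow, ← inv_pow, hx', hy', map_mul, map_mul, conjTranspose_mul hc,
    map_pow, map_pow, map_pow, map_pow, map_pow, map_pow, conjTranspose_pow hc,
    conjTranspose_pow hc, J.groupHom_x, J'.groupHom_x, J.groupHom_y, J'.groupHom_y]
  congr 2
  · rw [y_pow_two]
    ext <;> simp [conjTranspose]
  · rw [← constHom_apply, ← map_pow]
    ext
    · simpa [conjTranspose, constHom_apply] using (Coset.conj_root h).symm
    · simp [conjTranspose, constHom_apply]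
    · simp [conjTranspose, constHom_apply]

/-- Inverting x turns the component of J' into that of -J' = J, and inverting y reverses products.
-/
theorem Coset.proj_antipode {J J' : P.Coset} (h : J'.mu = J) (η : P.GA) :
    J.proj (HopfAlgebra.antipode F η) =
      conjTranspose J.theta (Coset.conj h : J'.K →+* J.K) (J'.proj η) := by
  induction η using MonoidAlgebra.induction_linear with
  | zero => ext <;> simp [conjTranspose]
  | add η₁ η₂ h1 h2 => rw [map_add, map_add, map_add, h1, h2, conjTranspose_add]
  | single g a =>
    have hs : ∀ b : J.K, J.theta.1 (a • b) = a • J.theta.1 b := by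
      intro b
      rw [Algebra.smul_def, map_mul, J.theta_apply_algebraMap, ← Algebra.smul_def]
    rw [MonoidAlgebra.antipode_single, J.proj_single, J'.proj_single, J.groupHom_inv h, J.smul_R,
      J'.smul_R]
    ext <;> simp [conjTranspose, hs]

theorem isSelfOrthogonal_code_iff (D : ∀ J : P.Coset, Ideal J.R) :
    P.IsSelfOrthogonal (P.code D) ↔ ∀ J : P.Coset, Coset.Orth J.mu_mu (D J) (D J.mu) := by
  rw [isSelfOrthogonal_iff (isLeftCode_code D)]
  constructor
  · intro h J ξ hξ η hη
    have := congrArg J.proj (h _ (incl_mem_code.2 hξ) _ (incl_mem_code.2 hη))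
    rwa [map_mul, map_zero, Coset.proj_antipode J.mu_mu, Coset.proj_incl_self,
      Coset.proj_incl_self] at this
  · intro h ξ hξ η hη
    refine ext_proj fun J => ?_
    rw [map_mul, map_zero, Coset.proj_antipode J.mu_mu]
    exact h J _ (mem_code.1 hξ J) _ (mem_code.1 hη J.mu)

theorem Coset.orth_mu_iff_self {J : P.Coset} (h : J.mu = J) (D : ∀ J : P.Coset, Ideal J.R) :
    Coset.Orth J.mu_mu (D J) (D J.mu) ↔ Coset.Orth h (D J) (D J) := by
  -- `D J.mu` and `D J` have different types, so the coset is generalised before the equality is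
  -- eliminated.
  have : ∀ (J' : P.Coset) (e : J.mu = J') (h' : J'.mu = J),
      Coset.Orth J.mu_mu (D J) (D J.mu) ↔ Coset.Orth h' (D J) (D J') := by
    rintro _ rfl _
    rfl
  exact this J h h

theorem Coset.orth_mu_symm {J : P.Coset} (D : ∀ J : P.Coset, Ideal J.R)
    (h : Coset.Orth J.mu_mu (D J) (D J.mu)) :
    Coset.Orth J.mu.mu_mu (D J.mu) (D J.mu.mu) := by
  have : ∀ (J' : P.Coset) (e : J = J') (h' : J'.mu = J.mu),
      Coset.Orth (J := J.mu) (J' := J') h' (D J.mu) (D J') := by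
    rintro _ rfl h'
    exact orth_symm (c := (Coset.conj J.mu_mu : J.mu.K →+* J.K))
      (c' := (Coset.conj h' : J.K →+* J.mu.K)) (Coset.conj_theta h')
      (Coset.conj_conj J.mu_mu h') h
  exact this _ J.mu_mu.symm _

theorem isAdmissible_iff {z : ∀ J : P.Coset, J.Kˣ}
    (hz : ∀ (J : P.Coset) (u : J.Kˣ), u ∈ Subgroup.zpowers (z J))
    {T : Set P.Coset} (hT : ∀ J : P.Coset, J.mu ≠ J → (J ∈ T ↔ J.mu ∉ T))
    (D : ∀ J : P.Coset, Ideal J.R) :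
    IsAdmissible z T D ↔ P.IsSelfOrthogonal (P.code D) := by
  rw [isSelfOrthogonal_code_iff]
  constructor
  · rintro ⟨h1, h2, h3, h4⟩
    have hmem : ∀ J : P.Coset, J.mu ≠ J → J ∈ T → Coset.Orth J.mu_mu (D J) (D J.mu) := by
      intro J hJ hJT
      by_cases hf : J.IsFixed
      · exact (Coset.caseII_iff_orth rfl J.mu_mu hf (hz J) _ _).1 (h2 J hJ hJT hf)
      · exact (Coset.caseIV_iff_orth hf rfl J.mu_mu (hz J) (fun h => hf (Coset.isFixed_mu_iff.1 h))
          (hz J.mu) _ _).1 (h4 J hJ hJT hf)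
    intro J
    by_cases hJ : J.mu = J
    · rw [Coset.orth_mu_iff_self hJ]
      by_cases hf : J.IsFixed
      · exact (Coset.caseI_iff_orth hJ hf (hz J) _).1 (h1 J hJ hf)
      · exact (Coset.caseIII_iff_orth hf hJ (hz J) _).1 (h3 J hJ hf)
    · by_cases hJT : J ∈ T
      · exact hmem J hJ hJT
      -- Here -J lies in T, and the condition at J follows from the one at -J by symmetry.
      · have hmu : J.mu.mu ≠ J.mu := by rw [J.mu_mu]; exact Ne.symm hJ
        have hT' : J.mu ∈ T := by
          by_contra hcon
          exact hJT ((hT J hJ).2 hcon)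
        have h5 := Coset.orth_mu_symm D (hmem J.mu hmu hT')
        have : ∀ (J' : P.Coset) (e : J' = J) , Coset.Orth J'.mu_mu (D J') (D J'.mu) →
            Coset.Orth J.mu_mu (D J) (D J.mu) := by
          rintro _ rfl h
          exact h
        exact this _ J.mu_mu h5
  · intro h
    refine ⟨fun J hJ hf => ?_, fun J hJ hJT hf => ?_, fun J hJ hf => ?_, fun J hJ hJT hf => ?_⟩
    · exact (Coset.caseI_iff_orth hJ hf (hz J) _).2 ((Coset.orth_mu_iff_self hJ D).1 (h J))
    · exact (Coset.caseII_iff_orth rfl J.mu_mu hf (hz J) _ _).2 (h J)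
    · exact (Coset.caseIII_iff_orth hf hJ (hz J) _).2 ((Coset.orth_mu_iff_self hJ D).1 (h J))
    · exact (Coset.caseIV_iff_orth hf rfl J.mu_mu (hz J) (fun h => hf (Coset.isFixed_mu_iff.1 h))
          (hz J.mu) _ _).2 (h J)

end MetacyclicData

end

/-- All self-orthogonal left metacyclic codes, each exactly once, with the numbers of admissible
pairs of components. -/
theorem theorem4p6 {F L : Type*} [Field F] [Fintype F] [Field L] [Algebra F L]
    (P : MetacyclicData F L)
    (z : ∀ J : P.Coset, J.Kˣ) (hz : ∀ (J : P.Coset) (u : J.Kˣ), u ∈ Subgroup.zpowers (z J))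
    (T : Set P.Coset) (hT : ∀ J : P.Coset, J.mu ≠ J → (J ∈ T ↔ J.mu ∉ T)) :
    Set.BijOn P.code {D | MetacyclicData.IsAdmissible z T D}
      {C | P.IsLeftCode C ∧ P.IsSelfOrthogonal C} ∧
    (∀ D : ∀ J : P.Coset, Ideal J.R, iSupIndep fun J : P.Coset => J.concat (D J)) ∧
    (∀ J : P.Coset, J.mu ≠ J → J.IsFixed →
      (P.q ≡ 0 [MOD 3] →
        {p : Ideal J.R × Ideal J.mu.R | J.CaseII J.mu rfl (z J) p.1 p.2}.ncard = 10) ∧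
      (P.q ^ J.d ≡ 2 [MOD 3] →
        {p : Ideal J.R × Ideal J.mu.R | J.CaseII J.mu rfl (z J) p.1 p.2}.ncard = 9) ∧
      (P.q ^ J.d ≡ 1 [MOD 3] →
        {p : Ideal J.R × Ideal J.mu.R | J.CaseII J.mu rfl (z J) p.1 p.2}.ncard = 27)) ∧
    (∀ J : P.Coset, J.mu ≠ J → ¬ J.IsFixed →
      {p : Ideal J.R × Ideal J.mu.R | J.CaseIV J.mu rfl (z J) (z J.mu) p.1 p.2}.ncard =
        10 + 8 * P.q ^ (J.d / 3) + 8 * P.q ^ (2 * J.d / 3) + P.q ^ J.d ∧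
      (∀ C' : Ideal J.mu.R, J.mu.IsListed (z J.mu) C') ∧
      {p : Ideal J.R × Ideal J.mu.R | J.CaseIV1 J.mu (z J.mu) p.1 p.2}.ncard =
        4 + 2 * P.q ^ (J.d / 3) + 2 * P.q ^ (2 * J.d / 3) ∧
      {p : Ideal J.R × Ideal J.mu.R | J.CaseIV2 J.mu rfl (z J) p.1 p.2}.ncard =
        (1 + P.q ^ (J.d / 3) + P.q ^ (2 * J.d / 3)) * (3 + P.q ^ (J.d / 3)) ∧
      (∀ α ∈ J.Gr (z J),
        {C' : Ideal J.mu.R | J.PartnerC1 J.mu rfl (z J) α C'}.ncard = 3 + P.q ^ (J.d / 3)) ∧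
      {p : Ideal J.R × Ideal J.mu.R | J.CaseIV3 J.mu rfl (z J) p.1 p.2}.ncard =
        2 * (1 + P.q ^ (J.d / 3) + P.q ^ (2 * J.d / 3)) ∧
      (∀ α ∈ J.Gr (z J), {C' : Ideal J.mu.R | J.PartnerC2 J.mu rfl α C'}.ncard = 2) ∧
      {p : Ideal J.R × Ideal J.mu.R | J.CaseIV4 J.mu p.1 p.2}.ncard = 1) := by
  refine ⟨⟨fun D hD => ?_, MetacyclicData.code_injective.injOn, fun C hC => ?_⟩,
    MetacyclicData.iSupIndep_concat, fun J _ hf => ?_, fun J _ hf => ?_⟩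
  · exact ⟨MetacyclicData.isLeftCode_code D, (MetacyclicData.isAdmissible_iff hz hT D).1 hD⟩
  · obtain ⟨D, rfl⟩ := MetacyclicData.exists_code_eq hC.1
    exact ⟨D, (MetacyclicData.isAdmissible_iff hz hT D).2 hC.2, rfl⟩
  · exact MetacyclicData.Coset.ncard_caseII rfl J.mu_mu hf (hz J)
  · exact MetacyclicData.Coset.ncard_caseIV hf rfl J.mu_mu (hz J)
      (fun h => hf (MetacyclicData.Coset.isFixed_mu_iff.1 h)) (hz J.mu)
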